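/- An instance of the Euclidean TSP is a finite set $V \subset \mathbb{R}^2$ with $n \ge 3$ points; let $c(x,y)$ denote the Euclidean distance. A tour for $V$ is a cycle in the complete graph on $V$ that contains all points of $V$; its length is the sum of the Euclidean lengths of its edges, and a tour is optimal if it has minimum length among all tours for $V$. Orient a tour $T$ as a directed cycle. If two distinct directed edges $(a,b)$ and $(x,y)$ of $T$ satisfy $c(a,x)+c(b,y) < c(a,b)+c(x,y)$, then replacing them by the edges $\{a,x\}$ and $\{b,y\}$ gives a shorter tour; this is called an improving 2-move. The 2-Opt heuristic starts with an arbitrary tour, performs improving 2-moves as long as one exists, and returns the tour reached; the tours it can return are exactly the 2-optimal tours, i.e. those with no improving 2-move. For $n \ge 3$ let $\rho(n)$ be the approximation ratio of the 2-Opt heuristic on instances with $n$ points, i.e. the supremum, over all $V \subset \mathbb{R}^2$ with $|V| = n$ and all tours $S$ for $V$ that the heuristic can return, of the length of $S$ divided by the length of an optimal tour for $V$. **Theorem.** For every $n \ge 3$ the supremum $\rho(n)$ is taken over a nonempty bounded set of real numbers, and $$\rho(n) = \Theta\!\left(\frac{\log n}{\log\log n}\right) \qquad (n \to \infty),$$ i.e.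 there are constants $c, C > 0$ and $n_0$ such that $c\,\frac{\log n}{\log\log n} \le \rho(n) \le C\,\frac{\log n}{\log\log n}$ for all $n \ge n_0$. -/

import Mathlib

namespace EuclideanTSP

/-- The Euclidean plane. -/
abbrev Plane : Type := EuclideanSpace ℝ (Fin 2)

/-- An oriented tour for the finite point set `V`, given by its successor map `σ`: the oriented
edges are the pairs `(v, σ v)`, and they form one single cycle through all the points of `V`.
As a cycle in a graph, a tour has at least three vertices. -/
def IsTour {V : Finset Plane} (σ : Equiv.Perm V) : Prop :=
  3 ≤ V.card ∧ σ.IsCycleOn Set.univ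

/-- The set of (unoriented) edges of a tour. -/
def edges {V : Finset Plane} (σ : Equiv.Perm V) : Set (Sym2 V) :=
  Set.range fun v : V => s(v, σ v)

/-- The length of a tour: the sum of the Euclidean lengths of its edges. -/
noncomputable def length {V : Finset Plane} (σ : Equiv.Perm V) : ℝ :=
  ∑ v : V, dist v (σ v)

/-- An optimal tour: a tour of minimum length among all tours for `V`. -/
def IsOptimalTour {V : Finset Plane} (σ : Equiv.Perm V) : Prop :=
  IsTour σ ∧ ∀ τ : Equiv.Perm V, IsTour τ → length σ ≤ length τ

/-- The two oriented edges `(a, σ a)` and `(x, σ x)` are distinct and violate the 2-optimality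
condition: the edges `{a, x}` and `{σ a, σ x}` are together strictly shorter. -/
def IsImprovingPair {V : Finset Plane} (σ : Equiv.Perm V) (a x : V) : Prop :=
  a ≠ x ∧ dist a x + dist (σ a) (σ x) < dist a (σ a) + dist x (σ x)

/-- `τ` is a tour that results from the tour `σ` by an improving 2-move: two oriented edges
`(a, b)` and `(x, y)` of `σ` that violate the 2-optimality condition are replaced by `{a, x}` and
`{b, y}`. The orientation of the resulting cycle may be chosen freely. -/
def ImprovingTwoMove {V : Finset Plane} (σ τ : Equiv.Perm V) : Prop :=
  IsTour σ ∧ IsTour τ ∧ ∃ a x : V, IsImprovingPair σ a x ∧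
    edges τ = (edges σ \ {s(a, σ a), s(x, σ x)}) ∪ {s(a, x), s(σ a, σ x)}

/-- A 2-optimal tour: for any two distinct oriented edges `(a, b)` and `(x, y)` of the tour,
`c(a, x) + c(b, y) ≥ c(a, b) + c(x, y)`. -/
def IsTwoOptimal {V : Finset Plane} (σ : Equiv.Perm V) : Prop :=
  IsTour σ ∧ ∀ a x : V, a ≠ x →
    dist a (σ a) + dist x (σ x) ≤ dist a x + dist (σ a) (σ x)

/-- `σ` is a possible output of the 2-Opt heuristic: start with an arbitrary tour, perform
improving 2-moves, and stop at a tour that is 2-optimal, i.e. has no improving 2-move. -/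
def IsTwoOptOutput {V : Finset Plane} (σ : Equiv.Perm V) : Prop :=
  ∃ σ₀ : Equiv.Perm V, IsTour σ₀ ∧ Relation.ReflTransGen ImprovingTwoMove σ₀ σ ∧ IsTwoOptimal σ

/-- All ratios between the length of an output of the 2-Opt heuristic and the length of an optimal
tour, over all Euclidean TSP instances with exactly `n` points. -/
def twoOptRatios (n : ℕ) : Set ℝ :=
  {r | ∃ V : Finset Plane, V.card = n ∧ ∃ σ τ : Equiv.Perm V,
    IsTwoOptOutput σ ∧ IsOptimalTour τ ∧ r = length σ / length τ}

/-- The (worst-case) approximation ratio of the 2-Opt heuristic for Euclidean TSP instances with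
`n` points. -/
noncomputable def twoOptApproxRatio (n : ℕ) : ℝ :=
  sSup (twoOptRatios n)

end EuclideanTSP

/-!
Edges of a 2-optimal tour do not cross. So the optimal tour `τ` is a simple polygon, and after its
refinement at the points where it meets the edges of a 2-optimal tour `σ`, these edges become
chords of the polygon. By the Jordan curve theorem for polygons, chords on the same side do not
interleave, so those that are directed alike form a laminar family of index intervals, hence a tree.
The gap of a node consists of the edges of the polygon below it that are not below its children. By
2-optimality, the children of a node together with its gap are longer than the node by at least
twice the longest child, so these longest children have a total length of at most half of `τ`. A
node whose children have more than `K` times the length of the longest one gains `log K` in entropy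
per unit of their length, and the entropy of the gaps is at most `O(log n)` times the length of `τ`.
So `σ` is longer than `τ` by a factor of `O(K + log n / log K)`, and `K = √(log n)` gives the
upper bound.

For the lower bound, place points on about `log n / log log n` horizontal layers whose heights and
spacings shrink geometrically. The tour that goes through the layers back and forth is 2-optimal
and traverses the unit width once per layer, whereas a closed walk of bounded length, which goes
along the densest layer and makes vertical detours, visits all points.
-/

namespace EuclideanTSP

section Entropy

open Finset

/-- The entropy function `x ↦ x (1 + log A - log x)`, which is increasing and subadditive on
`[0, A]`. It measures the total weight of the nodes of a tree on a logarithmic scale. -/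
noncomputable def entropyTerm (A x : ℝ) : ℝ := x * (1 + Real.log A - Real.log x)

@[simp] lemma entropyTerm_zero (A : ℝ) : entropyTerm A 0 = 0 := by simp [entropyTerm]

lemma entropyTerm_nonneg {A x : ℝ} (hx : 0 ≤ x) (hxA : x ≤ A) : 0 ≤ entropyTerm A x := by
  rcases hx.eq_or_lt with rfl | hx
  · simp
  · have := Real.log_le_log hx hxA
    exact mul_nonneg hx.le (by linarith)

lemma entropyTerm_mono {A x y : ℝ} (hx : 0 ≤ x) (hxy : x ≤ y) (hy : y ≤ A) :
    entropyTerm A x ≤ entropyTerm A y := by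
  rcases hx.eq_or_lt with rfl | hx
  · simpa using entropyTerm_nonneg hxy hy
  have hy0 : 0 < y := hx.trans_le hxy
  have hlog : x * (Real.log y - Real.log x) ≤ y - x := by
    rw [← Real.log_div hy0.ne' hx.ne']
    calc x * Real.log (y / x) ≤ x * (y / x - 1) := by
          gcongr
          exact Real.log_le_sub_one_of_pos (by positivity)
      _ = y - x := by field_simp
  have hyA := Real.log_le_log hy0 hy
  unfold entropyTerm
  nlinarith [mul_nonneg (sub_nonneg.2 hxy) (sub_nonneg.2 hyA)]

lemma entropyTerm_add_le {A x y : ℝ} (hx : 0 ≤ x) (hy : 0 ≤ y) :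
    entropyTerm A (x + y) ≤ entropyTerm A x + entropyTerm A y := by
  rcases hx.eq_or_lt with rfl | hx
  · simp
  rcases hy.eq_or_lt with rfl | hy
  · simp
  have hlogx : Real.log x ≤ Real.log (x + y) := Real.log_le_log hx (by linarith)
  have hlogy : Real.log y ≤ Real.log (x + y) := Real.log_le_log hy (by linarith)
  unfold entropyTerm
  nlinarith [mul_le_mul_of_nonneg_left hlogx hx.le, mul_le_mul_of_nonneg_left hlogy hy.le]

lemma entropyTerm_mul_le {N T x : ℝ} (hN : 0 < N) (hT : 0 < T) (hx : 0 ≤ x) :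
    entropyTerm (N * T) x ≤ x * (2 * Real.log N) + T / N := by
  rcases hx.eq_or_lt with rfl | hx
  · simp only [entropyTerm_zero, zero_mul, zero_add]
    positivity
  have hlog : Real.log (T / (N * x)) ≤ T / (N * x) - 1 :=
    Real.log_le_sub_one_of_pos (by positivity)
  rw [Real.log_div hT.ne' (by positivity), Real.log_mul hN.ne' hx.ne'] at hlog
  have hmul : x * (T / (N * x) - 1) = T / N - x := by field_simp
  unfold entropyTerm
  rw [Real.log_mul hN.ne' hT.ne']
  nlinarith [mul_le_mul_of_nonneg_left hlog hx.le]

lemma sum_entropyTerm_le {ι : Type*} (s : Finset ι) (g : ι → ℝ) (hg : ∀ i ∈ s, 0 ≤ g i)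
    (hs : 0 < ∑ i ∈ s, g i) :
    ∑ i ∈ s, entropyTerm (#s * ∑ i ∈ s, g i) (g i) ≤
      (∑ i ∈ s, g i) * (1 + 2 * Real.log #s) := by
  have hcard : (0 : ℝ) < #s := by
    rw [Nat.cast_pos, card_pos]
    exact nonempty_of_sum_ne_zero hs.ne'
  calc ∑ i ∈ s, entropyTerm (#s * ∑ i ∈ s, g i) (g i)
      ≤ ∑ i ∈ s, (g i * (2 * Real.log #s) + (∑ i ∈ s, g i) / #s) :=
        sum_le_sum fun i hi => entropyTerm_mul_le hcard hs (hg i hi)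
    _ = (∑ i ∈ s, g i) * (1 + 2 * Real.log #s) := by
        rw [sum_add_distrib, ← sum_mul, sum_const, nsmul_eq_mul]
        field_simp
        ring

lemma le_mul_add_mul_log_div {S M K : ℝ} (hK : 1 < K) (hM : 0 < M) (hMS : M ≤ S) :
    S ≤ K * M + S * (Real.log S - Real.log M) / Real.log K := by
  have hS : 0 < S := hM.trans_le hMS
  have hlogK : 0 < Real.log K := Real.log_pos hK
  rcases le_or_gt S (K * M) with hle | hlt
  · have hlog := sub_nonneg.2 (Real.log_le_log hM hMS)
    have : 0 ≤ S * (Real.log S - Real.log M) / Real.log K := by positivity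
    linarith
  · have hlog := Real.log_le_log (by positivity) hlt.le
    rw [Real.log_mul (by positivity) hM.ne'] at hlog
    have : S ≤ S * (Real.log S - Real.log M) / Real.log K := by
      rw [le_div_iff₀ hlogK]
      gcongr
      linarith
    have : 0 ≤ K * M := by positivity
    linarith

end Entropy

section GapTree

open Finset

/-- A rooted tree with node weights and gaps, given by its root, the set `inner` of its other nodes,
and their parents. The model is a noncrossing family of chords of a closed path, which is itself the
root: the weight of a chord is its length, its parent is the next larger chord, and its gap is the
length of the part of the path that it cuts off and its children do not. Then `weight_le` is the
triangle inequality and `weight_parent_add_le` is 2-optimality of a chord and its parent. -/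
structure GapTree (α : Type*) [DecidableEq α] where
  root : α
  inner : Finset α
  parent : α → α
  weight : α → ℝ
  gap : α → ℝ
  root_notMem : root ∉ inner
  parent_mem : ∀ f ∈ inner, parent f ∈ insert root inner
  weight_nonneg : ∀ e, 0 ≤ weight e
  gap_nonneg : ∀ e, 0 ≤ gap e
  weight_root : weight root = 0
  weight_le_sum_gap : ∀ f ∈ inner, weight f ≤ ∑ e ∈ insert root inner, gap e
  weight_le : ∀ e ∈ insert root inner, weight e ≤ (∑ f ∈ inner with parent f = e, weight f) + gap e
  weight_parent_add_le : ∀ f ∈ inner, weight (parent f) + 2 * weight f ≤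
    (∑ f' ∈ inner with parent f' = parent f, weight f') + gap (parent f)

namespace GapTree

variable {α : Type*} [DecidableEq α] (G : GapTree α)

/-- All nodes of the tree. -/
def nodes : Finset α := insert G.root G.inner

/-- The children of a node. -/
def children (e : α) : Finset α := {f ∈ G.inner | G.parent f = e}

/-- The sum of the weights of the children of a node. -/
noncomputable def childSum (e : α) : ℝ := ∑ f ∈ G.children e, G.weight f

/-- The largest weight of a child of a node, which is `0` for a node without children. -/
noncomputable def childMax (e : α) : ℝ := ⨆ f : G.children e, G.weight f

/-- The sum of all gaps. -/
noncomputable def totalGap : ℝ := ∑ e ∈ G.nodes, G.gap e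

lemma mem_children {e f : α} : f ∈ G.children e ↔ f ∈ G.inner ∧ G.parent f = e := mem_filter

lemma card_nodes : #G.nodes = #G.inner + 1 := card_insert_of_notMem G.root_notMem

lemma sum_nodes_of_root {h : α → ℝ} (hroot : h G.root = 0) :
    ∑ e ∈ G.nodes, h e = ∑ f ∈ G.inner, h f := by
  rw [nodes, sum_insert G.root_notMem, hroot, zero_add]

lemma sum_sum_children (h : α → ℝ) :
    ∑ e ∈ G.nodes, ∑ f ∈ G.children e, h f = ∑ f ∈ G.inner, h f :=
  sum_fiberwise_of_maps_to G.parent_mem h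

lemma childSum_nonneg (e : α) : 0 ≤ G.childSum e := sum_nonneg fun f _ => G.weight_nonneg f

lemma childMax_nonneg (e : α) : 0 ≤ G.childMax e := Real.iSup_nonneg fun f => G.weight_nonneg f

lemma weight_le_childMax {e f : α} (hf : f ∈ G.children e) : G.weight f ≤ G.childMax e :=
  le_ciSup (f := fun f : G.children e => G.weight f) (Set.finite_range _).bddAbove ⟨f, hf⟩

lemma childMax_le_childSum (e : α) : G.childMax e ≤ G.childSum e :=
  Real.iSup_le (fun f => single_le_sum (fun f _ => G.weight_nonneg f) f.2) (G.childSum_nonneg e)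

lemma weight_add_two_mul_childMax_le {e : α} (he : e ∈ G.nodes) :
    G.weight e + 2 * G.childMax e ≤ G.childSum e + G.gap e := by
  have hmax : G.childMax e ≤ (G.childSum e + G.gap e - G.weight e) / 2 := by
    refine Real.iSup_le (fun ⟨f, hf⟩ => ?_) ?_
    · obtain ⟨hfi, rfl⟩ := G.mem_children.1 hf
      have := G.weight_parent_add_le f hfi
      simp only [childSum, children]
      linarith
    · have : G.weight e ≤ G.childSum e + G.gap e := G.weight_le e he
      linarith
  linarith

lemma two_mul_sum_childMax_le : 2 * ∑ e ∈ G.nodes, G.childMax e ≤ G.totalGap := by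
  have hsum := sum_le_sum fun e he => G.weight_add_two_mul_childMax_le (e := e) he
  rw [sum_add_distrib, sum_add_distrib, ← mul_sum, G.sum_nodes_of_root G.weight_root] at hsum
  have hchildren := G.sum_sum_children G.weight
  simp only [childSum] at hsum
  unfold totalGap
  linarith

lemma childSum_add_gap_le {e : α} (he : e ∈ G.nodes) :
    G.childSum e + G.gap e ≤ #G.nodes * G.totalGap := by
  have hchild : G.childSum e ≤ #G.inner * G.totalGap :=
    calc G.childSum e ≤ ∑ f ∈ G.inner, G.weight f :=
          sum_le_sum_of_subset_of_nonneg (filter_subset _ _) fun f _ _ => G.weight_nonneg f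
      _ ≤ ∑ _f ∈ G.inner, G.totalGap := sum_le_sum G.weight_le_sum_gap
      _ = #G.inner * G.totalGap := by rw [sum_const, nsmul_eq_mul]
  have hgap : G.gap e ≤ G.totalGap := single_le_sum (fun e _ => G.gap_nonneg e) he
  rw [card_nodes]
  push_cast
  linarith

lemma entropyTerm_childSum_add_le (A : ℝ) (e : α) :
    entropyTerm A (G.childSum e) +
        G.childSum e * (Real.log (G.childSum e) - Real.log (G.childMax e)) ≤
      ∑ f ∈ G.children e, entropyTerm A (G.weight f) :=
  calc _ = ∑ f ∈ G.children e, G.weight f * (1 + Real.log A - Real.log (G.childMax e)) := by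
        rw [← sum_mul, ← childSum, entropyTerm]
        ring
    _ ≤ ∑ f ∈ G.children e, entropyTerm A (G.weight f) := by
        refine sum_le_sum fun f hf => ?_
        rcases (G.weight_nonneg f).eq_or_lt with hzero | hpos
        · simp [← hzero]
        · have := Real.log_le_log hpos (G.weight_le_childMax hf)
          unfold entropyTerm
          gcongr

lemma entropyTerm_weight_le {e : α} (he : e ∈ G.nodes) :
    entropyTerm (#G.nodes * G.totalGap) (G.weight e) ≤
      entropyTerm (#G.nodes * G.totalGap) (G.childSum e) +
        entropyTerm (#G.nodes * G.totalGap) (G.gap e) :=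
  (entropyTerm_mono (G.weight_nonneg e) (G.weight_le e he) (G.childSum_add_gap_le he)).trans
    (entropyTerm_add_le (G.childSum_nonneg e) (G.gap_nonneg e))

-- The entropies of the weights cancel in the sum over all nodes, as every node is a child once.
lemma sum_childSum_mul_log_le (hgap : 0 < G.totalGap) :
    ∑ e ∈ G.nodes, G.childSum e * (Real.log (G.childSum e) - Real.log (G.childMax e)) ≤
      G.totalGap * (1 + 2 * Real.log #G.nodes) := by
  have hchild := sum_le_sum fun e (_ : e ∈ G.nodes) =>
    G.entropyTerm_childSum_add_le (#G.nodes * G.totalGap) e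
  have hweight := sum_le_sum fun e he => G.entropyTerm_weight_le (e := e) he
  rw [sum_add_distrib] at hchild hweight
  rw [G.sum_sum_children fun f => entropyTerm (#G.nodes * G.totalGap) (G.weight f)] at hchild
  rw [G.sum_nodes_of_root (by simp [G.weight_root])] at hweight
  have := sum_entropyTerm_le G.nodes G.gap (fun e _ => G.gap_nonneg e) hgap
  rw [← totalGap] at this
  linarith

lemma childSum_le {K : ℝ} (hK : 1 < K) (e : α) :
    G.childSum e ≤ K * G.childMax e +
      G.childSum e * (Real.log (G.childSum e) - Real.log (G.childMax e)) / Real.log K := by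
  rcases (G.childMax_nonneg e).eq_or_lt with hzero | hpos
  · have : G.childSum e = 0 := le_antisymm
      (sum_nonpos fun f hf => (G.weight_le_childMax hf).trans hzero.ge) (G.childSum_nonneg e)
    simp [this, ← hzero]
  · exact le_mul_add_mul_log_div hK hpos (G.childMax_le_childSum e)

lemma sum_weight_le {K : ℝ} (hK : 1 < K) :
    ∑ f ∈ G.inner, G.weight f ≤
      G.totalGap * (K / 2 + (1 + 2 * Real.log #G.nodes) / Real.log K) := by
  rcases (sum_nonneg fun e (_ : e ∈ G.nodes) => G.gap_nonneg e).eq_or_lt with hzero | hpos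
  · rw [← totalGap] at hzero
    rw [← hzero, zero_mul]
    exact sum_nonpos fun f hf => (G.weight_le_sum_gap f hf).trans hzero.ge
  have hlogK : 0 < Real.log K := Real.log_pos hK
  calc ∑ f ∈ G.inner, G.weight f = ∑ e ∈ G.nodes, G.childSum e :=
        (G.sum_sum_children G.weight).symm
    _ ≤ ∑ e ∈ G.nodes, (K * G.childMax e +
          G.childSum e * (Real.log (G.childSum e) - Real.log (G.childMax e)) / Real.log K) :=
        sum_le_sum fun e _ => G.childSum_le hK e
    _ = K / 2 * (2 * ∑ e ∈ G.nodes, G.childMax e) +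
          (∑ e ∈ G.nodes, G.childSum e * (Real.log (G.childSum e) - Real.log (G.childMax e))) /
            Real.log K := by
        rw [sum_add_distrib, ← mul_sum, ← sum_div]
        ring
    _ ≤ K / 2 * G.totalGap + G.totalGap * (1 + 2 * Real.log #G.nodes) / Real.log K := by
        gcongr
        · exact G.two_mul_sum_childMax_le
        · exact G.sum_childSum_mul_log_le hpos
    _ = G.totalGap * (K / 2 + (1 + 2 * Real.log #G.nodes) / Real.log K) := by ring

end GapTree

end GapTree

section Shortcuts

open Finset

variable {X : Type*} [PseudoMetricSpace X] (t : ℕ → X) (D : Finset (ℕ × ℕ))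

/-- The length of the path from `t i` to `t k` that follows `t`, but jumps over the index intervals
in `D` that lie in `[i, k]`. -/
noncomputable def shortcutLength (i k : ℕ) : ℝ :=
  (∑ d ∈ D with i ≤ d.1 ∧ d.2 ≤ k, dist (t d.1) (t d.2)) +
    ∑ r ∈ Ico i k with ∀ d ∈ D, ¬ (d.1 ≤ r ∧ r < d.2), dist (t r) (t (r + 1))

lemma shortcutLength_nonneg (i k : ℕ) : 0 ≤ shortcutLength t D i k :=
  add_nonneg (sum_nonneg fun _ _ => dist_nonneg) (sum_nonneg fun _ _ => dist_nonneg)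

variable {t D}

lemma shortcutLength_add_le (hD : ∀ d ∈ D, d.1 < d.2) {i j k : ℕ} (hij : i ≤ j) (hjk : j ≤ k) :
    shortcutLength t D i j + shortcutLength t D j k ≤ shortcutLength t D i k := by
  unfold shortcutLength
  rw [add_add_add_comm, ← sum_union, ← sum_union]
  · refine add_le_add (sum_le_sum_of_subset_of_nonneg ?_ fun _ _ _ => dist_nonneg)
      (sum_le_sum_of_subset_of_nonneg ?_ fun _ _ _ => dist_nonneg)
    · grind
    · grind
  · grind [disjoint_left]
  · grind [disjoint_left]

lemma dist_le_shortcutLength_of_mem {d : ℕ × ℕ} (hd : d ∈ D) :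
    dist (t d.1) (t d.2) ≤ shortcutLength t D d.1 d.2 :=
  (single_le_sum (f := fun d : ℕ × ℕ => dist (t d.1) (t d.2)) (fun _ _ => dist_nonneg)
    (by simp [hd])).trans (le_add_of_nonneg_right (sum_nonneg fun _ _ => dist_nonneg))

lemma dist_le_shortcutLength_succ {r : ℕ} (hr : ∀ d ∈ D, ¬ (d.1 ≤ r ∧ r < d.2)) :
    dist (t r) (t (r + 1)) ≤ shortcutLength t D r (r + 1) :=
  (single_le_sum (f := fun r => dist (t r) (t (r + 1))) (fun _ _ => dist_nonneg)
    (by simpa using hr)).trans (le_add_of_nonneg_left (sum_nonneg fun _ _ => dist_nonneg))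

lemma dist_le_shortcutLength (hD : ∀ d ∈ D, d.1 < d.2)
    (hdisj : ∀ d ∈ D, ∀ d' ∈ D, d ≠ d' → d.2 ≤ d'.1 ∨ d'.2 ≤ d.1) {i k : ℕ} (hik : i ≤ k)
    (hin : ∀ d ∈ D, d.1 < k → i < d.2 → i ≤ d.1 ∧ d.2 ≤ k) :
    dist (t i) (t k) ≤ shortcutLength t D i k := by
  induction k using Nat.strong_induction_on with
  | _ k ih =>
  rcases hik.eq_or_lt with rfl | hlt
  · rw [dist_self]
    exact shortcutLength_nonneg t D i i
  suffices ∃ j, i ≤ j ∧ j < k ∧ (∀ d ∈ D, d.1 < j → i < d.2 → d.2 ≤ j) ∧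
      dist (t j) (t k) ≤ shortcutLength t D j k by
    obtain ⟨j, hij, hjk, hj, hdist⟩ := this
    calc dist (t i) (t k) ≤ dist (t i) (t j) + dist (t j) (t k) := dist_triangle _ _ _
      _ ≤ shortcutLength t D i j + shortcutLength t D j k := by
          gcongr
          exact ih j hjk hij fun d hd hdj hid => ⟨(hin d hd (by omega) hid).1, hj d hd hdj hid⟩
      _ ≤ shortcutLength t D i k := shortcutLength_add_le hD hij hjk.le
  obtain ⟨k, rfl⟩ : ∃ l, k = l + 1 := ⟨k - 1, by omega⟩
  by_cases hcov : ∃ d ∈ D, d.1 ≤ k ∧ k < d.2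
  · obtain ⟨d, hd, hdk, hkd⟩ := hcov
    have hdi := hin d hd (by omega) (by omega)
    have hdk : d.2 = k + 1 := by omega
    refine ⟨d.1, hdi.1, hdk ▸ hD d hd, fun d' hd' _ _ => ?_,
      hdk ▸ dist_le_shortcutLength_of_mem hd⟩
    have := hdisj d hd d' hd'
    have := hD d' hd'
    grind
  · push Not at hcov
    refine ⟨k, by omega, by omega, fun d hd hdk _ => ?_,
      dist_le_shortcutLength_succ fun d hd h => (hcov d hd h.1).not_gt h.2⟩
    exact hcov d hd hdk.le

end Shortcuts

section Laminar

open Finset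

/-- A shortest interval in `G` that contains `[a, b]`, and `[0, m]` if there is none. -/
noncomputable def shortestCover (G : Finset (ℕ × ℕ)) (m a b : ℕ) : ℕ × ℕ :=
  if h : {e ∈ G | e.1 ≤ a ∧ b ≤ e.2}.Nonempty then
    (exists_min_image _ (fun e => e.2 - e.1) h).choose else (0, m)

/-- A family of index intervals of a closed sequence of length `m` whose chords do not cross. -/
structure IsLaminar (m : ℕ) (F : Finset (ℕ × ℕ)) : Prop where
  fst_lt_snd : ∀ f ∈ F, f.1 < f.2
  snd_lt : ∀ f ∈ F, f.2 < m
  not_interleaved : ∀ e ∈ F, ∀ f ∈ F, ¬ (e.1 < f.1 ∧ f.1 < e.2 ∧ e.2 < f.2)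

/-- The smallest interval of a laminar family that properly contains `f`, where `[0, m]` serves as
the root. -/
noncomputable def laminarParent (F : Finset (ℕ × ℕ)) (m : ℕ) (f : ℕ × ℕ) : ℕ × ℕ :=
  shortestCover (F.erase f) m f.1 f.2

/-- The smallest interval of a laminar family that contains `[r, r + 1]`, where `[0, m]` serves as
the root. -/
noncomputable def laminarOwner (F : Finset (ℕ × ℕ)) (m r : ℕ) : ℕ × ℕ :=
  shortestCover F m r (r + 1)

lemma shortestCover_mem (G : Finset (ℕ × ℕ)) (m a b : ℕ) :
    shortestCover G m a b ∈ insert (0, m) G := by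
  unfold shortestCover
  split_ifs with h
  · have hmem := (exists_min_image _ (fun e : ℕ × ℕ => e.2 - e.1) h).choose_spec.1
    exact mem_insert_of_mem (mem_filter.1 hmem).1
  · exact mem_insert_self _ _

lemma shortestCover_covers (G : Finset (ℕ × ℕ)) {m a b : ℕ} (hb : b ≤ m) :
    (shortestCover G m a b).1 ≤ a ∧ b ≤ (shortestCover G m a b).2 := by
  unfold shortestCover
  split_ifs with h
  · have hmem := (exists_min_image _ (fun e : ℕ × ℕ => e.2 - e.1) h).choose_spec.1
    exact (mem_filter.1 hmem).2
  · exact ⟨a.zero_le, hb⟩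

lemma shortestCover_length_le {G : Finset (ℕ × ℕ)} {a b : ℕ} (m : ℕ) {e : ℕ × ℕ} (he : e ∈ G)
    (ha : e.1 ≤ a) (hb : b ≤ e.2) :
    (shortestCover G m a b).2 - (shortestCover G m a b).1 ≤ e.2 - e.1 := by
  have h : {e ∈ G | e.1 ≤ a ∧ b ≤ e.2}.Nonempty := ⟨e, mem_filter.2 ⟨he, ha, hb⟩⟩
  rw [shortestCover, dif_pos h]
  exact (exists_min_image _ (fun e : ℕ × ℕ => e.2 - e.1) h).choose_spec.2 e
    (mem_filter.2 ⟨he, ha, hb⟩)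

lemma laminarParent_mem (F : Finset (ℕ × ℕ)) (m : ℕ) (f : ℕ × ℕ) :
    laminarParent F m f ∈ insert (0, m) F :=
  insert_subset_insert _ (erase_subset _ _) (shortestCover_mem _ _ _ _)

lemma sum_sum_laminarOwner (F : Finset (ℕ × ℕ)) (m : ℕ) (g : ℕ → ℝ) :
    ∑ e ∈ insert (0, m) F, ∑ r ∈ range m with laminarOwner F m r = e, g r = ∑ r ∈ range m, g r :=
  sum_fiberwise_of_maps_to (fun r _ => shortestCover_mem F m r (r + 1)) g

namespace IsLaminar

variable {m : ℕ} {F : Finset (ℕ × ℕ)}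

lemma mono (h : IsLaminar m F) {G : Finset (ℕ × ℕ)} (hG : G ⊆ F) : IsLaminar m G where
  fst_lt_snd f hf := h.fst_lt_snd f (hG hf)
  snd_lt f hf := h.snd_lt f (hG hf)
  not_interleaved e he f hf := h.not_interleaved e (hG he) f (hG hf)

lemma bounds (h : IsLaminar m F) {e : ℕ × ℕ} (he : e ∈ insert (0, m) F) : e.1 ≤ e.2 ∧ e.2 ≤ m := by
  rcases mem_insert.1 he with rfl | he
  · simp
  · exact ⟨(h.fst_lt_snd e he).le, (h.snd_lt e he).le⟩

lemma shortestCover_subset (h : IsLaminar m F) {a b : ℕ} (hab : a < b) (hb : b ≤ m) {e : ℕ × ℕ}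
    (he : e ∈ insert (0, m) F) (hea : e.1 ≤ a) (hbe : b ≤ e.2) :
    e.1 ≤ (shortestCover F m a b).1 ∧ (shortestCover F m a b).2 ≤ e.2 := by
  obtain ⟨hca, hbc⟩ := shortestCover_covers F (a := a) hb
  have hc := shortestCover_mem F m a b
  have hbounds := h.bounds hc
  rcases mem_insert.1 he with rfl | he
  · exact ⟨Nat.zero_le _, hbounds.2⟩
  have hlen := shortestCover_length_le m he hea hbe
  rcases mem_insert.1 hc with hroot | hc
  · have := h.snd_lt e he
    rw [hroot] at hlen ⊢
    omega
  · have := h.not_interleaved e he _ hc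
    have := h.not_interleaved _ hc e he
    omega

lemma parent_covers (h : IsLaminar m F) {f : ℕ × ℕ} (hf : f ∈ F) :
    (laminarParent F m f).1 ≤ f.1 ∧ f.2 ≤ (laminarParent F m f).2 :=
  shortestCover_covers _ (h.snd_lt f hf).le

lemma parent_ne (h : IsLaminar m F) {f : ℕ × ℕ} (hf : f ∈ F) : laminarParent F m f ≠ f := by
  intro heq
  have hmem := shortestCover_mem (F.erase f) m f.1 f.2
  rw [← laminarParent, heq, mem_insert, mem_erase] at hmem
  rcases hmem with rfl | hmem
  · exact (h.snd_lt _ hf).false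
  · exact hmem.1 rfl

lemma parent_subset (h : IsLaminar m F) {e f : ℕ × ℕ} (hf : f ∈ F)
    (he : e ∈ insert (0, m) F) (hef : e ≠ f) (hsub : e.1 ≤ f.1 ∧ f.2 ≤ e.2) :
    e.1 ≤ (laminarParent F m f).1 ∧ (laminarParent F m f).2 ≤ e.2 :=
  (h.mono (erase_subset f F)).shortestCover_subset (h.fst_lt_snd f hf) (h.snd_lt f hf).le
    (by grind) hsub.1 hsub.2

lemma mem_of_subset (h : IsLaminar m F) {e p : ℕ × ℕ} (he : e ∈ insert (0, m) F)
    (hp : p ∈ insert (0, m) F) (hpe : p ≠ e) (hsub : e.1 ≤ p.1 ∧ p.2 ≤ e.2) : p ∈ F := by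
  refine (mem_insert.1 hp).resolve_left ?_
  rintro rfl
  have := h.bounds he
  exact hpe (Prod.ext (by grind) (by grind))

lemma exists_child_covers (h : IsLaminar m F) {e f : ℕ × ℕ} (he : e ∈ insert (0, m) F)
    (hf : f ∈ F) (hfe : f ≠ e) (hsub : e.1 ≤ f.1 ∧ f.2 ≤ e.2) :
    ∃ d ∈ F, laminarParent F m d = e ∧ d.1 ≤ f.1 ∧ f.2 ≤ d.2 := by
  obtain ⟨d, hd, hmax⟩ := exists_max_image
    {d ∈ F | (d.1 ≤ f.1 ∧ f.2 ≤ d.2) ∧ (e.1 ≤ d.1 ∧ d.2 ≤ e.2) ∧ d ≠ e}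
    (fun d => d.2 - d.1) ⟨f, by simp [hf, hsub, hfe]⟩
  simp only [mem_filter] at hd hmax
  obtain ⟨hd, hdf, hed, hne⟩ := hd
  refine ⟨d, hd, ?_, hdf⟩
  by_contra hpe
  have hcov := h.parent_covers hd
  have hpsub := h.parent_subset hd he hne.symm hed
  have hp : laminarParent F m d ∈ F := h.mem_of_subset he (laminarParent_mem F m d) hpe hpsub
  have hlen := hmax _ ⟨hp, by omega, hpsub, hpe⟩
  have := h.fst_lt_snd d hd
  exact h.parent_ne hd (Prod.ext (by omega) (by omega))

lemma children_disjoint (h : IsLaminar m F) {d d' : ℕ × ℕ} (hd : d ∈ F) (hd' : d' ∈ F)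
    (hpar : laminarParent F m d = laminarParent F m d') (hne : d ≠ d') :
    d.2 ≤ d'.1 ∨ d'.2 ≤ d.1 := by
  have not_nested : ∀ d ∈ F, ∀ d' ∈ F, laminarParent F m d = laminarParent F m d' → d' ≠ d →
      ¬ (d'.1 ≤ d.1 ∧ d.2 ≤ d'.2) := by
    intro d hd d' hd' hpar hne hsub
    have hsub := h.parent_subset hd (mem_insert_of_mem hd') hne hsub
    have hcov := h.parent_covers hd'
    rw [hpar] at hsub
    exact h.parent_ne hd' (Prod.ext (by omega) (by omega))
  have := not_nested d hd d' hd' hpar hne.symm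
  have := not_nested d' hd' d hd hpar.symm hne
  have := h.not_interleaved d hd d' hd'
  have := h.not_interleaved d' hd' d hd
  omega

lemma owner_eq (h : IsLaminar m F) {e : ℕ × ℕ} (he : e ∈ insert (0, m) F) {r : ℕ}
    (hr : e.1 ≤ r ∧ r < e.2) (huncov : ∀ d ∈ F, laminarParent F m d = e → ¬ (d.1 ≤ r ∧ r < d.2)) :
    laminarOwner F m r = e := by
  by_contra hne
  have hrm : r + 1 ≤ m := hr.2.trans_le (h.bounds he).2
  have hsub := h.shortestCover_subset r.lt_succ_self hrm he hr.1 hr.2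
  have hcov := shortestCover_covers F (a := r) hrm
  have howner := h.mem_of_subset he (shortestCover_mem F m r (r + 1)) hne hsub
  obtain ⟨d, hd, hpar, hdc⟩ := h.exists_child_covers he howner hne hsub
  exact huncov d hd hpar (by omega)

section ChordLengths

variable {X : Type*} [PseudoMetricSpace X] (t : ℕ → X)

lemma shortcutLength_children_le (h : IsLaminar m F) {e : ℕ × ℕ} (he : e ∈ insert (0, m) F) :
    shortcutLength t {f ∈ F | laminarParent F m f = e} e.1 e.2 ≤
      (∑ f ∈ F with laminarParent F m f = e, dist (t f.1) (t f.2)) +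
        ∑ r ∈ range m with laminarOwner F m r = e, dist (t r) (t (r + 1)) := by
  refine add_le_add
    (sum_le_sum_of_subset_of_nonneg (filter_subset _ _) fun _ _ _ => dist_nonneg)
    (sum_le_sum_of_subset_of_nonneg (fun r hr => ?_) fun _ _ _ => dist_nonneg)
  have := h.bounds he
  simp only [mem_filter, mem_Ico, and_imp] at hr
  exact mem_filter.2 ⟨mem_range.2 (by omega), h.owner_eq he hr.1 hr.2⟩

lemma dist_le_shortcutLength_children (h : IsLaminar m F) {e : ℕ × ℕ} {i k : ℕ} (hik : i ≤ k)
    (hin : ∀ d ∈ F, laminarParent F m d = e → d.1 < k → i < d.2 → i ≤ d.1 ∧ d.2 ≤ k) :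
    dist (t i) (t k) ≤ shortcutLength t {f ∈ F | laminarParent F m f = e} i k := by
  refine dist_le_shortcutLength (fun d hd => h.fst_lt_snd d (mem_filter.1 hd).1) ?_ hik ?_
  · intro d hd d' hd' hne
    rw [mem_filter] at hd hd'
    exact h.children_disjoint hd.1 hd'.1 (hd.2.trans hd'.2.symm) hne
  · intro d hd
    rw [mem_filter] at hd
    exact hin d hd.1 hd.2

lemma dist_parent_add_le (h : IsLaminar m F) {f : ℕ × ℕ} (hf : f ∈ F)
    (hopt : dist (t (laminarParent F m f).1) (t (laminarParent F m f).2) +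
        dist (t f.1) (t f.2) ≤
      dist (t (laminarParent F m f).1) (t f.1) + dist (t (laminarParent F m f).2) (t f.2)) :
    dist (t (laminarParent F m f).1) (t (laminarParent F m f).2) + 2 * dist (t f.1) (t f.2) ≤
      shortcutLength t {d ∈ F | laminarParent F m d = laminarParent F m f}
        (laminarParent F m f).1 (laminarParent F m f).2 := by
  set e := laminarParent F m f with he
  set D : Finset (ℕ × ℕ) := {d ∈ F | laminarParent F m d = e} with hD
  have hcov : e.1 ≤ f.1 ∧ f.2 ≤ e.2 := h.parent_covers hf
  have hlt := h.fst_lt_snd f hf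
  have hDlt : ∀ d ∈ D, d.1 < d.2 := fun d hd => h.fst_lt_snd d (mem_filter.1 hd).1
  have hpos : ∀ d ∈ F, laminarParent F m d = e →
      e.1 ≤ d.1 ∧ d.2 ≤ e.2 ∧ d.1 < d.2 ∧ (d = f ∨ d.2 ≤ f.1 ∨ f.2 ≤ d.1) := by
    intro d hd hde
    have hdcov := h.parent_covers hd
    rw [hde] at hdcov
    refine ⟨hdcov.1, hdcov.2, h.fst_lt_snd d hd, or_iff_not_imp_left.2 fun hne => ?_⟩
    exact h.children_disjoint hd hf hde hne
  have hleft : dist (t e.1) (t f.1) ≤ shortcutLength t D e.1 f.1 :=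
    h.dist_le_shortcutLength_children t hcov.1 fun d hd hde => by grind
  have hmid : dist (t f.1) (t f.2) ≤ shortcutLength t D f.1 f.2 :=
    dist_le_shortcutLength_of_mem (mem_filter.2 ⟨hf, he.symm⟩)
  have hright : dist (t f.2) (t e.2) ≤ shortcutLength t D f.2 e.2 :=
    h.dist_le_shortcutLength_children t hcov.2 fun d hd hde => by grind
  have hjoin := shortcutLength_add_le (t := t) hDlt hcov.1 hlt.le
  have hjoin' := shortcutLength_add_le (t := t) hDlt (hcov.1.trans hlt.le) hcov.2
  rw [dist_comm (t e.2)] at hopt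
  linarith

variable {t}

/-- The tree of a 2-optimal laminar family of chords of a closed path. -/
noncomputable def gapTree (h : IsLaminar m F) (hclosed : t m = t 0)
    (hopt : ∀ e ∈ F, ∀ f ∈ F, e ≠ f → dist (t e.1) (t e.2) + dist (t f.1) (t f.2) ≤
      dist (t e.1) (t f.1) + dist (t e.2) (t f.2)) : GapTree (ℕ × ℕ) where
  root := (0, m)
  inner := F
  parent := laminarParent F m
  weight e := dist (t e.1) (t e.2)
  gap e := ∑ r ∈ range m with laminarOwner F m r = e, dist (t r) (t (r + 1))
  root_notMem hroot := (h.snd_lt _ hroot).false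
  parent_mem f _ := laminarParent_mem F m f
  weight_nonneg _ := dist_nonneg
  gap_nonneg _ := sum_nonneg fun _ _ => dist_nonneg
  weight_root := by rw [hclosed, dist_self]
  weight_le_sum_gap f hf := by
    rw [sum_sum_laminarOwner]
    refine (dist_le_Ico_sum_dist t (h.fst_lt_snd f hf).le).trans
      (sum_le_sum_of_subset_of_nonneg (fun r hr => ?_) fun _ _ _ => dist_nonneg)
    have := h.snd_lt f hf
    simp only [mem_Ico, mem_range] at hr ⊢
    omega
  weight_le e he := by
    refine (h.dist_le_shortcutLength_children t (e := e) (h.bounds he).1 ?_).trans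
      (h.shortcutLength_children_le t he)
    rintro d hd rfl - -
    exact h.parent_covers hd
  weight_parent_add_le f hf := by
    refine (h.dist_parent_add_le t hf ?_).trans
      (h.shortcutLength_children_le t (laminarParent_mem F m f))
    rcases mem_insert.1 (laminarParent_mem F m f) with hroot | hmem
    · rw [hroot, hclosed, dist_self, zero_add]
      exact dist_triangle_left _ _ _
    · exact hopt _ hmem f hf (h.parent_ne hf)

lemma sum_dist_le (h : IsLaminar m F) (hclosed : t m = t 0)
    (hopt : ∀ e ∈ F, ∀ f ∈ F, e ≠ f → dist (t e.1) (t e.2) + dist (t f.1) (t f.2) ≤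
      dist (t e.1) (t f.1) + dist (t e.2) (t f.2)) {K : ℝ} (hK : 1 < K) :
    ∑ f ∈ F, dist (t f.1) (t f.2) ≤ (∑ r ∈ range m, dist (t r) (t (r + 1))) *
      (K / 2 + (1 + 2 * Real.log (#F + 1)) / Real.log K) := by
  have hsum := (h.gapTree hclosed hopt).sum_weight_le hK
  rw [GapTree.card_nodes, GapTree.totalGap] at hsum
  simpa only [gapTree, GapTree.nodes, sum_sum_laminarOwner, Nat.cast_add, Nat.cast_one] using hsum

end ChordLengths

end IsLaminar

end Laminar

section RayCrossing

/-- The second coordinate, at abscissa `ξ`, of the nonvertical line through `s` and `t`. -/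
noncomputable def lineThrough (s t : ℝ × ℝ) (ξ : ℝ) : ℝ :=
  s.2 + (t.2 - s.2) / (t.1 - s.1) * (ξ - s.1)

open Classical in
/-- Mod-2 indicator that the upward vertical ray from `p` crosses the segment `s t`. The segment is
half-open with respect to its abscissas, so that consecutive edges of a path do not both count. -/
noncomputable def rayCross (s t p : ℝ × ℝ) : ZMod 2 :=
  if ((s.1 ≤ p.1 ∧ p.1 < t.1) ∨ (t.1 ≤ p.1 ∧ p.1 < s.1)) ∧ p.2 < lineThrough s t p.1 then 1 else 0

open Classical in
/-- Mod-2 indicator that the point `v` lies above the segment `p q`. The segment is half-open on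
the other side than in `rayCross`, which makes `rayCross_add_rayCross` hold. -/
noncomputable def aboveSegment (p q v : ℝ × ℝ) : ZMod 2 :=
  if ((p.1 < v.1 ∧ v.1 ≤ q.1) ∨ (q.1 < v.1 ∧ v.1 ≤ p.1)) ∧ lineThrough p q v.1 < v.2 then 1 else 0

lemma lineThrough_left (s t : ℝ × ℝ) : lineThrough s t s.1 = s.2 := by
  simp [lineThrough]

lemma continuous_lineThrough (s t : ℝ × ℝ) : Continuous (lineThrough s t) := by
  unfold lineThrough
  fun_prop

variable {s t p q : ℝ × ℝ}

lemma lineThrough_symm (h : s.1 ≠ t.1) (ξ : ℝ) : lineThrough s t ξ = lineThrough t s ξ := by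
  have hts : t.1 - s.1 ≠ 0 := sub_ne_zero.2 h.symm
  have hst : s.1 - t.1 ≠ 0 := sub_ne_zero.2 h
  simp only [lineThrough]
  field_simp
  ring

lemma lineThrough_right (h : s.1 ≠ t.1) : lineThrough s t t.1 = t.2 := by
  rw [lineThrough_symm h, lineThrough_left]

lemma rayCross_symm (h : s.1 ≠ t.1) (p : ℝ × ℝ) : rayCross s t p = rayCross t s p := by
  simp only [rayCross, lineThrough_symm h, or_comm]

lemma aboveSegment_symm (h : p.1 ≠ q.1) (v : ℝ × ℝ) :
    aboveSegment p q v = aboveSegment q p v := by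
  simp only [aboveSegment, lineThrough_symm h, or_comm]

lemma mk_lineThrough_mem_segment (h : s.1 < t.1) {ξ : ℝ} (hξ : ξ ∈ Set.Icc s.1 t.1) :
    (ξ, lineThrough s t ξ) ∈ segment ℝ s t := by
  have hpos : 0 < t.1 - s.1 := sub_pos.2 h
  rw [segment_eq_image']
  refine ⟨(ξ - s.1) / (t.1 - s.1), ⟨div_nonneg (by linarith [hξ.1]) hpos.le, ?_⟩, ?_⟩
  · rw [div_le_one hpos]
    linarith [hξ.2]
  · ext
    · simp only [Prod.fst_add, Prod.smul_fst, Prod.fst_sub, smul_eq_mul]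
      field_simp
      ring
    · simp only [lineThrough, Prod.snd_add, Prod.smul_snd, Prod.snd_sub, smul_eq_mul]
      ring

lemma snd_ne_lineThrough (hst : s.1 ≠ t.1) (hp : p ∉ segment ℝ s t)
    (hx : p.1 ∈ Set.uIcc s.1 t.1) : p.2 ≠ lineThrough s t p.1 := by
  rintro heq
  apply hp
  rcases hst.lt_or_gt with h | h
  · rw [Set.uIcc_of_le h.le] at hx
    simpa only [← heq] using mk_lineThrough_mem_segment h hx
  · rw [Set.uIcc_of_ge h.le] at hx
    rw [lineThrough_symm hst] at heq
    rw [segment_symm]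
    simpa only [← heq] using mk_lineThrough_mem_segment h hx

lemma lineThrough_lt_lineThrough (hst : s.1 < t.1) (hpq : p.1 < q.1)
    (hd : Disjoint (segment ℝ p q) (segment ℝ s t)) {ξ η : ℝ}
    (hξ : ξ ∈ Set.Icc s.1 t.1 ∩ Set.Icc p.1 q.1) (hη : η ∈ Set.Icc s.1 t.1 ∩ Set.Icc p.1 q.1)
    (hlt : lineThrough p q ξ < lineThrough s t ξ) : lineThrough p q η < lineThrough s t η := by
  by_contra! hle
  obtain ⟨ζ, hζ, heq⟩ := isPreconnected_uIcc.intermediate_value₂ Set.right_mem_uIcc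
    Set.left_mem_uIcc (continuous_lineThrough s t).continuousOn
    (continuous_lineThrough p q).continuousOn hle hlt.le
  have hst' := mk_lineThrough_mem_segment hst (Set.uIcc_subset_Icc hξ.1 hη.1 hζ)
  have hpq' := mk_lineThrough_mem_segment hpq (Set.uIcc_subset_Icc hξ.2 hη.2 hζ)
  rw [heq] at hst'
  exact Set.disjoint_left.1 hd hpq' hst'

open Classical in
lemma indicator_interval_parity {s t p q : ℝ} (hst : s < t) (hpq : p < q) {S : ℝ → Prop}
    (hS : ∀ ξ ∈ Set.Icc s t ∩ Set.Icc p q, ∀ η ∈ Set.Icc s t ∩ Set.Icc p q, S ξ → S η) :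
    ((if (s ≤ p ∧ p < t) ∧ S p then 1 else 0) + (if (s ≤ q ∧ q < t) ∧ S q then 1 else 0) : ZMod 2) =
      (if (p < s ∧ s ≤ q) ∧ S s then 1 else 0) + (if (p < t ∧ t ≤ q) ∧ S t then 1 else 0) := by
  simp only [Set.mem_inter_iff, Set.mem_Icc] at hS
  have two : (1 : ZMod 2) + 1 = 0 := by decide
  grind

lemma rayCross_add_rayCross_of_lt (hst : s.1 < t.1) (hpq : p.1 < q.1)
    (hd : Disjoint (segment ℝ p q) (segment ℝ s t)) :
    rayCross s t p + rayCross s t q = aboveSegment p q s + aboveSegment p q t := by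
  have hcross : ∀ ξ ∈ Set.Icc s.1 t.1 ∩ Set.Icc p.1 q.1, ∀ η ∈ Set.Icc s.1 t.1 ∩ Set.Icc p.1 q.1,
      lineThrough p q ξ < lineThrough s t ξ → lineThrough p q η < lineThrough s t η :=
    fun _ hξ _ hη => lineThrough_lt_lineThrough hst hpq hd hξ hη
  have hpar := indicator_interval_parity hst hpq hcross
  rw [lineThrough_left, lineThrough_left, lineThrough_right hst.ne, lineThrough_right hpq.ne]
    at hpar
  have hts (x : ℝ) : ¬ (t.1 ≤ x ∧ x < s.1) := fun h => by linarith [h.1, h.2]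
  have hqp (x : ℝ) : ¬ (q.1 < x ∧ x ≤ p.1) := fun h => by linarith [h.1, h.2]
  simpa only [rayCross, aboveSegment, hts, hqp, or_false] using hpar

lemma rayCross_add_rayCross (hst : s.1 ≠ t.1) (hpq : p.1 ≠ q.1)
    (hd : Disjoint (segment ℝ p q) (segment ℝ s t)) :
    rayCross s t p + rayCross s t q = aboveSegment p q s + aboveSegment p q t := by
  wlog hlt : s.1 < t.1 generalizing s t
  · rw [rayCross_symm hst, rayCross_symm hst, add_comm (aboveSegment p q s)]
    exact this hst.symm (by rwa [segment_symm ℝ t s]) (hst.lt_or_gt.resolve_left hlt)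
  wlog hlt' : p.1 < q.1 generalizing p q
  · rw [aboveSegment_symm hpq, aboveSegment_symm hpq, add_comm]
    exact this hpq.symm (by rwa [segment_symm ℝ q p]) (hpq.lt_or_gt.resolve_left hlt')
  exact rayCross_add_rayCross_of_lt hlt hlt' hd

end RayCrossing

section RayCrossingLimits

open Filter Topology

lemma eventually_fst_order_iff {s b : ℝ × ℝ} (hs : s.1 ≠ b.1) :
    ∀ᶠ q in 𝓝 b, (s.1 ≤ q.1 ↔ s.1 ≤ b.1) ∧ (q.1 < s.1 ↔ b.1 < s.1) := by
  rcases hs.lt_or_gt with h | h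
  · filter_upwards [(continuous_fst.tendsto b).eventually (lt_mem_nhds h)] with q hq
    grind
  · filter_upwards [(continuous_fst.tendsto b).eventually (gt_mem_nhds h)] with q hq
    grind

lemma eventually_snd_lt_iff {g : ℝ → ℝ} (hg : Continuous g) {b : ℝ × ℝ} (hb : b.2 ≠ g b.1) :
    ∀ᶠ q in 𝓝 b, (q.2 < g q.1 ↔ b.2 < g b.1) := by
  have hg' : Tendsto (fun q : ℝ × ℝ => g q.1) (𝓝 b) (𝓝 (g b.1)) :=
    (hg.comp continuous_fst).tendsto b
  rcases hb.lt_or_gt with h | h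
  · filter_upwards [(continuous_snd.tendsto b).eventually_lt hg' h] with q hq
    exact iff_of_true hq h
  · filter_upwards [hg'.eventually_lt (continuous_snd.tendsto b) h] with q hq
    exact iff_of_false hq.not_gt h.not_gt

lemma eventually_rayCross_eq {s t b : ℝ × ℝ} (hs : s.1 ≠ b.1) (ht : t.1 ≠ b.1) (hst : s.1 ≠ t.1)
    (hb : b ∉ segment ℝ s t) : ∀ᶠ q in 𝓝 b, rayCross s t q = rayCross s t b := by
  by_cases hx : b.1 ∈ Set.uIcc s.1 t.1
  · filter_upwards [eventually_fst_order_iff hs, eventually_fst_order_iff ht,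
      eventually_snd_lt_iff (continuous_lineThrough s t) (snd_ne_lineThrough hst hb hx)]
      with q hqs hqt hlt
    simp only [rayCross, hqs.1, hqs.2, hqt.1, hqt.2, hlt]
  · have hstrip : ¬ ((s.1 ≤ b.1 ∧ b.1 < t.1) ∨ (t.1 ≤ b.1 ∧ b.1 < s.1)) := fun h =>
      hx (Set.mem_uIcc.2 (h.imp (fun h => ⟨h.1, h.2.le⟩) fun h => ⟨h.1, h.2.le⟩))
    filter_upwards [eventually_fst_order_iff hs, eventually_fst_order_iff ht] with q hqs hqt
    simp only [rayCross, hqs.1, hqs.2, hqt.1, hqt.2, hstrip, false_and]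

end RayCrossingLimits

section Chains

variable {C D : Multiset ((ℝ × ℝ) × (ℝ × ℝ))}

/-- The number of edges of the mod-2 chain `C` that are crossed by the upward vertical ray from `p`,
mod 2. -/
noncomputable def edgeCross (C : Multiset ((ℝ × ℝ) × (ℝ × ℝ))) (p : ℝ × ℝ) : ZMod 2 :=
  (C.map fun e => rayCross e.1 e.2 p).sum

/-- A mod-2 cycle of edges: its boundary vanishes, as tested by all functions on the plane. -/
def IsModTwoCycle (C : Multiset ((ℝ × ℝ) × (ℝ × ℝ))) : Prop :=
  ∀ f : ℝ × ℝ → ZMod 2, (C.map fun e => f e.1 + f e.2).sum = 0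

lemma edgeCross_cons (e : (ℝ × ℝ) × (ℝ × ℝ)) (p : ℝ × ℝ) :
    edgeCross (e ::ₘ C) p = rayCross e.1 e.2 p + edgeCross C p := by
  simp [edgeCross]

lemma IsModTwoCycle.edgeCross_eq (hC : IsModTwoCycle C) (hx : ∀ e ∈ C, e.1.1 ≠ e.2.1) {p q : ℝ × ℝ}
    (hpq : p.1 ≠ q.1) (hd : ∀ e ∈ C, Disjoint (segment ℝ p q) (segment ℝ e.1 e.2)) :
    edgeCross C p = edgeCross C q := by
  rw [← CharTwo.add_eq_zero, edgeCross, edgeCross, ← Multiset.sum_map_add,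
    Multiset.map_congr rfl fun e he => rayCross_add_rayCross (hx e he) hpq (hd e he)]
  exact hC (aboveSegment p q)

lemma IsModTwoCycle.edgeCross_lineMap_eq (hC : IsModTwoCycle C) (hx : ∀ e ∈ C, e.1.1 ≠ e.2.1)
    {b u : ℝ × ℝ} (hbu : b.1 ≠ u.1) {ε δ : ℝ} (hεδ : ε ≤ δ)
    (hmiss : ∀ θ ∈ Set.Icc ε δ, ∀ e ∈ C, AffineMap.lineMap b u θ ∉ segment ℝ e.1 e.2) :
    edgeCross C (AffineMap.lineMap b u ε) = edgeCross C (AffineMap.lineMap b u δ) := by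
  rcases hεδ.eq_or_lt with rfl | hlt
  · rfl
  refine hC.edgeCross_eq hx ?_ fun e he => ?_
  · rw [AffineMap.fst_lineMap, AffineMap.fst_lineMap]
    exact (AffineMap.lineMap_injective ℝ hbu).ne hlt.ne
  · rw [← image_segment ℝ (AffineMap.lineMap b u) ε δ, segment_eq_Icc hεδ, Set.disjoint_left]
    rintro _ ⟨θ, hθ, rfl⟩
    exact hmiss θ hθ e he

open Filter Topology in
lemma eventually_edgeCross_lineMap {b : ℝ × ℝ}
    (hC : ∀ e ∈ C, e.1.1 ≠ b.1 ∧ e.2.1 ≠ b.1 ∧ e.1.1 ≠ e.2.1 ∧ b ∉ segment ℝ e.1 e.2)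
    (v : ℝ × ℝ) :
    ∀ᶠ ε in 𝓝[>] (0 : ℝ), edgeCross C (AffineMap.lineMap b v ε) = edgeCross C b := by
  have htend : Tendsto (AffineMap.lineMap b v : ℝ → ℝ × ℝ) (𝓝[>] 0) (𝓝 b) := by
    have := (AffineMap.lineMap_continuous (R := ℝ) (p := b) (q := v)).tendsto 0
    rw [AffineMap.lineMap_apply_zero] at this
    exact this.mono_left nhdsWithin_le_nhds
  induction C using Multiset.induction_on with
  | empty => exact .of_forall fun _ => rfl
  | cons e C ih =>
    obtain ⟨hfst, hsnd, hne, hmem⟩ := hC e (Multiset.mem_cons_self e C)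
    filter_upwards [ih fun f hf => hC f (Multiset.mem_cons_of_mem hf),
      htend.eventually (eventually_rayCross_eq hfst hsnd hne hmem)] with ε hrest hedge
    rw [edgeCross_cons, edgeCross_cons, hrest, hedge]

end Chains

section PathChains

open Finset

variable {t : ℕ → ℝ × ℝ} {m i j : ℕ}

/-- The edges `t k, t (k + 1)`, for `k ∈ S`, of the path `t`. -/
def pathEdges (t : ℕ → ℝ × ℝ) (S : Finset ℕ) : Multiset ((ℝ × ℝ) × (ℝ × ℝ)) :=
  S.val.map fun k => (t k, t (k + 1))

/-- The part of the path `t` from `t i` to `t j`, closed up by the chord between its ends. -/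
def innerCycle (t : ℕ → ℝ × ℝ) (i j : ℕ) : Multiset ((ℝ × ℝ) × (ℝ × ℝ)) :=
  (t i, t j) ::ₘ pathEdges t (Ico i j)

/-- The part of the closed path `t` with `m` edges that is complementary to the part from `t i` to
`t j`, closed up by the chord between its ends. -/
def outerCycle (t : ℕ → ℝ × ℝ) (m i j : ℕ) : Multiset ((ℝ × ℝ) × (ℝ × ℝ)) :=
  (t i, t j) ::ₘ pathEdges t (range m \ Ico i j)

lemma edgeCross_pathEdges (S : Finset ℕ) (p : ℝ × ℝ) :
    edgeCross (pathEdges t S) p = ∑ k ∈ S, rayCross (t k) (t (k + 1)) p := by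
  rw [edgeCross, pathEdges, Multiset.map_map]
  rfl

lemma sum_map_pathEdges (f : ℝ × ℝ → ZMod 2) (S : Finset ℕ) :
    ((pathEdges t S).map fun e => f e.1 + f e.2).sum = ∑ k ∈ S, (f (t (k + 1)) - f (t k)) := by
  simp only [CharTwo.sub_eq_add, add_comm (f (t (_ + 1)))]
  rw [pathEdges, Multiset.map_map]
  rfl

lemma forall_mem_pathEdges {S : Finset ℕ} {P : (ℝ × ℝ) × (ℝ × ℝ) → Prop} :
    (∀ e ∈ pathEdges t S, P e) ↔ ∀ k ∈ S, P (t k, t (k + 1)) := by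
  simp [pathEdges]

lemma forall_mem_innerCycle {P : (ℝ × ℝ) × (ℝ × ℝ) → Prop} :
    (∀ e ∈ innerCycle t i j, P e) ↔ P (t i, t j) ∧ ∀ k ∈ Ico i j, P (t k, t (k + 1)) := by
  rw [innerCycle, Multiset.forall_mem_cons, forall_mem_pathEdges]

lemma forall_mem_outerCycle {P : (ℝ × ℝ) × (ℝ × ℝ) → Prop} :
    (∀ e ∈ outerCycle t m i j, P e) ↔
      P (t i, t j) ∧ ∀ k ∈ range m \ Ico i j, P (t k, t (k + 1)) := by
  rw [outerCycle, Multiset.forall_mem_cons, forall_mem_pathEdges]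

lemma isModTwoCycle_pathEdges_range (hclosed : t m = t 0) :
    IsModTwoCycle (pathEdges t (range m)) := fun f => by
  rw [sum_map_pathEdges, sum_range_sub (fun k => f (t k)), hclosed, sub_self]

lemma isModTwoCycle_innerCycle (hij : i ≤ j) : IsModTwoCycle (innerCycle t i j) := fun f => by
  rw [innerCycle, Multiset.map_cons, Multiset.sum_cons, sum_map_pathEdges,
    sum_Ico_sub (fun k => f (t k)) hij, CharTwo.sub_eq_add, add_comm (f (t j))]
  exact CharTwo.add_self_eq_zero _

lemma isModTwoCycle_outerCycle (hclosed : t m = t 0) (hij : i ≤ j) (hjm : j ≤ m) :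
    IsModTwoCycle (outerCycle t m i j) := fun f => by
  have hsub : Ico i j ⊆ range m := fun k hk => by grind
  rw [outerCycle, Multiset.map_cons, Multiset.sum_cons, sum_map_pathEdges, sum_sdiff_eq_sub hsub,
    sum_range_sub (fun k => f (t k)), hclosed, sub_self, zero_sub, CharTwo.neg_eq,
    sum_Ico_sub (fun k => f (t k)) hij, CharTwo.sub_eq_add, add_comm (f (t j))]
  exact CharTwo.add_self_eq_zero _

lemma edgeCross_innerCycle_add_outerCycle (hjm : j ≤ m) (p : ℝ × ℝ) :
    edgeCross (innerCycle t i j) p + edgeCross (outerCycle t m i j) p =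
      edgeCross (pathEdges t (range m)) p := by
  have hsub : Ico i j ⊆ range m := fun k hk => by grind
  rw [innerCycle, outerCycle, edgeCross_cons, edgeCross_cons, add_add_add_comm,
    CharTwo.add_self_eq_zero, zero_add, add_comm]
  simp only [edgeCross_pathEdges]
  exact sum_sdiff hsub

lemma edgeCross_innerCycle_succ (hij : i ≤ j) (p : ℝ × ℝ) :
    edgeCross (innerCycle t i (j + 1)) p = rayCross (t j) (t (j + 1)) p +
      rayCross (t i) (t (j + 1)) p + edgeCross (pathEdges t (Ico i j)) p := by
  simp only [innerCycle, edgeCross_cons, edgeCross_pathEdges, sum_Ico_succ_top hij]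
  ring

lemma edgeCross_outerCycle_eq (hij : i ≤ j) (hjm : j < m) (p : ℝ × ℝ) :
    edgeCross (outerCycle t m i j) p = rayCross (t j) (t (j + 1)) p +
      rayCross (t i) (t j) p + edgeCross (pathEdges t (range m \ Ico i (j + 1))) p := by
  have hinsert : range m \ Ico i j = insert j (range m \ Ico i (j + 1)) := by grind
  simp only [outerCycle, edgeCross_cons, edgeCross_pathEdges, hinsert]
  rw [sum_insert (by grind)]
  ring

end PathChains

section LocalTheta

open Filter Topology AffineMap

variable {b u v : ℝ × ℝ}

lemma add_mem_half_open_iff {x y w : ℝ} (hw : w ≠ 0) (hwy : |w| < |y - x|) :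
    (x ≤ x + w ∧ x + w < y) ∨ (y ≤ x + w ∧ x + w < x) ↔ 0 < (y - x) * w := by
  rw [mul_pos_iff]
  rcases hw.lt_or_gt with h | h
  · rw [abs_of_neg h, lt_abs] at hwy
    grind
  · rw [abs_of_pos h, lt_abs] at hwy
    grind

lemma eventually_rayCross_lineMap (hu : u.1 ≠ b.1) (hv : v.1 ≠ b.1) :
    ∀ᶠ ε : ℝ in 𝓝[>] 0, rayCross u b (lineMap b v ε) =
      if 0 < (u.1 - b.1) * (v.1 - b.1) ∧
        ((v.2 - b.2) * (u.1 - b.1) - (u.2 - b.2) * (v.1 - b.1)) * (u.1 - b.1) < 0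
      then 1 else 0 := by
  have hu' : u.1 - b.1 ≠ 0 := sub_ne_zero.2 hu
  have hv' : v.1 - b.1 ≠ 0 := sub_ne_zero.2 hv
  have hsmall : ∀ᶠ ε : ℝ in 𝓝[>] 0, |ε * (v.1 - b.1)| < |u.1 - b.1| := by
    have htend : Tendsto (fun ε : ℝ => |ε * (v.1 - b.1)|) (𝓝 0) (𝓝 |0 * (v.1 - b.1)|) :=
      Continuous.tendsto (by fun_prop) 0
    exact nhdsWithin_le_nhds (htend.eventually (gt_mem_nhds (by simpa using hu')))
  filter_upwards [hsmall, self_mem_nhdsWithin] with ε hε hpos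
  replace hpos : 0 < ε := hpos
  have hfst : (lineMap b v ε).1 = b.1 + ε * (v.1 - b.1) := by simp [lineMap_apply, add_comm]
  have hsnd : (lineMap b v ε).2 = b.2 + ε * (v.2 - b.2) := by simp [lineMap_apply, add_comm]
  have hbelow : b.2 + ε * (v.2 - b.2) < lineThrough b u (b.1 + ε * (v.1 - b.1)) ↔
      ((v.2 - b.2) * (u.1 - b.1) - (u.2 - b.2) * (v.1 - b.1)) * (u.1 - b.1) < 0 := by
    have hdiff : b.2 + ε * (v.2 - b.2) - lineThrough b u (b.1 + ε * (v.1 - b.1)) =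
        ε / (u.1 - b.1) ^ 2 *
          (((v.2 - b.2) * (u.1 - b.1) - (u.2 - b.2) * (v.1 - b.1)) * (u.1 - b.1)) := by
      simp only [lineThrough]
      field_simp
      ring
    rw [← sub_neg, hdiff]
    exact smul_neg_iff_of_pos_left (α := ℝ) (β := ℝ) (by positivity)
  have hstrip := add_mem_half_open_iff (mul_ne_zero hpos.ne' hv') hε
  rw [mul_left_comm, mul_pos_iff_of_pos_left hpos] at hstrip
  rw [rayCross_symm hu]
  simp only [rayCross, hfst, hsnd, hbelow, hstrip]

lemma mem_segment_of_cross_eq_zero (hv : v.1 ≠ b.1) (hpos : 0 < (u.1 - b.1) * (v.1 - b.1))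
    (hcross : (v.2 - b.2) * (u.1 - b.1) - (u.2 - b.2) * (v.1 - b.1) = 0)
    (habs : |u.1 - b.1| ≤ |v.1 - b.1|) : u ∈ segment ℝ b v := by
  have hv' : v.1 - b.1 ≠ 0 := sub_ne_zero.2 hv
  rw [segment_eq_image']
  refine ⟨(u.1 - b.1) / (v.1 - b.1), ⟨?_, ?_⟩, ?_⟩
  · rw [div_nonneg_iff, ← mul_nonneg_iff]
    exact hpos.le
  · refine (le_abs_self _).trans ?_
    rwa [abs_div, div_le_one (abs_pos.2 hv')]
  · ext
    · simp only [Prod.fst_add, Prod.smul_fst, Prod.fst_sub, smul_eq_mul]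
      field_simp
      ring
    · simp only [Prod.snd_add, Prod.smul_snd, Prod.snd_sub, smul_eq_mul]
      field_simp
      linarith

lemma cross_ne_zero (hu : u.1 ≠ b.1) (hv : v.1 ≠ b.1) (hpos : 0 < (u.1 - b.1) * (v.1 - b.1))
    (hd : ∀ p ∈ segment ℝ b u, p ∈ segment ℝ b v → p = b) :
    (v.2 - b.2) * (u.1 - b.1) - (u.2 - b.2) * (v.1 - b.1) ≠ 0 := fun hcross => by
  rcases le_total |u.1 - b.1| |v.1 - b.1| with h | h
  · exact hu (congrArg Prod.fst (hd u (right_mem_segment _ _ _)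
      (mem_segment_of_cross_eq_zero hv hpos hcross h)))
  · exact hv (congrArg Prod.fst (hd v (mem_segment_of_cross_eq_zero hu (by rwa [mul_comm])
      (by linarith) h) (right_mem_segment _ _ _)))

-- Of two rays from `b` that leave to the same side, exactly one is above the other.
lemma eventually_rayCross_add_rayCross (hu : u.1 ≠ b.1) (hv : v.1 ≠ b.1)
    (hd : ∀ p ∈ segment ℝ b u, p ∈ segment ℝ b v → p = b) :
    ∀ᶠ ε : ℝ in 𝓝[>] 0, rayCross u b (lineMap b v ε) + rayCross v b (lineMap b u ε) =
      if 0 < (u.1 - b.1) * (v.1 - b.1) then 1 else 0 := by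
  filter_upwards [eventually_rayCross_lineMap hu hv, eventually_rayCross_lineMap hv hu]
    with ε huv hvu
  rw [huv, hvu, mul_comm (v.1 - b.1) (u.1 - b.1)]
  by_cases hpos : 0 < (u.1 - b.1) * (v.1 - b.1)
  · have hiff : ((u.2 - b.2) * (v.1 - b.1) - (v.2 - b.2) * (u.1 - b.1)) * (v.1 - b.1) < 0 ↔
        ¬ ((v.2 - b.2) * (u.1 - b.1) - (u.2 - b.2) * (v.1 - b.1)) * (u.1 - b.1) < 0 := by
      have hcross := cross_ne_zero hu hv hpos hd
      rw [← neg_sub ((v.2 - b.2) * (u.1 - b.1))]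
      generalize (v.2 - b.2) * (u.1 - b.1) - (u.2 - b.2) * (v.1 - b.1) = c at hcross ⊢
      simp only [mul_neg_iff]
      rcases pos_and_pos_or_neg_and_neg_of_mul_pos hpos with h | h <;> grind
    simp only [hpos, true_and, hiff, if_true]
    split_ifs <;> simp_all
  · simp [hpos]

lemma ite_mul_pos_cyclic_sum_eq_one {x y z : ℝ} (hx : x ≠ 0) (hy : y ≠ 0) (hz : z ≠ 0) :
    ((if 0 < x * y then 1 else 0) + (if 0 < y * z then 1 else 0) + (if 0 < z * x then 1 else 0) :
      ZMod 2) = 1 := by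
  have three : (1 + 1 + 1 : ZMod 2) = 1 := by decide
  simp only [mul_pos_iff]
  grind

-- Near the common end `b` of three arcs, the crossings of far edges appear twice and cancel, and
-- the last edges of the arcs contribute `ite_mul_pos_cyclic_sum_eq_one`.
lemma exists_edgeCross_theta_eq_one {w : ℝ × ℝ} {C D : Multiset ((ℝ × ℝ) × (ℝ × ℝ))}
    (hu : u.1 ≠ b.1) (hv : v.1 ≠ b.1) (hw : w.1 ≠ b.1)
    (huv : ∀ p ∈ segment ℝ b u, p ∈ segment ℝ b v → p = b)
    (hvw : ∀ p ∈ segment ℝ b v, p ∈ segment ℝ b w → p = b)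
    (hwu : ∀ p ∈ segment ℝ b w, p ∈ segment ℝ b u → p = b)
    (hC : ∀ e ∈ C, e.1.1 ≠ b.1 ∧ e.2.1 ≠ b.1 ∧ e.1.1 ≠ e.2.1 ∧ b ∉ segment ℝ e.1 e.2)
    (hD : ∀ e ∈ D, e.1.1 ≠ b.1 ∧ e.2.1 ≠ b.1 ∧ e.1.1 ≠ e.2.1 ∧ b ∉ segment ℝ e.1 e.2) :
    ∃ ε ∈ Set.Ioo (0 : ℝ) (1 / 2),
      (rayCross u b (lineMap b v ε) + rayCross w b (lineMap b v ε) + edgeCross C (lineMap b v ε)) +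
        (rayCross v b (lineMap b u ε) + rayCross w b (lineMap b u ε) +
          edgeCross D (lineMap b u ε)) +
        (rayCross u b (lineMap b w ε) + rayCross v b (lineMap b w ε) +
          (edgeCross C (lineMap b w ε) + edgeCross D (lineMap b w ε))) = 1 := by
  have hev : ∀ᶠ ε : ℝ in 𝓝[>] 0, ε ∈ Set.Ioo (0 : ℝ) (1 / 2) :=
    Ioo_mem_nhdsGT (by norm_num)
  obtain ⟨ε, hε, hCv, hCw, hDu, hDw, huv', hvw', hwu'⟩ := (hev.and
    ((eventually_edgeCross_lineMap hC v).and ((eventually_edgeCross_lineMap hC w).and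
    ((eventually_edgeCross_lineMap hD u).and ((eventually_edgeCross_lineMap hD w).and
    ((eventually_rayCross_add_rayCross hu hv huv).and
    ((eventually_rayCross_add_rayCross hv hw hvw).and
    (eventually_rayCross_add_rayCross hw hu hwu)))))))).exists
  have hsigns :=
    ite_mul_pos_cyclic_sum_eq_one (sub_ne_zero.2 hu) (sub_ne_zero.2 hv) (sub_ne_zero.2 hw)
  refine ⟨ε, hε, ?_⟩
  rw [hCv, hCw, hDu, hDw, ← hsigns, ← huv', ← hvw', ← hwu']
  linear_combination CharTwo.add_self_eq_zero (edgeCross C b) +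
    CharTwo.add_self_eq_zero (edgeCross D b)

end LocalTheta

section Polygon

variable {E : Type*} [AddCommGroup E] [Module ℝ E]

/-- A simple closed polygon with the `m` distinct vertices `t 0, …, t (m - 1)`, closed up by
`t m = t 0`: two edges meet at most in a common end, and only if they are cyclically adjacent. -/
structure SimplePolygon (t : ℕ → E) (m : ℕ) : Prop where
  closed : t m = t 0
  injOn : Set.InjOn t (Set.Iio m)
  edges_inter : ∀ ⦃a b⦄, a < b → b < m → ∀ ⦃p⦄, p ∈ segment ℝ (t a) (t (a + 1)) →
    p ∈ segment ℝ (t b) (t (b + 1)) → (b = a + 1 ∧ p = t b) ∨ (a = 0 ∧ b + 1 = m ∧ p = t 0)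

/-- The chord between the vertices `t i` and `t j` meets the polygon in its end points only. -/
def AvoidsPolygon (t : ℕ → E) (m i j : ℕ) : Prop :=
  ∀ ⦃a⦄, a < m → ∀ ⦃p⦄, p ∈ segment ℝ (t i) (t j) → p ∈ segment ℝ (t a) (t (a + 1)) →
    p = t i ∨ p = t j

variable {t : ℕ → E} {m : ℕ}

lemma SimplePolygon.vertex_mem_edge (h : SimplePolygon t m) {v a : ℕ} (hv : v < m) (ha : a < m)
    (hmem : t v ∈ segment ℝ (t a) (t (a + 1))) : v = a ∨ v = a + 1 ∨ (v = 0 ∧ a + 1 = m) := by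
  have hvertex := left_mem_segment ℝ (t v) (t (v + 1))
  rcases lt_trichotomy a v with hav | rfl | hva
  · rcases h.edges_inter hav hv hmem hvertex with ⟨hadj, -⟩ | ⟨-, -, heq⟩
    · exact Or.inr (Or.inl hadj)
    · have := h.injOn hv (hav.pos.trans hv) heq
      omega
  · exact Or.inl rfl
  · rcases h.edges_inter hva ha hvertex hmem with ⟨-, heq⟩ | ⟨hv0, ham, -⟩
    · exact absurd (h.injOn hv ha heq) hva.ne
    · exact Or.inr (Or.inr ⟨hv0, ham⟩)

lemma SimplePolygon.disjoint_edges (h : SimplePolygon t m) {a b : ℕ} (hab : a + 1 < b) (hb : b < m)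
    (hwrap : ¬ (a = 0 ∧ b + 1 = m)) :
    Disjoint (segment ℝ (t a) (t (a + 1))) (segment ℝ (t b) (t (b + 1))) := by
  rw [Set.disjoint_left]
  intro p hpa hpb
  rcases h.edges_inter (by omega) hb hpa hpb with ⟨hadj, -⟩ | ⟨ha, hbm, -⟩ <;> omega

lemma AvoidsPolygon.symm {i j : ℕ} (h : AvoidsPolygon t m i j) : AvoidsPolygon t m j i :=
  fun _ ha _ hp hpa => (h ha (by rwa [segment_symm]) hpa).symm

lemma AvoidsPolygon.eq_right {i j a : ℕ} (h : AvoidsPolygon t m i j) (ht : SimplePolygon t m)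
    (hi : i < m) (ha : a < m) (hia : i ≠ a) (hia' : i ≠ a + 1) (hwrap : ¬ (i = 0 ∧ a + 1 = m))
    {p : E} (hp : p ∈ segment ℝ (t i) (t j)) (hpa : p ∈ segment ℝ (t a) (t (a + 1))) :
    p = t j := by
  rcases h ha hp hpa with rfl | heq
  · rcases ht.vertex_mem_edge hi ha hpa with hv | hv | hv
    exacts [absurd hv hia, absurd hv hia', absurd hv hwrap]
  · exact heq

lemma AvoidsPolygon.disjoint_edge {i j a : ℕ} (h : AvoidsPolygon t m i j) (ht : SimplePolygon t m)
    (hi : i < m) (hj : j < m) (ha : a < m) (hia : i ≠ a) (hia' : i ≠ a + 1)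
    (hwrap : ¬ (i = 0 ∧ a + 1 = m)) (hja : j ≠ a) (hja' : j ≠ a + 1)
    (hwrap' : ¬ (j = 0 ∧ a + 1 = m)) :
    Disjoint (segment ℝ (t a) (t (a + 1))) (segment ℝ (t i) (t j)) := by
  rw [Set.disjoint_left]
  intro p hpa hp
  have heq := h.eq_right ht hi ha hia hia' hwrap hp hpa
  subst heq
  rcases ht.vertex_mem_edge hj ha hpa with hv | hv | hv
  exacts [hja hv, hja' hv, hwrap' hv]

variable {E' : Type*} [AddCommGroup E'] [Module ℝ E'] {φ : E →ᵃ[ℝ] E'}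

lemma SimplePolygon.map (h : SimplePolygon t m) (hφ : Function.Injective φ) :
    SimplePolygon (fun k => φ (t k)) m where
  closed := by rw [h.closed]
  injOn := hφ.injOn.comp h.injOn (Set.mapsTo_univ _ _)
  edges_inter a b hab hb p hpa hpb := by
    rw [← image_segment ℝ φ] at hpa hpb
    obtain ⟨x, hx, rfl⟩ := hpa
    rw [hφ.mem_set_image] at hpb
    simpa only [hφ.eq_iff] using h.edges_inter hab hb hx hpb

lemma AvoidsPolygon.map {i j : ℕ} (h : AvoidsPolygon t m i j) (hφ : Function.Injective φ) :
    AvoidsPolygon (fun k => φ (t k)) m i j := by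
  intro a ha p hp hpa
  rw [← image_segment ℝ φ] at hp hpa
  obtain ⟨x, hx, rfl⟩ := hp
  rw [hφ.mem_set_image] at hpa
  simpa only [hφ.eq_iff] using h ha hx hpa

end Polygon

section Theta

open Finset AffineMap

variable {t : ℕ → ℝ × ℝ} {m i j k l : ℕ}

lemma SimplePolygon.edge_fst_ne (h : SimplePolygon t m) (hm : 2 ≤ m)
    (hx : Set.InjOn (fun k => (t k).1) (Set.Iio m)) {k : ℕ} (hk : k < m) :
    (t k).1 ≠ (t (k + 1)).1 := by
  intro heq
  rcases Nat.lt_or_ge (k + 1) m with hlt | hge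
  · exact absurd (hx hk hlt heq) (by omega)
  · rw [show k + 1 = m by omega, h.closed] at heq
    exact absurd (hx hk (by grind) heq) (by omega)

lemma SimplePolygon.edge_far_of_ne (h : SimplePolygon t m)
    (hx : Set.InjOn (fun k => (t k).1) (Set.Iio m)) {v a : ℕ} (hv : 0 < v) (hvm : v < m)
    (ha : a < m) (hva : v ≠ a) (hva' : v ≠ a + 1) :
    (t a).1 ≠ (t v).1 ∧ (t (a + 1)).1 ≠ (t v).1 ∧ (t a).1 ≠ (t (a + 1)).1 ∧
      t v ∉ segment ℝ (t a) (t (a + 1)) := by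
  refine ⟨fun heq => hva (hx hvm ha heq.symm), fun heq => ?_, h.edge_fst_ne (by omega) hx ha,
    fun hmem => ?_⟩
  · rcases Nat.lt_or_ge (a + 1) m with hlt | hge
    · exact hva' (hx hvm hlt heq.symm)
    · rw [show a + 1 = m by omega, h.closed] at heq
      exact hv.ne (hx (by grind) hvm heq)
  · have := h.vertex_mem_edge hvm ha hmem
    omega

lemma IsModTwoCycle.edgeCross_vertex_eq {C : Multiset ((ℝ × ℝ) × (ℝ × ℝ))} (hC : IsModTwoCycle C)
    (hx : ∀ e ∈ C, e.1.1 ≠ e.2.1) (hkl : k ≤ l)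
    (hne : ∀ a ∈ Ico k l, (t a).1 ≠ (t (a + 1)).1)
    (hd : ∀ a ∈ Ico k l, ∀ e ∈ C, Disjoint (segment ℝ (t a) (t (a + 1))) (segment ℝ e.1 e.2)) :
    edgeCross C (t k) = edgeCross C (t l) := by
  induction l, hkl using Nat.le_induction with
  | base => rfl
  | succ l hkl ih =>
    have hl : l ∈ Ico k (l + 1) := by simp [hkl]
    rw [ih (fun a ha => hne a (by grind)) fun a ha => hd a (by grind)]
    exact hC.edgeCross_eq hx (hne l hl) (hd l hl)

lemma SimplePolygon.fst_ne_of_mem_innerCycle (h : SimplePolygon t m)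
    (hx : Set.InjOn (fun k => (t k).1) (Set.Iio m)) (hij : i < j) (hjm : j < m) :
    ∀ e ∈ innerCycle t i j, e.1.1 ≠ e.2.1 :=
  forall_mem_innerCycle.2 ⟨hx.ne (hij.trans hjm) hjm hij.ne,
    fun k hk => h.edge_fst_ne (by omega) hx (by grind)⟩

lemma SimplePolygon.fst_ne_of_mem_outerCycle (h : SimplePolygon t m)
    (hx : Set.InjOn (fun k => (t k).1) (Set.Iio m)) (hij : i < j) (hjm : j < m) :
    ∀ e ∈ outerCycle t m i j, e.1.1 ≠ e.2.1 :=
  forall_mem_outerCycle.2 ⟨hx.ne (hij.trans hjm) hjm hij.ne,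
    fun k hk => h.edge_fst_ne (by omega) hx (by grind)⟩

lemma SimplePolygon.edgeCross_innerCycle_lineMap (h : SimplePolygon t m)
    (hx : Set.InjOn (fun k => (t k).1) (Set.Iio m)) (hij : i < j) (hjm : j + 1 < m)
    (hav : AvoidsPolygon t m i j) {ε : ℝ} (hε : ε ∈ Set.Ioo 0 1) :
    edgeCross (innerCycle t i j) (lineMap (t j) (t (j + 1)) ε) =
      edgeCross (innerCycle t i j) (t (j + 1)) := by
  have hne : (t j).1 ≠ (t (j + 1)).1 := h.edge_fst_ne (by omega) hx (by omega)
  have hconst := (isModTwoCycle_innerCycle hij.le).edgeCross_lineMap_eq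
    (h.fst_ne_of_mem_innerCycle hx hij (by omega)) hne hε.2.le fun θ hθ => ?_
  · rwa [lineMap_apply_one] at hconst
  have hmem : lineMap (t j) (t (j + 1)) θ ∈ segment ℝ (t j) (t (j + 1)) :=
    lineMap_mem_segment ℝ _ _ ⟨hε.1.le.trans hθ.1, hθ.2⟩
  have hnot : lineMap (t j) (t (j + 1)) θ ≠ t j := fun heq => (hε.1.trans_le hθ.1).ne'
    ((lineMap_eq_left_iff.1 heq).resolve_left fun heq => hne (congrArg Prod.fst heq))
  refine forall_mem_innerCycle.2 ⟨fun hchord => ?_, fun k hk hedge => ?_⟩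
  · exact hnot (hav.eq_right h (by omega) (by omega) (by omega) (by omega) (by omega) hchord hmem)
  · rcases h.edges_inter (by grind) (by omega) hedge hmem with ⟨-, heq⟩ | ⟨-, hjm', -⟩
    · exact hnot heq
    · omega

lemma SimplePolygon.edgeCross_outerCycle_lineMap (h : SimplePolygon t m)
    (hx : Set.InjOn (fun k => (t k).1) (Set.Iio m)) (hij : i < j) (hjm : j + 1 < m)
    (hav : AvoidsPolygon t m i (j + 1)) {ε : ℝ} (hε : ε ∈ Set.Ioo 0 1) :
    edgeCross (outerCycle t m i (j + 1)) (lineMap (t (j + 1)) (t j) ε) =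
      edgeCross (outerCycle t m i (j + 1)) (t j) := by
  have hne : (t (j + 1)).1 ≠ (t j).1 := (h.edge_fst_ne (by omega) hx (by omega)).symm
  have hconst := (isModTwoCycle_outerCycle (i := i) h.closed (by omega) hjm.le).edgeCross_lineMap_eq
    (h.fst_ne_of_mem_outerCycle hx (by omega) hjm) hne hε.2.le fun θ hθ => ?_
  · rwa [lineMap_apply_one] at hconst
  have hmem : lineMap (t (j + 1)) (t j) θ ∈ segment ℝ (t j) (t (j + 1)) := by
    rw [segment_symm]
    exact lineMap_mem_segment ℝ _ _ ⟨hε.1.le.trans hθ.1, hθ.2⟩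
  have hnot : lineMap (t (j + 1)) (t j) θ ≠ t (j + 1) := fun heq => (hε.1.trans_le hθ.1).ne'
    ((lineMap_eq_left_iff.1 heq).resolve_left fun heq => hne (congrArg Prod.fst heq))
  refine forall_mem_outerCycle.2 ⟨fun hchord => ?_, fun k hk hedge => ?_⟩
  · exact hnot (hav.eq_right h (by omega) (by omega) (by omega) (by omega) (by omega) hchord hmem)
  · have hk' : k < i ∨ j + 1 ≤ k ∧ k < m := by grind
    rcases hk' with hki | ⟨hjk, hkm⟩
    · exact Set.disjoint_left.1 (h.disjoint_edges (by omega) (by omega) (by omega)) hedge hmem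
    · rcases h.edges_inter (by omega) hkm hmem hedge with ⟨rfl, heq⟩ | ⟨hj, -, -⟩
      · exact hnot heq
      · omega

lemma SimplePolygon.edgeCross_lineMap_chord (h : SimplePolygon t m)
    (hx : Set.InjOn (fun k => (t k).1) (Set.Iio m)) (hij : i < j) (hjm : j < m)
    (hav : AvoidsPolygon t m i j) {ε : ℝ} (hε : ε ∈ Set.Ioo 0 (1 / 2)) :
    edgeCross (pathEdges t (range m)) (lineMap (t j) (t i) ε) =
      edgeCross (pathEdges t (range m)) (midpoint ℝ (t i) (t j)) := by
  have hne : (t j).1 ≠ (t i).1 := hx.ne hjm (hij.trans hjm) hij.ne'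
  have hne' : t j ≠ t i := fun heq => hne (congrArg Prod.fst heq)
  rw [midpoint_comm, midpoint, invOf_eq_inv, ← one_div]
  refine (isModTwoCycle_pathEdges_range h.closed).edgeCross_lineMap_eq
    (forall_mem_pathEdges.2 fun k hk => h.edge_fst_ne (by omega) hx (by grind)) hne hε.2.le
    fun θ hθ => forall_mem_pathEdges.2 fun k hk hedge => ?_
  have hθ' : 0 < θ ∧ θ < 1 := ⟨hε.1.trans_le hθ.1, hθ.2.trans_lt (by norm_num)⟩
  have hmem : lineMap (t j) (t i) θ ∈ segment ℝ (t j) (t i) :=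
    lineMap_mem_segment ℝ _ _ ⟨hθ'.1.le, hθ'.2.le⟩
  rcases hav.symm (mem_range.1 hk) hmem hedge with heq | heq
  · exact hθ'.1.ne' ((lineMap_eq_left_iff.1 heq).resolve_left hne')
  · exact hθ'.2.ne ((lineMap_eq_right_iff.1 heq).resolve_left hne')

lemma SimplePolygon.theta_parity (h : SimplePolygon t m)
    (hx : Set.InjOn (fun k => (t k).1) (Set.Iio m)) (hij : i < j) (hjm : j + 2 < m)
    (hav : AvoidsPolygon t m i (j + 1)) :
    edgeCross (innerCycle t i (j + 1)) (t (j + 2)) +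
      edgeCross (outerCycle t m i (j + 1)) (t j) +
      edgeCross (pathEdges t (range m)) (midpoint ℝ (t i) (t (j + 1))) = 1 := by
  have hfar {a : ℕ} (ha : a < m) (hja : j ≠ a) (hja' : j + 1 ≠ a) :=
    h.edge_far_of_ne hx (Nat.succ_pos j) (by omega) ha hja' (by omega)
  have hne {a : ℕ} (ha : a < m) (hja : a ≠ j + 1) : (t a).1 ≠ (t (j + 1)).1 :=
    hx.ne ha (by grind) hja
  have huv : ∀ p ∈ segment ℝ (t (j + 1)) (t j), p ∈ segment ℝ (t (j + 1)) (t (j + 2)) →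
      p = t (j + 1) := fun p hu hv => by
    rw [segment_symm] at hu
    rcases h.edges_inter (Nat.lt_succ_self j) (by omega) hu hv with ⟨-, heq⟩ | ⟨-, hjm', -⟩
    exacts [heq, by omega]
  have hchord (a : ℕ) (ha : a = j ∨ a = j + 1) :
      ∀ p ∈ segment ℝ (t (j + 1)) (t i), p ∈ segment ℝ (t a) (t (a + 1)) → p = t (j + 1) :=
    fun p hw hp => hav.eq_right h (by omega) (by omega) (by omega) (by omega) (by omega)
      (by rwa [segment_symm]) hp
  obtain ⟨ε, hε, hsum⟩ := exists_edgeCross_theta_eq_one (b := t (j + 1)) (u := t j)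
    (v := t (j + 2)) (w := t i) (C := pathEdges t (Ico i j))
    (D := pathEdges t (range m \ Ico i (j + 2))) (hne (by omega) (by omega))
    (hne (by omega) (by omega)) (hne (by omega) (by omega)) huv
    (fun p hv hw => hchord (j + 1) (.inr rfl) p hw hv)
    (fun p hw hu => hchord j (.inl rfl) p hw (by rwa [segment_symm] at hu))
    (forall_mem_pathEdges.2 fun k hk => hfar (by grind) (by grind) (by grind))
    (forall_mem_pathEdges.2 fun k hk => hfar (by grind) (by grind) (by grind))
  have hε' : ε ∈ Set.Ioo (0 : ℝ) 1 := ⟨hε.1, hε.2.trans (by norm_num)⟩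
  have hsymm (p : ℝ × ℝ) :
      rayCross (t (j + 1)) (t (j + 2)) p = rayCross (t (j + 2)) (t (j + 1)) p :=
    rayCross_symm (hne (by omega) (by omega)).symm p
  rw [← h.edgeCross_innerCycle_lineMap hx (by omega) hjm hav hε',
    ← h.edgeCross_outerCycle_lineMap hx hij (by omega) hav hε',
    ← h.edgeCross_lineMap_chord hx (by omega) (by omega) hav hε,
    ← edgeCross_innerCycle_add_outerCycle (i := i) (j := j + 1) (by omega), ← hsum]
  simp only [edgeCross_innerCycle_succ hij.le, edgeCross_outerCycle_eq (show i ≤ j + 1 by omega)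
    (show j + 1 < m by omega), hsymm]
  linear_combination
    CharTwo.add_self_eq_zero (rayCross (t i) (t (j + 1)) (lineMap (t (j + 1)) (t i) ε))

end Theta

section Interleaved

open Finset AffineMap

variable {t : ℕ → ℝ × ℝ} {m i j k l : ℕ}

lemma IsModTwoCycle.edgeCross_midpoint_eq {C : Multiset ((ℝ × ℝ) × (ℝ × ℝ))} (hC : IsModTwoCycle C)
    (hx : ∀ e ∈ C, e.1.1 ≠ e.2.1) {u v : ℝ × ℝ} (huv : u.1 ≠ v.1)
    (hmeet : ∀ e ∈ C, ∀ p ∈ segment ℝ u v, p ∈ segment ℝ e.1 e.2 → p = u) :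
    edgeCross C (midpoint ℝ u v) = edgeCross C v := by
  rw [midpoint, invOf_eq_inv]
  have hconst := hC.edgeCross_lineMap_eq hx huv (show (2 : ℝ)⁻¹ ≤ 1 by norm_num)
    fun θ hθ e he hmem => ?_
  · rwa [lineMap_apply_one] at hconst
  have hθ0 : 0 < θ := lt_of_lt_of_le (by norm_num) hθ.1
  have hθu := hmeet e he _ (lineMap_mem_segment ℝ u v ⟨hθ0.le, hθ.2⟩) hmem
  exact hθ0.ne' ((lineMap_eq_left_iff.1 hθu).resolve_left fun heq => huv (congrArg Prod.fst heq))

lemma SimplePolygon.edgeCross_innerCycle_vertex_eq (h : SimplePolygon t m)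
    (hx : Set.InjOn (fun k => (t k).1) (Set.Iio m)) (hij : i < j) (hjl : j < l) (hlm : l < m)
    (hav : AvoidsPolygon t m i j) :
    edgeCross (innerCycle t i j) (t (j + 1)) = edgeCross (innerCycle t i j) (t l) := by
  refine (isModTwoCycle_innerCycle hij.le).edgeCross_vertex_eq
    (h.fst_ne_of_mem_innerCycle hx hij (by omega)) hjl
    (fun a ha => h.edge_fst_ne (by omega) hx (by grind)) fun a ha => ?_
  have ha' : j < a ∧ a + 1 < m := by grind
  refine forall_mem_innerCycle.2 ⟨?_, fun e he => ?_⟩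
  · apply hav.disjoint_edge h <;> omega
  · exact (h.disjoint_edges (by grind) (by omega) (by omega)).symm

lemma SimplePolygon.edgeCross_outerCycle_vertex_eq (h : SimplePolygon t m)
    (hx : Set.InjOn (fun k => (t k).1) (Set.Iio m)) (hik : i < k) (hkj : k ≤ j) (hjm : j + 1 < m)
    (hav : AvoidsPolygon t m i (j + 1)) :
    edgeCross (outerCycle t m i (j + 1)) (t k) = edgeCross (outerCycle t m i (j + 1)) (t j) := by
  refine (isModTwoCycle_outerCycle h.closed (by omega) hjm.le).edgeCross_vertex_eq
    (h.fst_ne_of_mem_outerCycle hx (by omega) hjm) hkj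
    (fun a ha => h.edge_fst_ne (by omega) hx (by grind)) fun a ha => ?_
  have ha' : i < a ∧ a < j := by grind
  refine forall_mem_outerCycle.2 ⟨?_, fun e he => ?_⟩
  · apply hav.disjoint_edge h <;> omega
  · have he' : e < i ∨ j + 1 ≤ e ∧ e < m := by grind
    rcases he' with hei | ⟨hje, hem⟩
    · exact (h.disjoint_edges (by omega) (by omega) (by omega)).symm
    · exact h.disjoint_edges (by omega) hem (by omega)

lemma SimplePolygon.edgeCross_innerCycle_midpoint_eq (h : SimplePolygon t m)
    (hx : Set.InjOn (fun k => (t k).1) (Set.Iio m)) (hik : i < k) (hkj : k < j) (hjl : j < l)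
    (hlm : l < m) (hav : AvoidsPolygon t m k l)
    (hdisj : Disjoint (segment ℝ (t i) (t j)) (segment ℝ (t k) (t l))) :
    edgeCross (innerCycle t i j) (midpoint ℝ (t k) (t l)) = edgeCross (innerCycle t i j) (t l) := by
  refine (isModTwoCycle_innerCycle (by omega)).edgeCross_midpoint_eq
    (h.fst_ne_of_mem_innerCycle hx (by omega) (by omega))
    (hx.ne (by grind) hlm (by omega : k ≠ l))
    (forall_mem_innerCycle.2 ⟨fun p hp hij => ?_, fun e he p hp hpe => ?_⟩)
  · exact absurd hp (Set.disjoint_left.1 hdisj hij)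
  · rw [segment_symm] at hp
    apply hav.symm.eq_right h hlm _ _ _ _ hp hpe <;> grind

lemma SimplePolygon.edgeCross_outerCycle_midpoint_eq (h : SimplePolygon t m)
    (hx : Set.InjOn (fun k => (t k).1) (Set.Iio m)) (hik : i < k) (hkj : k < j) (hjl : j < l)
    (hlm : l < m) (hav : AvoidsPolygon t m k l)
    (hdisj : Disjoint (segment ℝ (t i) (t j)) (segment ℝ (t k) (t l))) :
    edgeCross (outerCycle t m i j) (midpoint ℝ (t k) (t l)) =
      edgeCross (outerCycle t m i j) (t k) := by
  rw [midpoint_comm]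
  refine (isModTwoCycle_outerCycle h.closed (by omega) (by omega)).edgeCross_midpoint_eq
    (h.fst_ne_of_mem_outerCycle hx (by omega) (by omega))
    (hx.ne hlm (by grind) (by omega : l ≠ k))
    (forall_mem_outerCycle.2 ⟨fun p hp hij => ?_, fun e he p hp hpe => ?_⟩)
  · rw [segment_symm] at hp
    exact absurd hp (Set.disjoint_left.1 hdisj hij)
  · rw [segment_symm] at hp
    apply hav.eq_right h _ _ _ _ _ hp hpe <;> grind

lemma SimplePolygon.edgeCross_midpoint_add_edgeCross_midpoint (h : SimplePolygon t m)
    (hx : Set.InjOn (fun k => (t k).1) (Set.Iio m)) (hik : i < k) (hkj : k < j) (hjl : j < l)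
    (hlm : l < m) (hav : AvoidsPolygon t m i j) (hav' : AvoidsPolygon t m k l)
    (hdisj : Disjoint (segment ℝ (t i) (t j)) (segment ℝ (t k) (t l))) :
    edgeCross (pathEdges t (range m)) (midpoint ℝ (t i) (t j)) +
      edgeCross (pathEdges t (range m)) (midpoint ℝ (t k) (t l)) = 1 := by
  obtain ⟨j, rfl⟩ : ∃ n, j = n + 1 := ⟨j - 1, by omega⟩
  rw [← h.theta_parity hx (by omega) (by omega) hav,
    ← edgeCross_innerCycle_add_outerCycle (i := i) (j := j + 1) (by omega) (midpoint ℝ (t k) (t l)),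
    h.edgeCross_innerCycle_midpoint_eq hx hik hkj hjl hlm hav' hdisj,
    h.edgeCross_outerCycle_midpoint_eq hx hik hkj hjl hlm hav' hdisj,
    h.edgeCross_innerCycle_vertex_eq hx (by omega) hjl hlm hav,
    h.edgeCross_outerCycle_vertex_eq hx hik (by omega) (by omega) hav, add_comm]

end Interleaved

section Side

open Finset

/-- The shear `(x, y) ↦ (x + s y, y)`, used to give the vertices of a polygon distinct
abscissas. -/
noncomputable def shear (s : ℝ) : Plane →ₗ[ℝ] ℝ × ℝ where
  toFun p := (p 0 + s * p 1, p 1)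
  map_add' p q := by ext <;> simp only [PiLp.add_apply, Prod.fst_add, Prod.snd_add]; ring
  map_smul' c p := by
    ext <;> simp only [PiLp.smul_apply, Prod.smul_fst, Prod.smul_snd, smul_eq_mul, RingHom.id_apply]
    ring

lemma plane_ext {p q : Plane} (h0 : p 0 = q 0) (h1 : p 1 = q 1) : p = q := by
  ext i
  fin_cases i
  exacts [h0, h1]

lemma shear_injective (s : ℝ) : Function.Injective (shear s) := by
  intro p q h
  have hsnd : p 1 = q 1 := congrArg Prod.snd h
  have hfst : p 0 + s * p 1 = q 0 + s * q 1 := congrArg Prod.fst h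
  exact plane_ext (by rwa [hsnd, add_left_inj] at hfst) hsnd

lemma exists_injOn_fst_shear (A : Finset Plane) :
    ∃ s : ℝ, Set.InjOn (fun p => (shear s p).1) A := by
  classical
  obtain ⟨s, hs⟩ := Infinite.exists_notMem_finset
    ((A ×ˢ A).image fun x => (x.1 0 - x.2 0) / (x.2 1 - x.1 1))
  refine ⟨s, fun p hp q hq h => ?_⟩
  have hfst : p 0 + s * p 1 = q 0 + s * q 1 := h
  by_cases hsnd : p 1 = q 1
  · exact plane_ext (by rwa [hsnd, add_left_inj] at hfst) hsnd
  · refine absurd (mem_image.2 ⟨(p, q), mem_product.2 ⟨hp, hq⟩, ?_⟩) hs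
    rw [div_eq_iff (sub_ne_zero.2 (Ne.symm hsnd))]
    linarith

/-- The side on which a chord lies is the number modulo two of edges above its midpoint, after a
generic shear. -/
lemma SimplePolygon.exists_side {t : ℕ → Plane} {m : ℕ} (h : SimplePolygon t m) :
    ∃ side : ℕ → ℕ → ZMod 2, ∀ ⦃i k j l⦄, i < k → k < j → j < l → l < m →
      AvoidsPolygon t m i j → AvoidsPolygon t m k l →
      Disjoint (segment ℝ (t i) (t j)) (segment ℝ (t k) (t l)) → side i j ≠ side k l := by
  classical
  obtain ⟨s, hs⟩ := exists_injOn_fst_shear ((range m).image t)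
  have hinj : Function.Injective (shear s).toAffineMap := shear_injective s
  have hx : Set.InjOn (fun k => (shear s (t k)).1) (Set.Iio m) :=
    hs.comp h.injOn fun k hk => mem_image_of_mem t (mem_range.2 hk)
  refine ⟨fun i j => edgeCross (pathEdges (fun k => shear s (t k)) (range m))
    (midpoint ℝ (shear s (t i)) (shear s (t j))), ?_⟩
  intro i k j l hik hkj hjl hlm hav hav' hdisj heq
  have hdisj' := (Set.disjoint_image_iff hinj).2 hdisj
  rw [image_segment, image_segment] at hdisj'
  have hsum := (h.map hinj).edgeCross_midpoint_add_edgeCross_midpoint hx hik hkj hjl hlm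
    (hav.map hinj) (hav'.map hinj) hdisj'
  exact zero_ne_one ((CharTwo.add_self_eq_zero _).symm.trans ((congrArg _ heq).trans hsum))

end Side

section Chords

open Finset Real

lemma wbtw_or_wbtw_of_wbtw_of_wbtw {E : Type*} [AddCommGroup E] [Module ℝ E] {x p y z : E}
    (hy : Wbtw ℝ x p y) (hz : Wbtw ℝ x p z) (hp : p ≠ x) : Wbtw ℝ p y z ∨ Wbtw ℝ p z y := by
  have hray : SameRay ℝ (y -ᵥ x) (z -ᵥ x) := hy.sameRay_vsub_left.symm.trans hz.sameRay_vsub_left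
    fun h => absurd (vsub_eq_zero_iff_eq.1 h) hp
  exact (wbtw_total_of_sameRay_vsub_left hray).imp (·.trans_left_right hy) (·.trans_left_right hz)

lemma wbtw_of_dist_add_dist_le {a b x y p : Plane}
    (hopt : dist a b + dist x y ≤ dist a x + dist b y) (hab : Wbtw ℝ a p b) (hxy : Wbtw ℝ x p y) :
    Wbtw ℝ a p x ∧ Wbtw ℝ b p y := by
  rw [← dist_add_dist_eq_iff] at hab hxy ⊢
  rw [← dist_add_dist_eq_iff]
  have hax := dist_triangle a p x
  have hby := dist_triangle b p y
  rw [dist_comm x p] at hxy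
  rw [dist_comm b p] at hby ⊢
  constructor <;> linarith

variable {t : ℕ → Plane} {m : ℕ}

lemma AvoidsPolygon.eq_or_eq_of_mem_segment {i j a : ℕ} (hav : AvoidsPolygon t m i j)
    (h : SimplePolygon t m) (hi : i < m) (hj : j < m) (ha : a < m)
    (hmem : t a ∈ segment ℝ (t i) (t j)) : a = i ∨ a = j :=
  (hav ha hmem (left_mem_segment _ _ _)).imp (h.injOn ha hi) (h.injOn ha hj)

lemma SimplePolygon.disjoint_chords (h : SimplePolygon t m) {i k j l : ℕ}
    (hik : i < k) (hkj : k < j) (hjl : j < l) (hlm : l < m) (hav : AvoidsPolygon t m i j)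
    (hav' : AvoidsPolygon t m k l)
    (hopt : dist (t i) (t j) + dist (t k) (t l) ≤ dist (t i) (t k) + dist (t j) (t l)) :
    Disjoint (segment ℝ (t i) (t j)) (segment ℝ (t k) (t l)) := by
  rw [Set.disjoint_left]
  intro p hij hkl
  have hpi : p ≠ t i := by
    rintro rfl
    have := hav'.eq_or_eq_of_mem_segment h (by omega) hlm (by omega) hkl
    omega
  have hik' := (wbtw_of_dist_add_dist_le hopt (mem_segment_iff_wbtw.1 hij)
    (mem_segment_iff_wbtw.1 hkl)).1
  rcases wbtw_or_wbtw_of_wbtw_of_wbtw (mem_segment_iff_wbtw.1 hij) hik' hpi with hw | hw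
  · have := hav'.eq_or_eq_of_mem_segment h (by omega) hlm (by omega)
      ((convex_segment (t k) (t l)).segment_subset hkl (left_mem_segment _ _ _)
        (mem_segment_iff_wbtw.2 hw))
    omega
  · have := hav.eq_or_eq_of_mem_segment h (by omega) (by omega) (by omega)
      ((convex_segment (t i) (t j)).segment_subset hij (right_mem_segment _ _ _)
        (mem_segment_iff_wbtw.2 hw))
    omega

/-- The chord between two cyclically adjacent vertices, i.e. an edge of the polygon. -/
def IsAdjacentPair (m i j : ℕ) : Prop :=
  j = i + 1 ∨ i = j + 1 ∨ (i = 0 ∧ j + 1 = m) ∨ (j = 0 ∧ i + 1 = m)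

/-- A family of directed chords of the closed polygon `t 0, …, t (m - 1)` among which there is no
improving 2-move. -/
structure IsTwoOptFamily (t : ℕ → Plane) (m : ℕ) (E : Finset (ℕ × ℕ)) : Prop where
  fst_lt : ∀ e ∈ E, e.1 < m
  snd_lt : ∀ e ∈ E, e.2 < m
  fst_ne_snd : ∀ e ∈ E, e.1 ≠ e.2
  not_improving : ∀ e ∈ E, ∀ f ∈ E, e ≠ f → dist (t e.1) (t e.2) + dist (t f.1) (t f.2) ≤
    dist (t e.1) (t f.1) + dist (t e.2) (t f.2)

/-- A 2-optimal family each of whose chords is an edge of the polygon or meets the polygon in its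
end points only. -/
structure IsTwoOptChordFamily (t : ℕ → Plane) (m : ℕ) (E : Finset (ℕ × ℕ)) : Prop
    extends IsTwoOptFamily t m E where
  avoids_or_adjacent : ∀ e ∈ E, AvoidsPolygon t m e.1 e.2 ∨ IsAdjacentPair m e.1 e.2

variable {E F : Finset (ℕ × ℕ)}

lemma IsTwoOptFamily.mono (hE : IsTwoOptFamily t m E) (hFE : F ⊆ E) : IsTwoOptFamily t m F where
  fst_lt e he := hE.fst_lt e (hFE he)
  snd_lt e he := hE.snd_lt e (hFE he)
  fst_ne_snd e he := hE.fst_ne_snd e (hFE he)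
  not_improving e he f hf := hE.not_improving e (hFE he) f (hFE hf)

namespace IsTwoOptChordFamily

lemma mono (hE : IsTwoOptChordFamily t m E) (hFE : F ⊆ E) : IsTwoOptChordFamily t m F where
  toIsTwoOptFamily := hE.toIsTwoOptFamily.mono hFE
  avoids_or_adjacent e he := hE.avoids_or_adjacent e (hFE he)

lemma map_prodComm (hE : IsTwoOptChordFamily t m E) :
    IsTwoOptChordFamily t m (E.map (Equiv.prodComm ℕ ℕ).toEmbedding) where
  fst_lt := forall_mem_map.2 hE.snd_lt
  snd_lt := forall_mem_map.2 hE.fst_lt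
  fst_ne_snd := forall_mem_map.2 fun e he => (hE.fst_ne_snd e he).symm
  not_improving := forall_mem_map.2 fun e he => forall_mem_map.2 fun f hf hne => by
    have hopt := hE.not_improving e he f hf (ne_of_apply_ne _ hne)
    simp only [Equiv.coe_toEmbedding, Equiv.prodComm_apply, Prod.fst_swap, Prod.snd_swap]
    rwa [dist_comm (t e.2) (t e.1), dist_comm (t f.2) (t f.1),
      add_comm (dist (t e.2) (t f.2)) (dist (t e.1) (t f.1))]
  avoids_or_adjacent := forall_mem_map.2 fun e he =>
    (hE.avoids_or_adjacent e he).imp AvoidsPolygon.symm fun hadj => by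
      unfold IsAdjacentPair at hadj ⊢
      simp only [Equiv.coe_toEmbedding, Equiv.prodComm_apply, Prod.fst_swap, Prod.snd_swap]
      omega

lemma isLaminar (hE : IsTwoOptChordFamily t m E) (h : SimplePolygon t m)
    (hlt : ∀ e ∈ E, e.1 < e.2) {side : ℕ → ℕ → ZMod 2} {s : ZMod 2}
    (hside : ∀ ⦃i k j l⦄, i < k → k < j → j < l → l < m → AvoidsPolygon t m i j →
      AvoidsPolygon t m k l → Disjoint (segment ℝ (t i) (t j)) (segment ℝ (t k) (t l)) →
      side i j ≠ side k l)
    (hs : ∀ e ∈ E, side e.1 e.2 = s) : IsLaminar m E where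
  fst_lt_snd := hlt
  snd_lt := hE.snd_lt
  not_interleaved := by
    rintro e he f hf ⟨hef, hfe, hef'⟩
    have hav {d : ℕ × ℕ} (hd : d ∈ E) (hsep : ¬ IsAdjacentPair m d.1 d.2) :=
      (hE.avoids_or_adjacent d hd).resolve_right hsep
    have hfm := hE.snd_lt f hf
    have hav_e := hav he (by unfold IsAdjacentPair; omega)
    have hav_f := hav hf (by unfold IsAdjacentPair; omega)
    have hne : e ≠ f := by
      rintro rfl
      exact hef.false
    exact hside hef hfe hef' hfm hav_e hav_f
      (h.disjoint_chords hef hfe hef' hfm hav_e hav_f (hE.not_improving e he f hf hne))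
      ((hs e he).trans (hs f hf).symm)

lemma sum_dist_le_of_fst_lt_snd (hE : IsTwoOptChordFamily t m E) (h : SimplePolygon t m)
    (hlt : ∀ e ∈ E, e.1 < e.2) {K : ℝ} (hK : 1 < K) :
    ∑ e ∈ E, dist (t e.1) (t e.2) ≤ 2 * ((∑ r ∈ range m, dist (t r) (t (r + 1))) *
      (K / 2 + (1 + 2 * log (#E + 1)) / log K)) := by
  obtain ⟨side, hside⟩ := h.exists_side
  have hlogK := log_pos hK
  have hclass (s : ZMod 2) : ∑ e ∈ E with side e.1 e.2 = s, dist (t e.1) (t e.2) ≤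
      (∑ r ∈ range m, dist (t r) (t (r + 1))) * (K / 2 + (1 + 2 * log (#E + 1)) / log K) := by
    have hF := hE.mono (filter_subset (fun e => side e.1 e.2 = s) E)
    have hcard := card_filter_le E fun e => side e.1 e.2 = s
    refine ((hF.isLaminar h (fun e he => hlt e (mem_of_mem_filter e he)) hside
      fun e he => (mem_filter.1 he).2).sum_dist_le h.closed hF.not_improving hK).trans ?_
    gcongr
  rw [← sum_fiberwise E fun e => side e.1 e.2, two_mul]
  exact (Fin.sum_univ_two _).trans_le (add_le_add (hclass 0) (hclass 1))

lemma sum_dist_le (hE : IsTwoOptChordFamily t m E) (h : SimplePolygon t m) {K : ℝ} (hK : 1 < K) :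
    ∑ e ∈ E, dist (t e.1) (t e.2) ≤ 4 * ((∑ r ∈ range m, dist (t r) (t (r + 1))) *
      (K / 2 + (1 + 2 * log (#E + 1)) / log K)) := by
  set T := ∑ r ∈ range m, dist (t r) (t (r + 1))
  have hlogK := log_pos hK
  have hforward : ∑ e ∈ E with e.1 < e.2, dist (t e.1) (t e.2) ≤
      2 * (T * (K / 2 + (1 + 2 * log (#E + 1)) / log K)) := by
    have hcard := card_filter_le E fun e => e.1 < e.2
    refine ((hE.mono (filter_subset _ E)).sum_dist_le_of_fst_lt_snd h
      (fun e he => (mem_filter.1 he).2) hK).trans ?_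
    gcongr
  have hbackward : ∑ e ∈ E with ¬ e.1 < e.2, dist (t e.1) (t e.2) ≤
      2 * (T * (K / 2 + (1 + 2 * log (#E + 1)) / log K)) := by
    have hcard := card_filter_le E fun e => ¬ e.1 < e.2
    have hswap := (hE.mono (filter_subset (fun e => ¬ e.1 < e.2) E)).map_prodComm
      |>.sum_dist_le_of_fst_lt_snd h (forall_mem_map.2 fun e he => lt_of_le_of_ne
        (not_lt.1 (mem_filter.1 he).2) (hE.fst_ne_snd e (mem_of_mem_filter e he)).symm) hK
    rw [sum_map, card_map] at hswap
    simp only [Equiv.coe_toEmbedding, Equiv.prodComm_apply, Prod.fst_swap, Prod.snd_swap,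
      dist_comm] at hswap ⊢
    refine hswap.trans ?_
    gcongr
  rw [← sum_filter_add_sum_filter_not E fun e => e.1 < e.2]
  linarith

end IsTwoOptChordFamily

end Chords

section Betweenness

variable {E : Type*} [AddCommGroup E] [Module ℝ E] {x z u w p y : E}

lemma wbtw_or_wbtw_of_collinear (h : Collinear ℝ {x, u, w}) (hp : Wbtw ℝ u p w) :
    Wbtw ℝ x p u ∨ Wbtw ℝ x p w := by
  rcases h.wbtw_or_wbtw_or_wbtw with hxuw | huwx | hwxu
  · exact Or.inr (hxuw.trans_right hp)
  · exact Or.inl (huwx.trans_left hp).symm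
  · obtain ⟨s, hs, rfl⟩ := hwxu.symm
    obtain ⟨r, hr, rfl⟩ := hp
    rcases le_total r s with hrs | hsr
    · left
      simpa using ((wbtw_iff_of_le hs.1).2 ⟨hr.1, hrs⟩).symm.map (AffineMap.lineMap u w)
    · right
      simpa using ((wbtw_iff_of_le hs.2).2 ⟨hsr, hr.2⟩).map (AffineMap.lineMap u w)

lemma wbtw_of_sbtw_of_not_sbtw (hp : Sbtw ℝ u p w) (hy : Wbtw ℝ w p y) (hnot : ¬Sbtw ℝ u y w) :
    Wbtw ℝ p u y := by
  rcases wbtw_or_wbtw_of_wbtw_of_wbtw hp.wbtw.symm hy hp.ne_right with hpuy | hpyu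
  · exact hpuy
  · have hyw : y ≠ w := by
      rintro rfl
      exact hp.ne_right ((wbtw_self_iff ℝ).1 hy)
    have huyw : Wbtw ℝ u y w := hp.wbtw.trans_left hpyu.symm
    have hyu : y = u := by_contra fun hne => hnot ⟨huyw, hne, hyw⟩
    exact hyu ▸ wbtw_self_right ℝ p y

lemma wbtw_and_wbtw_of_sbtw (hcol : Collinear ℝ {x, u, w}) (hp : Sbtw ℝ u p w)
    (hpxz : Wbtw ℝ x p z) (hx : ¬Sbtw ℝ u x w) (hz : ¬Sbtw ℝ u z w) :
    Wbtw ℝ x u z ∧ Wbtw ℝ x w z := by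
  wlog hpxw : Wbtw ℝ x p w generalizing u w
  · have hpxu := (wbtw_or_wbtw_of_collinear hcol hp.wbtw).resolve_right hpxw
    rw [sbtw_comm] at hx hz
    exact (this (Set.pair_comm u w ▸ hcol) hp.symm hx hz hpxu).symm
  have hpux : Wbtw ℝ p u x := wbtw_of_sbtw_of_not_sbtw hp hpxw.symm hx
  have hupz : Wbtw ℝ u p z := hpxz.trans_left_right hpux.symm
  rw [sbtw_comm] at hz
  exact ⟨hpxz.trans_left hpux.symm,
    hpxz.trans_right (wbtw_of_sbtw_of_not_sbtw hp.symm hupz hz)⟩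

end Betweenness

section Refinement

open Finset

/-- The closed polygon obtained from `t` by inserting the new vertex `p` between `t r` and
`t (r + 1)`. -/
def insertVertex {E : Type*} (t : ℕ → E) (r : ℕ) (p : E) (k : ℕ) : E :=
  if k ≤ r then t k else if k = r + 1 then p else t (k - 1)

/-- The edge of `t` that contains the edge `a` of `insertVertex t r p`. -/
def edgeBeforeInsert (r a : ℕ) : ℕ :=
  if a ≤ r then a else a - 1

section Insert

variable {E : Type*} {t : ℕ → E} {m r k a : ℕ} {p : E}

lemma insertVertex_of_le (hk : k ≤ r) : insertVertex t r p k = t k :=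
  if_pos hk

lemma insertVertex_self : insertVertex t r p (r + 1) = p := by
  simp [insertVertex]

lemma insertVertex_add_one (hk : r < k) : insertVertex t r p (k + 1) = t k := by
  rw [insertVertex, if_neg (by omega), if_neg (by omega), Nat.add_sub_cancel]

lemma insertVertex_of_ne (hk : k ≠ r + 1) : insertVertex t r p k = t (edgeBeforeInsert r k) := by
  simp only [insertVertex, edgeBeforeInsert, if_neg hk]
  split_ifs <;> rfl

lemma edgeBeforeInsert_lt (hr : r < m) (ha : a < m + 1) : edgeBeforeInsert r a < m := by
  unfold edgeBeforeInsert
  split_ifs <;> omega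

end Insert

section Module

variable {E : Type*} [AddCommGroup E] [Module ℝ E] {t : ℕ → E} {m r a : ℕ} {p : E}

lemma edge_insertVertex_subset (hp : p ∈ segment ℝ (t r) (t (r + 1))) (a : ℕ) :
    segment ℝ (insertVertex t r p a) (insertVertex t r p (a + 1)) ⊆
      segment ℝ (t (edgeBeforeInsert r a)) (t (edgeBeforeInsert r a + 1)) := by
  rcases lt_trichotomy a r with har | rfl | hra
  · rw [insertVertex_of_le har.le, insertVertex_of_le har, edgeBeforeInsert, if_pos har.le]
  · rw [insertVertex_of_le le_rfl, insertVertex_self, edgeBeforeInsert, if_pos le_rfl]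
    exact (convex_segment _ _).segment_subset (left_mem_segment _ _ _) hp
  · obtain ⟨a, rfl⟩ := Nat.exists_eq_add_one_of_ne_zero hra.ne_bot
    rw [insertVertex_add_one hra, edgeBeforeInsert, if_neg hra.not_ge, Nat.add_sub_cancel]
    rcases (Nat.lt_succ_iff.1 hra).eq_or_lt with rfl | hra
    · rw [insertVertex_self]
      exact (convex_segment _ _).segment_subset hp (right_mem_segment _ _ _)
    · rw [insertVertex_add_one hra]

lemma exists_mem_edge_insertVertex (hp : p ∈ segment ℝ (t r) (t (r + 1))) (ha : a < m) {x : E}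
    (hx : x ∈ segment ℝ (t a) (t (a + 1))) : ∃ b < m + 1,
      x ∈ segment ℝ (insertVertex t r p b) (insertVertex t r p (b + 1)) := by
  rcases lt_trichotomy a r with har | rfl | hra
  · refine ⟨a, by omega, ?_⟩
    rwa [insertVertex_of_le har.le, insertVertex_of_le har]
  · rw [mem_segment_iff_wbtw] at hp hx
    rcases wbtw_or_wbtw_of_collinear (Set.insert_comm p _ _ ▸ hp.collinear) hx with hpx | hpx
    · refine ⟨a, by omega, ?_⟩
      rw [insertVertex_of_le le_rfl, insertVertex_self]
      exact mem_segment_iff_wbtw.2 hpx.symm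
    · refine ⟨a + 1, by omega, ?_⟩
      rw [insertVertex_self, insertVertex_add_one a.lt_succ_self]
      exact mem_segment_iff_wbtw.2 hpx
  · refine ⟨a + 1, by omega, ?_⟩
    rwa [insertVertex_add_one hra, insertVertex_add_one (by omega)]

namespace SimplePolygon

lemma injOn_insertVertex (h : SimplePolygon t m) (hr : r < m) (hnew : ∀ k < m, t k ≠ p) :
    Set.InjOn (insertVertex t r p) (Set.Iio (m + 1)) := by
  intro a ha b hb hab
  have hlt {c : ℕ} (hc : c < m + 1) := edgeBeforeInsert_lt hr hc
  by_cases har : a = r + 1 <;> by_cases hbr : b = r + 1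
  · omega
  · rw [har, insertVertex_self, insertVertex_of_ne hbr] at hab
    exact absurd hab.symm (hnew _ (hlt hb))
  · rw [hbr, insertVertex_self, insertVertex_of_ne har] at hab
    exact absurd hab (hnew _ (hlt ha))
  · rw [insertVertex_of_ne har, insertVertex_of_ne hbr] at hab
    have := h.injOn (hlt ha) (hlt hb) hab
    unfold edgeBeforeInsert at this
    split_ifs at this <;> omega

lemma apply_ne_of_le (h : SimplePolygon t m) (hm : 0 < m) (hnew : ∀ k < m, t k ≠ p) {k : ℕ}
    (hk : k ≤ m) : t k ≠ p := by
  rcases hk.lt_or_eq with hk | rfl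
  · exact hnew k hk
  · exact h.closed ▸ hnew 0 hm

lemma ne_of_mem_edge_insertVertex (h : SimplePolygon t m) (hr : r < m)
    (hp : p ∈ segment ℝ (t r) (t (r + 1))) (hnew : ∀ k < m, t k ≠ p) {x : E}
    (hx : x ∈ segment ℝ (insertVertex t r p r) (insertVertex t r p (r + 1))) :
    x ≠ t (r + 1) := by
  rintro rfl
  rw [insertVertex_of_le le_rfl, insertVertex_self, mem_segment_iff_wbtw] at hx
  exact h.apply_ne_of_le (by omega) hnew hr
    ((wbtw_swap_right_iff ℝ _).1 ⟨hx, mem_segment_iff_wbtw.1 hp⟩)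

lemma ne_of_mem_edge_insertVertex_add_one (hr : r < m) (hp : p ∈ segment ℝ (t r) (t (r + 1)))
    (hnew : ∀ k < m, t k ≠ p) {x : E}
    (hx : x ∈ segment ℝ (insertVertex t r p (r + 1)) (insertVertex t r p (r + 1 + 1))) :
    x ≠ t r := by
  rintro rfl
  rw [insertVertex_self, insertVertex_add_one r.lt_succ_self, mem_segment_iff_wbtw] at hx
  exact hnew r hr ((wbtw_swap_left_iff ℝ _).1 ⟨mem_segment_iff_wbtw.1 hp, hx⟩)

lemma eq_of_mem_edges_insertVertex (hp : p ∈ segment ℝ (t r) (t (r + 1))) {x : E}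
    (hx : x ∈ segment ℝ (insertVertex t r p r) (insertVertex t r p (r + 1)))
    (hx' : x ∈ segment ℝ (insertVertex t r p (r + 1)) (insertVertex t r p (r + 1 + 1))) :
    x = p := by
  rw [insertVertex_of_le le_rfl, insertVertex_self, mem_segment_iff_wbtw] at hx
  rw [insertVertex_self, insertVertex_add_one r.lt_succ_self, mem_segment_iff_wbtw] at hx'
  exact (wbtw_swap_left_iff ℝ _).1 ⟨(mem_segment_iff_wbtw.1 hp).trans_left_right hx, hx'⟩

lemma edges_inter_insertVertex (h : SimplePolygon t m) (hr : r < m)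
    (hp : p ∈ segment ℝ (t r) (t (r + 1))) (hnew : ∀ k < m, t k ≠ p) {b : ℕ} (hab : a < b)
    (hb : b < m + 1) {x : E}
    (hxa : x ∈ segment ℝ (insertVertex t r p a) (insertVertex t r p (a + 1)))
    (hxb : x ∈ segment ℝ (insertVertex t r p b) (insertVertex t r p (b + 1))) :
    (b = a + 1 ∧ x = insertVertex t r p b) ∨
      (a = 0 ∧ b + 1 = m + 1 ∧ x = insertVertex t r p 0) := by
  rcases eq_or_ne (edgeBeforeInsert r a) (edgeBeforeInsert r b) with heq | hne
  · obtain ⟨rfl, rfl⟩ : a = r ∧ b = r + 1 := by unfold edgeBeforeInsert at heq; grind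
    exact Or.inl ⟨rfl, (eq_of_mem_edges_insertVertex hp hxa hxb).trans insertVertex_self.symm⟩
  have hlt : edgeBeforeInsert r a < edgeBeforeInsert r b := by
    unfold edgeBeforeInsert at hne ⊢; grind
  have har (hx : x = t (r + 1)) : a ≠ r := by
    rintro rfl
    exact h.ne_of_mem_edge_insertVertex hr hp hnew hxa hx
  rcases h.edges_inter hlt (edgeBeforeInsert_lt hr hb) (edge_insertVertex_subset hp a hxa)
    (edge_insertVertex_subset hp b hxb) with ⟨hadj, hx⟩ | ⟨ha, hbm, hx⟩
  · have hbr : b ≠ r + 1 := by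
      rintro rfl
      rw [edgeBeforeInsert, if_neg (by omega)] at hx
      exact ne_of_mem_edge_insertVertex_add_one hr hp hnew hxb hx
    refine Or.inl ⟨?_, hx.trans (insertVertex_of_ne hbr).symm⟩
    unfold edgeBeforeInsert at hadj hx
    grind
  · have ha0 : a = 0 := by
      by_contra ha0
      obtain ⟨rfl, rfl⟩ : a = r + 1 ∧ r = 0 := by unfold edgeBeforeInsert at ha; grind
      exact ne_of_mem_edge_insertVertex_add_one hr hp hnew hxa hx
    have hbm' : b = m := by
      by_contra hbm'
      obtain ⟨rfl, rfl⟩ : b = r ∧ r + 1 = m := by unfold edgeBeforeInsert at hbm; grind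
      exact h.ne_of_mem_edge_insertVertex hr hp hnew hxb (hx.trans h.closed.symm)
    exact Or.inr ⟨ha0, by rw [hbm'], hx.trans (insertVertex_of_le r.zero_le).symm⟩

lemma insertVertex (h : SimplePolygon t m) (hr : r < m) (hp : p ∈ segment ℝ (t r) (t (r + 1)))
    (hnew : ∀ k < m, t k ≠ p) : SimplePolygon (insertVertex t r p) (m + 1) where
  closed := by rw [insertVertex_add_one hr, insertVertex_of_le r.zero_le, h.closed]
  injOn := h.injOn_insertVertex hr hnew
  edges_inter _ _ hab hb _ := h.edges_inter_insertVertex hr hp hnew hab hb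

end SimplePolygon

end Module

lemma sum_dist_insertVertex {E : Type*} [SeminormedAddCommGroup E] [NormedSpace ℝ E] {t : ℕ → E}
    {m r : ℕ} {p : E} (hr : r < m) (hp : p ∈ segment ℝ (t r) (t (r + 1))) :
    ∑ k ∈ range (m + 1), dist (insertVertex t r p k) (insertVertex t r p (k + 1)) =
      ∑ k ∈ range m, dist (t k) (t (k + 1)) := by
  obtain ⟨s, rfl⟩ := Nat.exists_eq_add_of_lt hr
  have hlow : ∑ k ∈ range r, dist (insertVertex t r p k) (insertVertex t r p (k + 1)) =
      ∑ k ∈ range r, dist (t k) (t (k + 1)) := sum_congr rfl fun k hk => by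
    rw [mem_range] at hk
    rw [insertVertex_of_le hk.le, insertVertex_of_le hk]
  have hhigh : ∑ k ∈ range s, dist (insertVertex t r p (r + 1 + 1 + k))
      (insertVertex t r p (r + 1 + 1 + k + 1)) =
      ∑ k ∈ range s, dist (t (r + 1 + k)) (t (r + 1 + k + 1)) := sum_congr rfl fun k _ => by
    rw [add_right_comm (r + 1), insertVertex_add_one (by omega), insertVertex_add_one (by omega)]
  rw [show r + s + 1 + 1 = r + 1 + 1 + s by ring, show r + s + 1 = r + 1 + s by ring,
    sum_range_add _ (r + 1 + 1) s, sum_range_add _ (r + 1) s, sum_range_succ _ (r + 1),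
    sum_range_succ _ r, sum_range_succ _ r, hlow, hhigh, insertVertex_of_le le_rfl,
    insertVertex_self, insertVertex_add_one r.lt_succ_self, add_assoc (∑ k ∈ range r, _),
    dist_add_dist_of_mem_segment hp]

/-- The closed polygon `t'` runs through all vertices of `t`, along the edges of `t`. -/
structure IsRefinement {E : Type*} [SeminormedAddCommGroup E] [NormedSpace ℝ E] (t' : ℕ → E)
    (m' : ℕ) (t : ℕ → E) (m : ℕ) : Prop where
  exists_vertex : ∀ ⦃k⦄, k < m → ∃ k' < m', t' k' = t k
  sum_dist_eq :
    ∑ k ∈ range m', dist (t' k) (t' (k + 1)) = ∑ k ∈ range m, dist (t k) (t (k + 1))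
  exists_mem_edge : ∀ ⦃a⦄, a < m → ∀ ⦃x⦄, x ∈ segment ℝ (t a) (t (a + 1)) →
    ∃ b < m', x ∈ segment ℝ (t' b) (t' (b + 1))
  edge_subset : ∀ ⦃a⦄, a < m' → ∃ b < m,
    segment ℝ (t' a) (t' (a + 1)) ⊆ segment ℝ (t b) (t (b + 1))

section Normed

variable {E : Type*} [SeminormedAddCommGroup E] [NormedSpace ℝ E] {t t' t'' : ℕ → E}
  {m m' m'' r : ℕ} {p : E}

namespace IsRefinement

lemma refl (t : ℕ → E) (m : ℕ) : IsRefinement t m t m where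
  exists_vertex k hk := ⟨k, hk, rfl⟩
  sum_dist_eq := rfl
  exists_mem_edge a ha _ hx := ⟨a, ha, hx⟩
  edge_subset a ha := ⟨a, ha, subset_rfl⟩

lemma trans (h : IsRefinement t'' m'' t' m') (h' : IsRefinement t' m' t m) :
    IsRefinement t'' m'' t m where
  exists_vertex k hk := by
    obtain ⟨k', hk', heq'⟩ := h'.exists_vertex hk
    obtain ⟨k'', hk'', heq''⟩ := h.exists_vertex hk'
    exact ⟨k'', hk'', heq''.trans heq'⟩
  sum_dist_eq := h.sum_dist_eq.trans h'.sum_dist_eq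
  exists_mem_edge a ha x hx := by
    obtain ⟨b, hb, hxb⟩ := h'.exists_mem_edge ha hx
    exact h.exists_mem_edge hb hxb
  edge_subset a ha := by
    obtain ⟨b, hb, hab⟩ := h.edge_subset ha
    obtain ⟨c, hc, hbc⟩ := h'.edge_subset hb
    exact ⟨c, hc, hab.trans hbc⟩

lemma insertVertex (hr : r < m) (hp : p ∈ segment ℝ (t r) (t (r + 1))) :
    IsRefinement (insertVertex t r p) (m + 1) t m where
  exists_vertex k hk := by
    rcases le_or_gt k r with hkr | hrk
    · exact ⟨k, by omega, insertVertex_of_le hkr⟩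
    · exact ⟨k + 1, by omega, insertVertex_add_one hrk⟩
  sum_dist_eq := sum_dist_insertVertex hr hp
  exists_mem_edge _ ha _ hx := exists_mem_edge_insertVertex hp ha hx
  edge_subset a ha := ⟨_, edgeBeforeInsert_lt hr ha, edge_insertVertex_subset hp a⟩

end IsRefinement

lemma SimplePolygon.exists_isRefinement (h : SimplePolygon t m) (Q : Finset E)
    (hQ : ∀ p ∈ Q, ∃ a < m, p ∈ segment ℝ (t a) (t (a + 1))) :
    ∃ (t' : ℕ → E) (m' : ℕ), SimplePolygon t' m' ∧ IsRefinement t' m' t m ∧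
      m' ≤ m + #Q ∧ ∀ p ∈ Q, ∃ k < m', t' k = p := by
  classical
  induction Q using Finset.induction_on with
  | empty => exact ⟨t, m, h, .refl t m, by simp, by simp⟩
  | insert p Q hpQ ih =>
    obtain ⟨t', m', ht', hrefines, hcard, hvertex⟩ := ih fun q hq => hQ q (mem_insert_of_mem hq)
    rw [card_insert_of_notMem hpQ]
    by_cases hex : ∃ k < m', t' k = p
    · exact ⟨t', m', ht', hrefines, by omega, forall_mem_insert _ _ _ |>.2 ⟨hex, hvertex⟩⟩
    · push Not at hex
      obtain ⟨a, ha, hpa⟩ := hQ p (mem_insert_self _ _)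
      obtain ⟨r, hr, hpr⟩ := hrefines.exists_mem_edge ha hpa
      have hinsert := IsRefinement.insertVertex hr hpr
      refine ⟨_, m' + 1, ht'.insertVertex hr hpr hex, hinsert.trans hrefines, by omega,
        forall_mem_insert _ _ _ |>.2
          ⟨⟨r + 1, by omega, insertVertex_self⟩, fun q hq => ?_⟩⟩
      obtain ⟨k, hk, rfl⟩ := hvertex q hq
      exact hinsert.exists_vertex hk

end Normed

end Refinement

section Subdivision

open Finset

lemma dist_add_dist_le_of_wbtw {a b x y r : Plane}
    (hopt : dist a b + dist x y ≤ dist a x + dist b y) (hr : Wbtw ℝ a r b) :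
    dist a r + dist x y ≤ dist a x + dist r y ∧ dist r b + dist x y ≤ dist r x + dist b y := by
  have hrb := dist_add_dist_eq_iff.2 hr
  have hbry := dist_triangle b r y
  have harx := dist_triangle a r x
  rw [dist_comm b r] at hbry
  constructor <;> linarith

/-- The family of chords `E` with its chord `e` subdivided at the vertex `r`. -/
def splitChord (E : Finset (ℕ × ℕ)) (e : ℕ × ℕ) (r : ℕ) : Finset (ℕ × ℕ) :=
  insert (e.1, r) (insert (r, e.2) (E.erase e))

namespace IsTwoOptFamily

variable {t : ℕ → Plane} {m r : ℕ} {E F : Finset (ℕ × ℕ)} {e : ℕ × ℕ}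

lemma card_le (hE : IsTwoOptFamily t m E) : #E ≤ m ^ 2 := by
  have hsub : E ⊆ range m ×ˢ range m := fun e he =>
    mem_product.2 ⟨mem_range.2 (hE.fst_lt e he), mem_range.2 (hE.snd_lt e he)⟩
  simpa [sq] using card_le_card hsub

lemma insert_chord (hE : IsTwoOptFamily t m E) (h₁ : e.1 < m) (h₂ : e.2 < m) (hne : e.1 ≠ e.2)
    (hopt : ∀ f ∈ E, dist (t e.1) (t e.2) + dist (t f.1) (t f.2) ≤
      dist (t e.1) (t f.1) + dist (t e.2) (t f.2)) : IsTwoOptFamily t m (insert e E) where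
  fst_lt := forall_mem_insert _ _ _ |>.2 ⟨h₁, hE.fst_lt⟩
  snd_lt := forall_mem_insert _ _ _ |>.2 ⟨h₂, hE.snd_lt⟩
  fst_ne_snd := forall_mem_insert _ _ _ |>.2 ⟨hne, hE.fst_ne_snd⟩
  not_improving := by
    intro f hf g hg hfg
    rcases mem_insert.1 hf with rfl | hfE <;> rcases mem_insert.1 hg with rfl | hgE
    · exact absurd rfl hfg
    · exact hopt g hgE
    · rw [add_comm, dist_comm (t f.1) (t g.1), dist_comm (t f.2) (t g.2)]
      exact hopt f hfE
    · exact hE.not_improving f hfE g hgE hfg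

lemma split (hE : IsTwoOptFamily t m E) (he : e ∈ E) (hr : r < m)
    (hre : Sbtw ℝ (t e.1) (t r) (t e.2)) : IsTwoOptFamily t m (splitChord E e r) := by
  have hopt {f} (hf : f ∈ E.erase e) := dist_add_dist_le_of_wbtw (hE.not_improving e he f
    (mem_of_mem_erase hf) (ne_of_mem_erase hf).symm) hre.wbtw
  exact ((hE.mono (erase_subset e E)).insert_chord (e := (r, e.2)) hr (hE.snd_lt e he)
    (ne_of_apply_ne t hre.ne_right) fun f hf => (hopt hf).2).insert_chord (e := (e.1, r))
    (hE.fst_lt e he) hr (ne_of_apply_ne t hre.left_ne)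
    (forall_mem_insert _ _ _ |>.2 ⟨le_rfl, fun f hf => (hopt hf).1⟩)

lemma notMem_of_sbtw (hE : IsTwoOptFamily t m E) (he : e ∈ E)
    (hre : Sbtw ℝ (t e.1) (t r) (t e.2)) : (r, e.2) ∉ E ∧ (e.1, r) ∉ E := by
  have hsum := dist_add_dist_eq_iff.2 hre.wbtw
  constructor <;> intro hmem
  · have hopt := hE.not_improving e he _ hmem fun heq => hre.left_ne (congrArg (t ·.1) heq)
    have hpos := dist_pos.2 hre.ne_right
    simp only [dist_self] at hopt
    linarith
  · have hopt := hE.not_improving e he _ hmem fun heq => hre.ne_right (congrArg (t ·.2) heq).symm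
    have hpos := dist_pos.2 hre.left_ne
    simp only [dist_self, dist_comm (t e.2)] at hopt
    linarith

lemma notMem_insert_of_sbtw (hE : IsTwoOptFamily t m E) (he : e ∈ E)
    (hre : Sbtw ℝ (t e.1) (t r) (t e.2)) : (e.1, r) ∉ insert (r, e.2) (E.erase e) := by
  rw [mem_insert, not_or]
  exact ⟨fun heq => hre.left_ne (congrArg (t ·.1) heq),
    mt mem_of_mem_erase (hE.notMem_of_sbtw he hre).2⟩

lemma card_splitChord (hE : IsTwoOptFamily t m E) (he : e ∈ E)
    (hre : Sbtw ℝ (t e.1) (t r) (t e.2)) : #(splitChord E e r) = #E + 1 := by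
  rw [splitChord, card_insert_of_notMem (hE.notMem_insert_of_sbtw he hre),
    card_insert_of_notMem (mt mem_of_mem_erase (hE.notMem_of_sbtw he hre).1),
    card_erase_add_one he]

lemma sum_dist_splitChord (hE : IsTwoOptFamily t m E) (he : e ∈ E)
    (hre : Sbtw ℝ (t e.1) (t r) (t e.2)) :
    ∑ f ∈ splitChord E e r, dist (t f.1) (t f.2) = ∑ f ∈ E, dist (t f.1) (t f.2) := by
  rw [splitChord, sum_insert (hE.notMem_insert_of_sbtw he hre),
    sum_insert (mt mem_of_mem_erase (hE.notMem_of_sbtw he hre).1), ← add_assoc,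
    dist_add_dist_eq_iff.2 hre.wbtw, add_sum_erase _ (fun f => dist (t f.1) (t f.2)) he]

lemma exists_segment_subset_of_mem_splitChord (he : e ∈ E)
    (hre : Sbtw ℝ (t e.1) (t r) (t e.2)) {f : ℕ × ℕ} (hf : f ∈ splitChord E e r) :
    ∃ g ∈ E, segment ℝ (t f.1) (t f.2) ⊆ segment ℝ (t g.1) (t g.2) := by
  have hr := mem_segment_iff_wbtw.2 hre.wbtw
  have hconvex := convex_segment (𝕜 := ℝ) (t e.1) (t e.2)
  unfold splitChord at hf
  rw [mem_insert, mem_insert] at hf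
  rcases hf with rfl | rfl | hf
  · exact ⟨e, he, hconvex.segment_subset (left_mem_segment _ _ _) hr⟩
  · exact ⟨e, he, hconvex.segment_subset hr (right_mem_segment _ _ _)⟩
  · exact ⟨f, mem_of_mem_erase hf, subset_rfl⟩

lemma exists_subdivision (hE : IsTwoOptFamily t m E) : ∃ F, IsTwoOptFamily t m F ∧
    (∀ f ∈ F, ∃ e ∈ E, segment ℝ (t f.1) (t f.2) ⊆ segment ℝ (t e.1) (t e.2)) ∧
    (∀ f ∈ F, ∀ r < m, ¬Sbtw ℝ (t f.1) (t r) (t f.2)) ∧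
    ∑ f ∈ F, dist (t f.1) (t f.2) = ∑ e ∈ E, dist (t e.1) (t e.2) := by
  induction hd : m ^ 2 - #E generalizing E with
  | zero =>
    refine ⟨E, hE, fun e he => ⟨e, he, subset_rfl⟩, fun e he r hr hre => ?_, rfl⟩
    have := (hE.split he hr hre).card_le
    rw [hE.card_splitChord he hre] at this
    omega
  | succ d ih =>
    by_cases hsbtw : ∃ e ∈ E, ∃ r < m, Sbtw ℝ (t e.1) (t r) (t e.2)
    · obtain ⟨e, he, r, hr, hre⟩ := hsbtw
      obtain ⟨F, hF, hsub, hnot, hsum⟩ := ih (hE.split he hr hre)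
        (by rw [hE.card_splitChord he hre]; omega)
      refine ⟨F, hF, fun f hf => ?_, hnot, hsum.trans (hE.sum_dist_splitChord he hre)⟩
      obtain ⟨g, hg, hfg⟩ := hsub f hf
      obtain ⟨e', he', hge⟩ := exists_segment_subset_of_mem_splitChord he hre hg
      exact ⟨e', he', hfg.trans hge⟩
    · push Not at hsbtw
      exact ⟨E, hE, fun e he => ⟨e, he, subset_rfl⟩, hsbtw, rfl⟩

end IsTwoOptFamily

end Subdivision

section LengthBound

open Finset Real

lemma exists_finset_hitting {ι α : Type*} (I : Finset ι) (S : ι → Set α) :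
    ∃ Q : Finset α, #Q ≤ #I ∧ (∀ q ∈ Q, ∃ i ∈ I, q ∈ S i) ∧
      ∀ i ∈ I, (S i).Nonempty → ∃ q ∈ Q, q ∈ S i := by
  classical
  choose x hx using fun (i : {i // (S i).Nonempty}) => i.2
  refine ⟨((I.subtype fun i => (S i).Nonempty).image x), ?_, ?_, ?_⟩
  · refine card_image_le.trans ?_
    rw [card_subtype]
    exact card_filter_le _ _
  · rintro q hq
    obtain ⟨i, hi, rfl⟩ := mem_image.1 hq
    exact ⟨i, mem_subtype.1 hi, hx i⟩
  · exact fun i hi hne => ⟨x ⟨i, hne⟩, mem_image_of_mem _ (mem_subtype.2 hi), hx ⟨i, hne⟩⟩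

section Edge

variable {E : Type*} [SeminormedAddCommGroup E] [NormedSpace ℝ E] {t t' : ℕ → E} {m m' i j : ℕ}

lemma collinear_of_mem_segment {x y u v w : E} (hu : u ∈ segment ℝ x y) (hv : v ∈ segment ℝ x y)
    (hw : w ∈ segment ℝ x y) : Collinear ℝ {u, v, w} :=
  collinear_triple_of_mem_affineSpan_pair (mem_segment_iff_wbtw.1 hu).mem_affineSpan
    (mem_segment_iff_wbtw.1 hv).mem_affineSpan (mem_segment_iff_wbtw.1 hw).mem_affineSpan

lemma mem_segment_of_sbtw {x y p q u w z s : E} (hu : u ∈ segment ℝ p q) (hw : w ∈ segment ℝ p q)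
    (hz : z ∈ segment ℝ p q ∩ segment ℝ x y) (hs : Sbtw ℝ u s w) (hs' : s ∈ segment ℝ x y)
    (hz' : ¬Sbtw ℝ u z w) (hx : ¬Sbtw ℝ u x w) (hy : ¬Sbtw ℝ u y w) :
    u ∈ segment ℝ x y ∧ w ∈ segment ℝ x y := by
  have hcol := collinear_of_mem_segment hz.1 hu hw
  have hcover {e : E} (he : e ∈ segment ℝ x y) (he' : ¬Sbtw ℝ u e w) (hwbtw : Wbtw ℝ z s e) :
      u ∈ segment ℝ x y ∧ w ∈ segment ℝ x y :=
    (wbtw_and_wbtw_of_sbtw hcol hs hwbtw hz' he').imp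
      (fun h => (convex_segment x y).segment_subset hz.2 he (mem_segment_iff_wbtw.2 h))
      (fun h => (convex_segment x y).segment_subset hz.2 he (mem_segment_iff_wbtw.2 h))
  have hzxy := collinear_of_mem_segment hz.2 (left_mem_segment ℝ x y) (right_mem_segment ℝ x y)
  exact (wbtw_or_wbtw_of_collinear hzxy (mem_segment_iff_wbtw.1 hs')).elim
    (hcover (left_mem_segment ℝ x y) hx) (hcover (right_mem_segment ℝ x y) hy)

lemma SimplePolygon.exists_lt_apply_eq (h : SimplePolygon t m) {a : ℕ} (ha : a < m) :
    ∃ k < m, t k = t (a + 1) := by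
  rcases (Nat.succ_le_of_lt ha).lt_or_eq with hlt | heq
  · exact ⟨a + 1, hlt, rfl⟩
  · exact ⟨0, by omega, by rw [← h.closed, ← heq]⟩

lemma avoidsPolygon_or_isAdjacentPair (ht : SimplePolygon t m) (ht' : SimplePolygon t' m')
    (href : IsRefinement t' m' t m) (hi : i < m') (hj : j < m') (hij : i ≠ j)
    (hnot : ∀ k < m', ¬Sbtw ℝ (t' i) (t' k) (t' j)) {x y : E}
    (hsub : segment ℝ (t' i) (t' j) ⊆ segment ℝ x y)
    (hcross : ∀ a < m, (segment ℝ x y ∩ segment ℝ (t a) (t (a + 1))).Nonempty →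
      ∃ k < m', t' k ∈ segment ℝ x y ∩ segment ℝ (t a) (t (a + 1))) :
    AvoidsPolygon t' m' i j ∨ IsAdjacentPair m' i j := by
  by_contra! ⟨hav, hadj⟩
  unfold AvoidsPolygon at hav
  push Not at hav
  obtain ⟨b, hb, p, hp, hpb, hpi, hpj⟩ := hav
  obtain ⟨a, ha, hba⟩ := href.edge_subset hb
  have hsbtw : Sbtw ℝ (t' i) p (t' j) := ⟨mem_segment_iff_wbtw.1 hp, hpi, hpj⟩
  have hvertex {k : ℕ} (hk : k < m) : ¬Sbtw ℝ (t' i) (t k) (t' j) := by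
    obtain ⟨k', hk', heq⟩ := href.exists_vertex hk
    exact heq ▸ hnot k' hk'
  obtain ⟨l, hl, hla⟩ := ht.exists_lt_apply_eq ha
  obtain ⟨l', hl', hlb⟩ := ht'.exists_lt_apply_eq hb
  obtain ⟨k, hk, hcommon⟩ := hcross a ha ⟨p, hsub hp, hba hpb⟩
  obtain ⟨hia, hja⟩ := mem_segment_of_sbtw (hsub (left_mem_segment ..))
    (hsub (right_mem_segment ..)) hcommon hsbtw (hba hpb) (hnot k hk) (hvertex ha)
    (hla ▸ hvertex hl)
  have hleft := left_mem_segment ℝ (t' b) (t' (b + 1))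
  obtain ⟨hib, hjb⟩ := mem_segment_of_sbtw hia hja ⟨hba hleft, hleft⟩ hsbtw hpb (hnot b hb)
    (hnot b hb) (hlb ▸ hnot l' hl')
  have hiedge := ht'.vertex_mem_edge hi hb hib
  have hjedge := ht'.vertex_mem_edge hj hb hjb
  unfold IsAdjacentPair at hadj
  omega

end Edge

lemma IsTour.apply_ne {V : Finset Plane} {σ : Equiv.Perm V} (h : IsTour σ) (v : V) : σ v ≠ v := by
  have hV : Nontrivial V := by
    rw [← Fintype.one_lt_card_iff_nontrivial, Fintype.card_coe]
    exact Nat.lt_of_succ_lt h.1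
  exact h.2.apply_ne Set.nontrivial_univ (Set.mem_univ v)

variable {V : Finset Plane} {σ : Equiv.Perm V} {t : ℕ → Plane} {m : ℕ}

lemma IsTwoOptimal.exists_isTwoOptFamily (hσ : IsTwoOptimal σ)
    (hV : ∀ v ∈ V, ∃ k < m, t k = v) : ∃ E, IsTwoOptFamily t m E ∧
      (∀ e ∈ E, ∃ v : V, t e.1 = v ∧ t e.2 = σ v) ∧
      ∑ e ∈ E, dist (t e.1) (t e.2) = length σ := by
  classical
  choose idx hlt hidx using fun v : V => hV v v.2
  have hinj : Function.Injective fun v : V => (idx v, idx (σ v)) := fun v w hvw =>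
    Subtype.ext <| by rw [← hidx v, ← hidx w, (Prod.mk.inj hvw).1]
  refine ⟨univ.map ⟨_, hinj⟩, ⟨?_, ?_, ?_, ?_⟩, ?_, ?_⟩
  · exact forall_mem_map.2 fun v _ => hlt v
  · exact forall_mem_map.2 fun v _ => hlt (σ v)
  · refine forall_mem_map.2 fun v _ heq => hσ.1.apply_ne v (Subtype.ext ?_)
    rw [← hidx v, ← hidx (σ v)]
    exact congrArg t heq.symm
  · refine forall_mem_map.2 fun v _ => forall_mem_map.2 fun w _ hvw => ?_
    simp only [Function.Embedding.coeFn_mk, hidx]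
    exact hσ.2 v w (ne_of_apply_ne _ hvw)
  · exact forall_mem_map.2 fun v _ => ⟨v, hidx v, hidx (σ v)⟩
  · simp only [sum_map, Function.Embedding.coeFn_mk, hidx]
    rfl

lemma SimplePolygon.exists_crossing_refinement (h : SimplePolygon t m) (σ : Equiv.Perm V)
    (hm : m ≤ #V + 1) : ∃ (t' : ℕ → Plane) (m' : ℕ), SimplePolygon t' m' ∧ IsRefinement t' m' t m ∧
      m' ≤ (#V + 1) ^ 2 ∧
      ∀ v : V, ∀ a < m, (segment ℝ (v : Plane) (σ v) ∩ segment ℝ (t a) (t (a + 1))).Nonempty →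
        ∃ k < m', t' k ∈ segment ℝ (v : Plane) (σ v) ∩ segment ℝ (t a) (t (a + 1)) := by
  obtain ⟨Q, hQcard, hQmem, hQ⟩ := exists_finset_hitting ((univ : Finset V) ×ˢ range m)
    fun i => segment ℝ (i.1 : Plane) (σ i.1) ∩ segment ℝ (t i.2) (t (i.2 + 1))
  obtain ⟨t', m', ht', href, hm', hvertex⟩ := h.exists_isRefinement Q fun q hq => by
    obtain ⟨i, hi, hqi⟩ := hQmem q hq
    exact ⟨i.2, mem_range.1 (mem_product.1 hi).2, hqi.2⟩
  refine ⟨t', m', ht', href, ?_, fun v a ha hne => ?_⟩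
  · rw [card_product, card_univ, Fintype.card_coe, card_range] at hQcard
    nlinarith
  · obtain ⟨q, hq, hmem⟩ := hQ (v, a) (by simpa using ha) hne
    obtain ⟨k, hk, rfl⟩ := hvertex q hq
    exact ⟨k, hk, hmem⟩

lemma IsTwoOptimal.length_le_of_simplePolygon (hσ : IsTwoOptimal σ) (ht : SimplePolygon t m)
    (hV : ∀ v ∈ V, ∃ k < m, t k = v) (hm : m ≤ #V + 1) {K : ℝ} (hK : 1 < K) :
    length σ ≤ 4 * ((∑ r ∈ range m, dist (t r) (t (r + 1))) *
      (K / 2 + (1 + 2 * log (((#V : ℝ) + 1) ^ 4 + 1)) / log K)) := by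
  obtain ⟨t', m', ht', href, hm', hcross⟩ := ht.exists_crossing_refinement σ hm
  obtain ⟨E, hE, hEσ, hEsum⟩ := hσ.exists_isTwoOptFamily (t := t') (m := m') fun v hv => by
    obtain ⟨k, hk, rfl⟩ := hV v hv
    exact href.exists_vertex hk
  obtain ⟨F, hF, hFE, hnot, hFsum⟩ := hE.exists_subdivision
  have hchord : IsTwoOptChordFamily t' m' F := ⟨hF, fun f hf => by
    obtain ⟨e, he, hfe⟩ := hFE f hf
    obtain ⟨v, hv, hv'⟩ := hEσ e he
    rw [hv, hv'] at hfe
    exact avoidsPolygon_or_isAdjacentPair ht ht' href (hF.fst_lt f hf) (hF.snd_lt f hf)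
      (hF.fst_ne_snd f hf) (hnot f hf) hfe (hcross v)⟩
  have hcard : (#F : ℝ) ≤ ((#V : ℝ) + 1) ^ 4 := by
    have hcard_nat : #F ≤ (#V + 1) ^ 4 := calc
      #F ≤ m' ^ 2 := hF.card_le
      _ ≤ ((#V + 1) ^ 2) ^ 2 := Nat.pow_le_pow_left hm' 2
      _ = (#V + 1) ^ 4 := by ring
    exact_mod_cast hcard_nat
  have hlogK := log_pos hK
  calc length σ = ∑ f ∈ F, dist (t' f.1) (t' f.2) := (hFsum.trans hEsum).symm
    _ ≤ 4 * ((∑ r ∈ range m', dist (t' r) (t' (r + 1))) *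
        (K / 2 + (1 + 2 * log (#F + 1)) / log K)) := hchord.sum_dist_le ht' hK
    _ ≤ _ := by
      rw [href.sum_dist_eq]
      gcongr

end LengthBound

section TwoOptNoncrossing

variable {V : Finset Plane} {σ : Equiv.Perm V} {v w : V}

lemma exists_sbtw_and_sbtw {E : Type*} [AddCommGroup E] [Module ℝ E] {a b c d : E}
    (hc : Wbtw ℝ a b c) (hd : Wbtw ℝ a b d) (hba : b ≠ a) (hbc : b ≠ c) (hbd : b ≠ d) :
    ∃ p, Sbtw ℝ b p c ∧ Sbtw ℝ b p d := by
  wlog hcd : Wbtw ℝ b c d generalizing c d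
  · have hdc := (wbtw_or_wbtw_of_wbtw_of_wbtw hc hd hba).resolve_left hcd
    exact (this hd hc hbd hbc hdc).imp fun _ => And.symm
  · have hmid := sbtw_midpoint_of_ne ℝ hbc
    exact ⟨_, hmid, hcd.trans_sbtw_left hmid⟩

/-- The edges of the tour `σ` leaving `v` and `w` share a point interior to both. -/
def EdgesOverlap (σ : Equiv.Perm V) (v w : V) : Prop :=
  ∃ p : Plane, Sbtw ℝ (v : Plane) p (σ v) ∧ Sbtw ℝ (w : Plane) p (σ w)

lemma EdgesOverlap.symm (h : EdgesOverlap σ v w) : EdgesOverlap σ w v :=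
  h.imp fun _ => And.symm

lemma IsTour.exists_pow_apply_eq (h : IsTour σ) (v w : V) : ∃ k : ℕ, (σ ^ k) v = w :=
  (h.2.2 (Set.mem_univ v) (Set.mem_univ w)).exists_nat_pow_eq

namespace IsTwoOptimal

lemma wbtw_of_wbtw (hσ : IsTwoOptimal σ) (hvw : v ≠ w) {p : Plane}
    (hv : Wbtw ℝ (v : Plane) p (σ v)) (hw : Wbtw ℝ (w : Plane) p (σ w)) :
    Wbtw ℝ (v : Plane) p w ∧ Wbtw ℝ (σ v : Plane) p (σ w) :=
  wbtw_of_dist_add_dist_le (hσ.2 v w hvw) hv hw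

lemma coe_ne_coe_apply (hσ : IsTwoOptimal σ) (v : V) : (v : Plane) ≠ σ v :=
  fun h => hσ.1.apply_ne v (Subtype.ext h.symm)

lemma edgesOverlap_of_sbtw (hσ : IsTwoOptimal σ) (h : Sbtw ℝ (w : Plane) v (σ w)) :
    EdgesOverlap σ v w := by
  have hvw : v ≠ w := fun hvw => h.ne_left (congrArg Subtype.val hvw)
  have hforward := (hσ.wbtw_of_wbtw hvw (wbtw_self_left ℝ _ _) h.wbtw).2.symm
  obtain ⟨p, hpv, hpw⟩ := exists_sbtw_and_sbtw hforward h.wbtw.symm h.ne_right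
    (hσ.coe_ne_coe_apply v) h.ne_left
  exact ⟨p, hpv, (h.wbtw.symm.trans_sbtw_right hpw).symm⟩

lemma edgesOverlap_of_sbtw_apply (hσ : IsTwoOptimal σ) (h : Sbtw ℝ (w : Plane) (σ v) (σ w)) :
    EdgesOverlap σ v w := by
  have hvw : v ≠ w := fun hvw => h.ne_right (congrArg (fun u => (σ u : Plane)) hvw)
  have hbackward := (hσ.wbtw_of_wbtw hvw (wbtw_self_right ℝ _ _) h.wbtw).1.symm
  obtain ⟨p, hpv, hpw⟩ := exists_sbtw_and_sbtw hbackward h.wbtw h.ne_left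
    (hσ.coe_ne_coe_apply v).symm h.ne_right
  exact ⟨p, hpv.symm, h.wbtw.trans_sbtw_right hpw⟩

-- Among the edges overlapping the edge of `v`, the one starting farthest from `v` points away from
-- it: otherwise its predecessor would overlap as well and start even farther away.
lemma exists_edgesOverlap_apply (hσ : IsTwoOptimal σ) (h : ∃ w ≠ v, EdgesOverlap σ v w) :
    (∃ w ≠ σ v, EdgesOverlap σ (σ v) w) ∧
      (σ (σ v) : Plane) ∈ line[ℝ, (v : Plane), (σ v : Plane)] := by
  classical
  obtain ⟨w, ⟨hwv, p, hpv, hpw⟩, hmax⟩ :=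
    Set.exists_max_image {w | w ≠ v ∧ EdgesOverlap σ v w} (fun w => dist (v : Plane) w)
      (Set.toFinite _) h
  obtain ⟨hvpw, hσvpw⟩ := hσ.wbtw_of_wbtw hwv.symm hpv.wbtw hpw.wbtw
  have hline : (σ w : Plane) ∈ line[ℝ, (v : Plane), (σ v : Plane)] :=
    affineSpan_pair_le_of_mem_of_mem (right_mem_affineSpan_pair ℝ _ _)
      hpv.wbtw.mem_affineSpan (hσvpw.right_mem_affineSpan_of_left_ne hpv.ne_right.symm)
  by_cases hvw : σ v = w
  · subst hvw
    exact ⟨⟨v, hwv.symm, p, hpw, hpv⟩, hline⟩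
  have hvw' : (σ v : Plane) ≠ w := fun h => hvw (Subtype.ext h)
  rcases wbtw_or_wbtw_of_wbtw_of_wbtw hvpw hpv.wbtw hpv.ne_left with hw | hv
  · have hwmem : Sbtw ℝ (v : Plane) w (σ v) :=
      ⟨hpv.wbtw.trans_right hw, fun h => hwv (Subtype.ext h), hvw'.symm⟩
    obtain ⟨u, rfl⟩ := σ.surjective w
    have huv : u ≠ v := fun h => hvw (congrArg σ h.symm)
    have hfar := (hσ.wbtw_of_wbtw huv (wbtw_self_right ℝ _ _) hwmem.wbtw).1.symm.dist_add_dist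
    have hnear := hmax u ⟨huv, (hσ.edgesOverlap_of_sbtw_apply hwmem).symm⟩
    have hpos := dist_pos.2 (hσ.coe_ne_coe_apply u).symm
    linarith
  · have hvmem : Sbtw ℝ (w : Plane) (σ v) (σ w) :=
      ⟨hpw.wbtw.trans_left hv.symm, hvw', fun h => hwv (σ.injective (Subtype.ext h)).symm⟩
    have hbeyond := (hσ.wbtw_of_wbtw hvw (wbtw_self_left ℝ _ _) hvmem.wbtw).2.symm
    exact ⟨⟨w, fun h => hvw h.symm, hσ.edgesOverlap_of_sbtw hvmem⟩,
      affineSpan_pair_le_of_mem_of_mem hline (right_mem_affineSpan_pair ℝ _ _)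
        (hbeyond.right_mem_affineSpan_of_left_ne hvmem.ne_right.symm)⟩

lemma not_edgesOverlap (hσ : IsTwoOptimal σ) (hV : ¬ Collinear ℝ (V : Set Plane)) (hvw : v ≠ w) :
    ¬ EdgesOverlap σ v w := by
  intro h
  set ℓ := line[ℝ, (v : Plane), (σ v : Plane)]
  have hall (k : ℕ) : (∃ w ≠ (σ ^ k) v, EdgesOverlap σ ((σ ^ k) v) w) ∧
      (((σ ^ k) v : V) : Plane) ∈ ℓ ∧ ((σ ((σ ^ k) v) : V) : Plane) ∈ ℓ := by
    induction k with
    | zero => exact ⟨⟨w, hvw.symm, h⟩, left_mem_affineSpan_pair .., right_mem_affineSpan_pair ..⟩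
    | succ k ih =>
      obtain ⟨hoverlap, hk, hk'⟩ := ih
      obtain ⟨hoverlap', hline⟩ := hσ.exists_edgesOverlap_apply hoverlap
      rw [pow_succ', Equiv.Perm.mul_apply]
      exact ⟨hoverlap', hk', affineSpan_pair_le_of_mem_of_mem hk hk' hline⟩
  refine hV ((collinear_iff_exists_forall_eq_smul_vadd _).2
    ⟨v, (σ v : Plane) -ᵥ (v : Plane), fun x hx => ?_⟩)
  obtain ⟨k, hk⟩ := hσ.1.exists_pow_apply_eq v ⟨x, hx⟩
  obtain ⟨r, hr⟩ := mem_affineSpan_pair_iff_exists_lineMap_eq.1 (hall k).2.1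
  exact ⟨r, by rw [← AffineMap.lineMap_apply, hr, hk]⟩

lemma edges_inter (hσ : IsTwoOptimal σ) (hV : ¬ Collinear ℝ (V : Set Plane)) (hvw : v ≠ w)
    {p : Plane} (hpv : Wbtw ℝ (v : Plane) p (σ v)) (hpw : Wbtw ℝ (w : Plane) p (σ w)) :
    (σ v = w ∧ p = w) ∨ (σ w = v ∧ p = v) := by
  have hvertex (u u' : V) : ¬ Sbtw ℝ (u' : Plane) u (σ u') := fun h => by
    have huu' : u ≠ u' := fun hu => h.ne_left (congrArg Subtype.val hu)
    exact hσ.not_edgesOverlap hV huu' (hσ.edgesOverlap_of_sbtw h)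
  have hends {u u' : V} (h : Wbtw ℝ (u' : Plane) u (σ u')) : u = u' ∨ u = σ u' := by
    by_contra! hne
    exact hvertex u u' ⟨h, fun h => hne.1 (Subtype.ext h), fun h => hne.2 (Subtype.ext h)⟩
  by_cases hv : p = v
  · subst hv
    exact Or.inr ⟨((hends hpw).resolve_left hvw).symm, rfl⟩
  by_cases hw : p = w
  · subst hw
    exact Or.inl ⟨((hends hpv).resolve_left hvw.symm).symm, rfl⟩
  by_cases hσv : p = σ v
  · subst hσv
    exact ((hends hpw).elim (fun h => hw (congrArg _ h)) fun h => hvw (σ.injective h)).elim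
  by_cases hσw : p = σ w
  · subst hσw
    exact ((hends hpv).elim (fun h => hv (congrArg _ h)) fun h => hvw (σ.injective h).symm).elim
  exact absurd ⟨p, ⟨hpv, hv, hσv⟩, ⟨hpw, hw, hσw⟩⟩ (hσ.not_edgesOverlap hV hvw)

end IsTwoOptimal

end TwoOptNoncrossing

section PathLength

open Finset

variable {X : Type*} [PseudoMetricSpace X]

/-- The length of the polygonal path through the points of a list. -/
noncomputable def pathLength : List X → ℝ
  | [] => 0
  | [_] => 0
  | a :: b :: l => dist a b + pathLength (b :: l)

@[simp] lemma pathLength_singleton (a : X) : pathLength [a] = 0 := rfl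

@[simp] lemma pathLength_cons_cons (a b : X) (l : List X) :
    pathLength (a :: b :: l) = dist a b + pathLength (b :: l) := rfl

lemma pathLength_append (l₁ : List X) (q : X) (l₂ : List X) :
    pathLength (l₁ ++ q :: l₂) = pathLength (l₁ ++ [q]) + pathLength (q :: l₂) := by
  induction l₁ with
  | nil => simp
  | cons a l ih =>
    cases l with
    | nil => simp
    | cons b l =>
      simp only [List.cons_append, pathLength_cons_cons] at ih ⊢
      rw [ih, add_assoc]

lemma pathLength_cons_le (a b : X) (l : List X) :
    pathLength (a :: l) ≤ dist a b + pathLength (b :: l) := by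
  cases l with
  | nil => simp
  | cons c l =>
    simp only [pathLength_cons_cons]
    linarith [dist_triangle a b c]

lemma pathLength_le_of_sublist {l' l : List X} (h : l'.Sublist l) (a c : X) :
    pathLength (a :: l' ++ [c]) ≤ pathLength (a :: l ++ [c]) := by
  induction h generalizing a with
  | slnil => exact le_rfl
  | cons b _ ih => exact (ih a).trans (pathLength_cons_le a b _)
  | cons_cons b _ ih =>
    simp only [List.cons_append, pathLength_cons_cons] at ih ⊢
    exact add_le_add le_rfl (ih b)

lemma pathLength_eq_sum (l : List X) (x : X) :
    pathLength l = ∑ k ∈ range (l.length - 1), dist (l.getD k x) (l.getD (k + 1) x) := by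
  induction l with
  | nil => simp [pathLength]
  | cons a l ih =>
    cases l with
    | nil => simp
    | cons b l =>
      rw [pathLength_cons_cons, ih]
      simp only [List.length_cons, Nat.add_sub_cancel]
      rw [sum_range_succ', add_comm]
      rfl

lemma pathLength_map_range (t : ℕ → X) (m : ℕ) :
    pathLength ((List.range (m + 1)).map t) = ∑ k ∈ range m, dist (t k) (t (k + 1)) := by
  rw [pathLength_eq_sum _ (t 0), List.length_map, List.length_range, Nat.add_sub_cancel]
  refine sum_congr rfl fun k hk => ?_
  have hk := mem_range.1 hk
  simp [hk, hk.trans (Nat.lt_succ_self m)]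

lemma pathLength_detour (l₁ : List X) (q p : X) (l₂ : List X) :
    pathLength (l₁ ++ q :: p :: q :: l₂) = pathLength (l₁ ++ q :: l₂) + 2 * dist q p := by
  rw [pathLength_append, pathLength_append l₁ q l₂]
  simp only [pathLength_cons_cons]
  rw [dist_comm p q]
  ring

/-- There is a closed walk of length at most `B` from `a` visiting exactly the points of `V`. -/
def HasClosedWalk (V : Set X) (a : X) (B : ℝ) : Prop :=
  ∃ l : List X, (∀ x, x ∈ V ↔ x ∈ a :: l) ∧ pathLength (a :: l ++ [a]) ≤ B

variable {V : Set X} {a : X} {B : ℝ}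

lemma HasClosedWalk.mono (h : HasClosedWalk V a B) {B' : ℝ} (hB : B ≤ B') :
    HasClosedWalk V a B' :=
  h.imp fun _ hl => ⟨hl.1, hl.2.trans hB⟩

lemma HasClosedWalk.two_mul_dist_le (h : HasClosedWalk V a B) {p : X} (hp : p ∈ V) :
    2 * dist a p ≤ B := by
  obtain ⟨l, hl, hB⟩ := h
  have hle {l' : List X} (hl' : l'.Sublist l) := (pathLength_le_of_sublist hl' a a).trans hB
  rcases List.mem_cons.1 ((hl p).1 hp) with rfl | hpl
  · simpa using hle (List.nil_sublist l)
  · have := hle (List.singleton_sublist.2 hpl)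
    simp only [List.cons_append, List.nil_append, pathLength_cons_cons, pathLength_singleton,
      dist_comm p a] at this
    linarith

lemma HasClosedWalk.insert_of_mem (h : HasClosedWalk V a B) {q : X} (hq : q ∈ V) (p : X) :
    HasClosedWalk (insert p V) a (B + 2 * dist q p) := by
  obtain ⟨l, hl, hB⟩ := h
  rcases List.mem_cons.1 ((hl q).1 hq) with rfl | hql
  · refine ⟨p :: q :: l, fun x => ?_, ?_⟩
    · simp only [Set.mem_insert_iff, hl, List.mem_cons]
      tauto
    · have := pathLength_detour [] q p (l ++ [q])
      simp only [List.nil_append, List.cons_append] at this hB ⊢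
      linarith
  · obtain ⟨l₁, l₂, rfl⟩ := List.append_of_mem hql
    refine ⟨l₁ ++ q :: p :: q :: l₂, fun x => ?_, ?_⟩
    · simp only [Set.mem_insert_iff, hl, List.mem_cons, List.mem_append]
      tauto
    · have := pathLength_detour (a :: l₁) q p (l₂ ++ [a])
      simp only [List.cons_append, List.append_assoc] at this hB ⊢
      linarith

lemma HasClosedWalk.union_image (h : HasClosedWalk V a B) {κ : Type*} (s : Finset κ) (f : κ → X)
    {δ : ℝ} (hf : ∀ k ∈ s, ∃ q ∈ V, dist q (f k) ≤ δ) :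
    HasClosedWalk (V ∪ f '' s) a (B + 2 * δ * #s) := by
  classical
  induction s using Finset.induction_on with
  | empty => simpa using h
  | insert k s hk ih =>
    obtain ⟨q, hq, hd⟩ := hf k (mem_insert_self _ _)
    have hwalk := (ih fun j hj => hf j (mem_insert_of_mem hj)).insert_of_mem (Or.inl hq) (f k)
    rw [coe_insert, Set.image_insert_eq, Set.union_insert]
    refine hwalk.mono ?_
    rw [card_insert_of_notMem hk]
    push_cast
    linarith

end PathLength

section Tours

open Finset

variable {V : Finset Plane} {σ τ : Equiv.Perm V} {t : ℕ → Plane}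

/-- The sequence `t 0, …, t (#V - 1)`, closed up by `t #V = t 0`, runs once through `V`. -/
structure IsCyclicEnumeration (V : Finset Plane) (t : ℕ → Plane) : Prop where
  closed : t #V = t 0
  bijOn : Set.BijOn t (Set.Iio #V) V

/-- The permutation `σ` runs through `V` in the order of the sequence `t`. -/
def Follows (σ : Equiv.Perm V) (t : ℕ → Plane) : Prop :=
  ∀ k < #V, ∀ v : V, (v : Plane) = t k → (σ v : Plane) = t (k + 1)

lemma IsCyclicEnumeration.apply_mem (ht : IsCyclicEnumeration V t) {k : ℕ} (hV : 0 < #V)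
    (hk : k ≤ #V) : t k ∈ V := by
  rcases hk.lt_or_eq with hlt | rfl
  · exact ht.bijOn.mapsTo hlt
  · exact ht.closed ▸ ht.bijOn.mapsTo hV

lemma IsCyclicEnumeration.exists_follows (ht : IsCyclicEnumeration V t) :
    ∃ σ : Equiv.Perm V, Follows σ t := by
  choose index hindex hindex_eq using fun v : V => ht.bijOn.surjOn v.2
  simp only [Set.mem_Iio] at hindex
  have hindex_unique {k : ℕ} (hk : k < #V) {v : V} (hv : (v : Plane) = t k) : index v = k :=
    ht.bijOn.injOn (hindex v) hk ((hindex_eq v).trans hv)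
  let next (v : V) : V := ⟨t (index v + 1), ht.apply_mem (card_pos.2 ⟨v, v.2⟩) (hindex v)⟩
  have hnext : Function.Surjective next := fun w => by
    have hw := hindex w
    obtain ⟨k, hk, hkw⟩ : ∃ k < #V, t (k + 1) = w := by
      rcases Nat.eq_zero_or_pos (index w) with h0 | hpos
      · refine ⟨#V - 1, by omega, ?_⟩
        rw [Nat.sub_add_cancel (by omega), ht.closed, ← h0, hindex_eq]
      · exact ⟨index w - 1, by omega, by rw [Nat.sub_add_cancel hpos, hindex_eq]⟩
    refine ⟨⟨t k, ht.bijOn.mapsTo hk⟩, Subtype.ext ?_⟩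
    rw [← hkw]
    exact congrArg (fun i => t (i + 1)) (hindex_unique hk rfl)
  exact ⟨.ofBijective next (Finite.surjective_iff_bijective.1 hnext), fun k hk v hv =>
    congrArg (fun i => t (i + 1)) (hindex_unique hk hv)⟩

lemma Follows.isTour (hσ : Follows σ t) (ht : IsCyclicEnumeration V t) (hV : 3 ≤ #V) :
    IsTour σ := by
  have h0 : t 0 ∈ V := ht.apply_mem (by omega) (Nat.zero_le _)
  have hpow (k : ℕ) (hk : k < #V) : (((σ ^ k) ⟨t 0, h0⟩ : V) : Plane) = t k := by
    induction k with
    | zero => rfl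
    | succ k ih =>
      rw [pow_succ', Equiv.Perm.mul_apply]
      exact hσ k (by omega) _ (ih (by omega))
  have hcycle (v : V) : σ.SameCycle ⟨t 0, h0⟩ v := by
    obtain ⟨k, hk, hkv⟩ := ht.bijOn.surjOn v.2
    exact ⟨k, Subtype.ext ((hpow k hk).trans hkv)⟩
  exact ⟨hV, Set.bijOn_univ.2 σ.bijective, fun v _ w _ => (hcycle v).symm.trans (hcycle w)⟩

lemma Follows.length_eq (hσ : Follows σ t) (ht : IsCyclicEnumeration V t) :
    length σ = ∑ k ∈ range #V, dist (t k) (t (k + 1)) := by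
  have hmem {k : ℕ} (hk : k ∈ range #V) : t k ∈ V := ht.bijOn.mapsTo (mem_range.1 hk)
  refine (sum_bij (fun k hk => (⟨t k, hmem hk⟩ : V)) (fun _ _ => mem_univ _) ?_ ?_ ?_).symm
  · exact fun a ha b hb hab =>
      ht.bijOn.injOn (mem_range.1 ha) (mem_range.1 hb) (congrArg Subtype.val hab)
  · intro v _
    obtain ⟨k, hk, hkv⟩ := ht.bijOn.surjOn v.2
    exact ⟨k, mem_range.2 hk, Subtype.ext hkv⟩
  · exact fun k hk => by rw [Subtype.dist_eq, hσ k (mem_range.1 hk) ⟨t k, hmem hk⟩ rfl]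

lemma IsCyclicEnumeration.exists_isTour (ht : IsCyclicEnumeration V t) (hV : 3 ≤ #V) :
    ∃ σ : Equiv.Perm V, IsTour σ ∧ length σ = ∑ k ∈ range #V, dist (t k) (t (k + 1)) := by
  obtain ⟨σ, hσ⟩ := ht.exists_follows
  exact ⟨σ, hσ.isTour ht hV, hσ.length_eq ht⟩

/-- The sequence of points that the permutation `σ` visits when it starts at `v`. -/
def orbitSeq (σ : Equiv.Perm V) (v : V) (k : ℕ) : Plane := ((σ ^ k) v : V)

lemma orbitSeq_succ (v : V) (k : ℕ) : orbitSeq σ v (k + 1) = σ ((σ ^ k) v) := by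
  rw [orbitSeq, pow_succ', Equiv.Perm.mul_apply]

lemma IsTour.isCyclicEnumeration (h : IsTour σ) (v : V) :
    IsCyclicEnumeration V (orbitSeq σ v) := by
  have hcycle : σ.IsCycleOn ((univ : Finset V) : Set V) := by
    rw [coe_univ]
    exact h.2
  have hcard : #(univ : Finset V) = #V := card_attach
  refine ⟨?_, fun k _ => ((σ ^ k) v).2, fun a ha b hb hab => ?_, fun x hx => ?_⟩
  · rw [← hcard, orbitSeq, hcycle.pow_card_apply (mem_univ v)]
    rfl
  · have hmod := (hcycle.pow_apply_eq_pow_apply (mem_univ v)).1 (Subtype.ext hab)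
    rw [hcard] at hmod
    exact hmod.eq_of_lt_of_lt ha hb
  · obtain ⟨k, hk, hkx⟩ := hcycle.exists_pow_eq (mem_univ v) (mem_univ ⟨x, hx⟩)
    exact ⟨k, hcard ▸ hk, congrArg Subtype.val hkx⟩

lemma IsTour.length_eq_sum_orbitSeq (h : IsTour σ) (v : V) :
    length σ = ∑ k ∈ range #V, dist (orbitSeq σ v k) (orbitSeq σ v (k + 1)) :=
  Follows.length_eq (fun k _ w hw => by rw [orbitSeq_succ, Subtype.ext hw])
    (h.isCyclicEnumeration v)

end Tours

section OptimalTours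

open Finset

variable {V : Finset Plane} {σ τ : Equiv.Perm V} {t : ℕ → Plane} {a : Plane} {l : List Plane}

lemma card_eq_length_of_nodup {α : Type*} {s : Finset α} {l : List α} (hnd : l.Nodup)
    (hs : ∀ x, x ∈ s ↔ x ∈ l) : #s = l.length := by
  classical
  rw [← List.toFinset_card_of_nodup hnd]
  exact congrArg card (ext fun x => by rw [List.mem_toFinset, hs])

lemma isCyclicEnumeration_getD (hnd : (a :: l).Nodup) (hV : ∀ x, x ∈ V ↔ x ∈ a :: l) :
    IsCyclicEnumeration V fun k => (a :: l ++ [a]).getD k a := by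
  have hcard := card_eq_length_of_nodup hnd hV
  have hget {k : ℕ} (hk : k < (a :: l).length) : (a :: l ++ [a]).getD k a = (a :: l)[k] := by
    rw [List.getD_append _ _ _ _ hk, List.getD_eq_getElem _ _ hk]
  refine ⟨by simp [hcard], fun k hk => ?_, fun i hi j hj hij => ?_, fun x hx => ?_⟩
  · have hk : k < (a :: l).length := hcard ▸ hk
    simp only [hget hk]
    exact (hV _).2 (List.getElem_mem hk)
  · have hi : i < (a :: l).length := hcard ▸ hi
    have hj : j < (a :: l).length := hcard ▸ hj
    simp only [hget hi, hget hj] at hij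
    exact hnd.getElem_inj_iff.1 hij
  · obtain ⟨k, hk, rfl⟩ := List.mem_iff_getElem.1 ((hV x).1 hx)
    exact ⟨k, hcard ▸ hk, hget hk⟩

lemma exists_isTour_of_isChain (hcard : 3 ≤ #V) (hnd : (a :: l).Nodup)
    (hV : ∀ x, x ∈ V ↔ x ∈ a :: l) {R : Plane → Plane → Prop}
    (hR : List.IsChain R (a :: l ++ [a])) :
    ∃ σ : Equiv.Perm V, IsTour σ ∧ (∀ v : V, R v (σ v)) ∧
      length σ = pathLength (a :: l ++ [a]) := by
  have ht := isCyclicEnumeration_getD hnd hV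
  obtain ⟨σ, hσ⟩ := ht.exists_follows
  have hlen : (a :: l ++ [a]).length = #V + 1 := by
    rw [List.length_append, List.length_singleton, card_eq_length_of_nodup hnd hV]
  refine ⟨σ, hσ.isTour ht hcard, fun v => ?_, ?_⟩
  · obtain ⟨k, hk, hkv⟩ := ht.bijOn.surjOn v.2
    simp only [Set.mem_Iio] at hk
    rw [hσ k hk v hkv.symm, ← hkv]
    simp only
    rw [List.getD_eq_getElem _ _ (by omega), List.getD_eq_getElem _ _ (by omega)]
    exact List.isChain_iff_getElem.1 hR k (by omega)
  · rw [hσ.length_eq ht, pathLength_eq_sum _ a, hlen, Nat.add_sub_cancel]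

lemma HasClosedWalk.exists_isTour {B : ℝ} (h : HasClosedWalk (V : Set Plane) a B) (hV : 3 ≤ #V) :
    ∃ τ : Equiv.Perm V, IsTour τ ∧ length τ ≤ B := by
  classical
  obtain ⟨l, hl, hB⟩ := h
  have hsub : (l.filter (· ≠ a)).dedup.Sublist l := (List.dedup_sublist _).trans List.filter_sublist
  have hnd : (a :: (l.filter (· ≠ a)).dedup).Nodup :=
    List.nodup_cons.2 ⟨by simp, List.nodup_dedup _⟩
  have hmem (x : Plane) : x ∈ V ↔ x ∈ a :: (l.filter (· ≠ a)).dedup := by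
    rw [← mem_coe, hl]
    by_cases hxa : x = a <;> simp [hxa]
  obtain ⟨τ, hτ, -, hτl⟩ := exists_isTour_of_isChain hV hnd hmem (R := fun _ _ => True)
    (List.isChain_iff_getElem.2 fun _ _ => trivial)
  exact ⟨τ, hτ, hτl.trans_le ((pathLength_le_of_sublist hsub a a).trans hB)⟩

lemma IsTour.hasClosedWalk (h : IsTour τ) (v : V) : HasClosedWalk (V : Set Plane) v (length τ) := by
  have ht := h.isCyclicEnumeration v
  obtain ⟨n, hn⟩ : ∃ n, #V = n + 1 := ⟨#V - 1, by have := h.1; omega⟩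
  have hlist : (v : Plane) :: (List.range n).map (fun k => orbitSeq τ v (k + 1)) =
      (List.range #V).map (orbitSeq τ v) := by
    rw [hn, List.range_succ_eq_map, List.map_cons, List.map_map]
    rfl
  refine ⟨(List.range n).map fun k => orbitSeq τ v (k + 1), fun x => ?_, ?_⟩
  · rw [hlist, ← ht.bijOn.image_eq]
    simp
  · rw [hlist, h.length_eq_sum_orbitSeq v, ← pathLength_map_range, List.range_succ, List.map_append,
      List.map_singleton, ht.closed]
    exact le_rfl

lemma IsTour.exists_isOptimalTour (h : IsTour σ) : ∃ τ : Equiv.Perm V, IsOptimalTour τ :=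
  (Set.toFinite {τ : Equiv.Perm V | IsTour τ}).exists_minimalFor length _ ⟨σ, h⟩
    |>.imp fun _ hτ => ⟨hτ.1, fun _ hτ' => (le_total _ _).elim id (hτ.2 hτ')⟩

/-- The permutation of `ℕ` that reverses the order of `1, …, r`. -/
def reverseIcc (r k : ℕ) : ℕ := if 1 ≤ k ∧ k ≤ r then r + 1 - k else k

lemma bijOn_reverseIcc {r n : ℕ} (hr : r < n) :
    Set.BijOn (reverseIcc r) (Set.Iio n) (Set.Iio n) := by
  have hinv (k : ℕ) : reverseIcc r (reverseIcc r k) = k := by grind [reverseIcc]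
  have hmaps : Set.MapsTo (reverseIcc r) (Set.Iio n) (Set.Iio n) := fun k hk => by
    grind [reverseIcc]
  exact Set.InvOn.bijOn ⟨fun k _ => hinv k, fun k _ => hinv k⟩ hmaps hmaps

lemma IsCyclicEnumeration.comp_reverseIcc (ht : IsCyclicEnumeration V t) {r : ℕ} (hr : r < #V) :
    IsCyclicEnumeration V (t ∘ reverseIcc r) where
  closed := by
    have hn : reverseIcc r #V = #V := if_neg (by omega)
    have h0 : reverseIcc r 0 = 0 := if_neg (by omega)
    simpa only [Function.comp_apply, hn, h0] using ht.closed
  bijOn := ht.bijOn.comp (bijOn_reverseIcc hr)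

lemma sum_dist_comp_reverseIcc {X : Type*} [PseudoMetricSpace X] (t : ℕ → X) {r n : ℕ}
    (hr : r < n) (hr0 : r ≠ 0) :
    (∑ k ∈ range n, dist ((t ∘ reverseIcc r) k) ((t ∘ reverseIcc r) (k + 1))) +
        (dist (t 0) (t 1) + dist (t r) (t (r + 1))) =
      (∑ k ∈ range n, dist (t k) (t (k + 1))) + (dist (t 0) (t r) + dist (t 1) (t (r + 1))) := by
  obtain ⟨m, rfl⟩ := Nat.exists_eq_succ_of_ne_zero hr0
  obtain ⟨s, rfl⟩ : ∃ s, n = m + 1 + 1 + s := ⟨n - (m + 2), by omega⟩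
  have hlow (k : ℕ) (hk : k ≤ m) : reverseIcc (m + 1) (k + 1) = m - k + 1 := by
    grind [reverseIcc]
  have hhigh (k : ℕ) : reverseIcc (m + 1) (m + 1 + 1 + k) = m + 1 + 1 + k := by
    grind [reverseIcc]
  have hmiddle : ∑ k ∈ range m, dist (t (reverseIcc (m + 1) (k + 1)))
      (t (reverseIcc (m + 1) (k + 1 + 1))) = ∑ k ∈ range m, dist (t (k + 1)) (t (k + 1 + 1)) := by
    rw [← sum_range_reflect fun k => dist (t (k + 1)) (t (k + 1 + 1))]
    refine sum_congr rfl fun k hk => ?_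
    have hk := mem_range.1 hk
    rw [hlow k hk.le, hlow (k + 1) hk, dist_comm]
    congr 2 <;> congr 1 <;> omega
  have hfirst : reverseIcc (m + 1) 0 = 0 := rfl
  have htop := hhigh 0
  have hone := hlow 0 (Nat.zero_le m)
  have hlast := hlow m le_rfl
  simp only [sum_range_add _ (m + 1 + 1) s, Function.comp_apply, sum_range_succ _ (m + 1),
    sum_range_succ' _ m, hmiddle, add_assoc (m + 1 + 1), hhigh]
  simp only [Nat.add_zero, Nat.sub_zero, Nat.sub_self, zero_add] at htop hone hlast ⊢
  rw [hfirst, htop, hone, hlast]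
  ring

lemma IsOptimalTour.isTwoOptimal (h : IsOptimalTour τ) : IsTwoOptimal τ := by
  refine ⟨h.1, fun a x hax => ?_⟩
  have ht := h.1.isCyclicEnumeration a
  obtain ⟨r, hr, hrx⟩ := ht.bijOn.surjOn x.2
  have hr0 : r ≠ 0 := by
    rintro rfl
    exact hax (Subtype.ext hrx)
  obtain ⟨σ, hσ, hσl⟩ := (ht.comp_reverseIcc hr).exists_isTour h.1.1
  have hsum := sum_dist_comp_reverseIcc (orbitSeq τ a) hr hr0
  have orbitSeq_zero : orbitSeq τ a 0 = a := rfl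
  have orbitSeq_one : orbitSeq τ a 1 = τ a := rfl
  have hr1 : orbitSeq τ a (r + 1) = τ x := by
    rw [orbitSeq_succ, Subtype.ext hrx]
  rw [← hσl, ← h.1.length_eq_sum_orbitSeq a, orbitSeq_zero, orbitSeq_one, hr1, hrx] at hsum
  have hle := h.2 σ hσ
  simp only [Subtype.dist_eq]
  linarith

end OptimalTours

section UpperBound

open Finset Real

variable {V : Finset Plane} {σ τ : Equiv.Perm V}

lemma IsTwoOptimal.simplePolygon (h : IsTwoOptimal τ) (hV : ¬ Collinear ℝ (V : Set Plane)) (v : V) :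
    SimplePolygon (orbitSeq τ v) #V := by
  have ht := h.1.isCyclicEnumeration v
  refine ⟨ht.closed, ht.bijOn.injOn, fun a b hab hb p hpa hpb => ?_⟩
  have hne : (τ ^ a) v ≠ (τ ^ b) v := fun hh =>
    hab.ne (ht.bijOn.injOn (hab.trans hb) hb (congrArg Subtype.val hh))
  rw [orbitSeq_succ, mem_segment_iff_wbtw] at hpa hpb
  rcases h.edges_inter hV hne hpa hpb with ⟨hsucc, hp⟩ | ⟨hsucc, hp⟩
  · have hba : orbitSeq τ v (a + 1) = orbitSeq τ v b := by rw [orbitSeq_succ, hsucc, orbitSeq]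
    exact Or.inl ⟨(ht.bijOn.injOn (show a + 1 < #V by omega) hb hba).symm, hp⟩
  · have hba : orbitSeq τ v (b + 1) = orbitSeq τ v a := by rw [orbitSeq_succ, hsucc, orbitSeq]
    rcases Nat.lt_or_ge (b + 1) #V with hlt | hge
    · have := ht.bijOn.injOn hlt (hab.trans hb) hba
      omega
    · obtain hbV : b + 1 = #V := by omega
      rw [hbV, ht.closed] at hba
      obtain rfl := ht.bijOn.injOn (show 0 < #V by omega) (hab.trans hb) hba
      exact Or.inr ⟨rfl, hbV, hp⟩

/-- The third vertex of the isosceles right triangle with legs `p q` and `p (quarterTurn p q)`; it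
is added to a tour to make the vertex set non-collinear. -/
noncomputable def quarterTurn (p q : Plane) : Plane :=
  !₂[p 0 - (q 1 - p 1), p 1 + (q 0 - p 0)]

lemma dist_quarterTurn (p q : Plane) : dist p (quarterTurn p q) = dist p q := by
  simp only [EuclideanSpace.dist_eq, Fin.sum_univ_two, quarterTurn, Real.dist_eq, sq_abs]
  congr 1
  simp
  ring

lemma not_collinear_quarterTurn {p q : Plane} (h : p ≠ q) :
    ¬ Collinear ℝ {p, q, quarterTurn p q} := by
  intro hcol
  obtain ⟨u, hu⟩ := (collinear_iff_of_mem (Set.mem_insert p _)).1 hcol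
  obtain ⟨r, hr⟩ := hu q (by simp)
  obtain ⟨s, hs⟩ := hu (quarterTurn p q) (by simp)
  have hcoord {x : Plane} {r : ℝ} (hx : x = r • u +ᵥ p) (i : Fin 2) : x i - p i = r * u i := by
    simp [hx]
  have hs0 : -(q 1 - p 1) = s * u 0 := by simpa [quarterTurn] using hcoord hs 0
  have hs1 : q 0 - p 0 = s * u 1 := by simpa [quarterTurn] using hcoord hs 1
  have hsq : (q 0 - p 0) ^ 2 + (q 1 - p 1) ^ 2 = 0 := by
    linear_combination (q 0 - p 0) * hs1 - (q 1 - p 1) * hs0 + s * u 1 * hcoord hr 0 -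
      s * u 0 * hcoord hr 1
  refine h (plane_ext ?_ ?_) <;> nlinarith [sq_nonneg (q 0 - p 0), sq_nonneg (q 1 - p 1)]

lemma IsTour.two_mul_dist_le (h : IsTour τ) (v w : V) : 2 * dist (v : Plane) w ≤ length τ :=
  (h.hasClosedWalk v).two_mul_dist_le w.2

lemma IsTour.length_pos (h : IsTour τ) : 0 < length τ := by
  obtain ⟨v, hv, w, hw, hvw⟩ := one_lt_card.1 (lt_of_lt_of_le (by norm_num) h.1 : 1 < #V)
  exact (mul_pos two_pos (dist_pos.2 hvw)).trans_le (h.two_mul_dist_le ⟨v, hv⟩ ⟨w, hw⟩)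

lemma IsTour.exists_simplePolygon (hτ : IsTour τ) : ∃ (t : ℕ → Plane) (m : ℕ), SimplePolygon t m ∧
    (∀ v ∈ V, ∃ k < m, t k = v) ∧ m ≤ #V + 1 ∧
    ∑ r ∈ range m, dist (t r) (t (r + 1)) ≤ 2 * length τ := by
  classical
  obtain ⟨v, hv, w, hw, hvw⟩ := one_lt_card.1 (lt_of_lt_of_le (by norm_num) hτ.1 : 1 < #V)
  set W := insert (quarterTurn v w) V
  have hVW : V ⊆ W := subset_insert _ _
  have hwalk : HasClosedWalk (W : Set Plane) v (2 * length τ) := by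
    rw [coe_insert]
    refine ((hτ.hasClosedWalk ⟨v, hv⟩).insert_of_mem (q := v) hv _).mono ?_
    have hle : 2 * dist v w ≤ length τ := hτ.two_mul_dist_le ⟨v, hv⟩ ⟨w, hw⟩
    rw [dist_quarterTurn]
    linarith
  obtain ⟨τ₁, hτ₁, hτ₁l⟩ := hwalk.exists_isTour (hτ.1.trans (card_le_card hVW))
  obtain ⟨τ₂, hτ₂⟩ := hτ₁.exists_isOptimalTour
  have hW : ¬ Collinear ℝ (W : Set Plane) := fun hcol => by
    refine not_collinear_quarterTurn hvw (hcol.subset ?_)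
    rintro _ (rfl | rfl | rfl)
    exacts [hVW hv, hVW hw, mem_insert_self _ _]
  refine ⟨_, _, hτ₂.isTwoOptimal.simplePolygon hW ⟨v, hVW hv⟩, fun x hx =>
    (hτ₂.1.isCyclicEnumeration _).bijOn.surjOn (hVW hx), card_insert_le _ _, ?_⟩
  rw [← hτ₂.1.length_eq_sum_orbitSeq]
  exact (hτ₂.2 _ hτ₁).trans hτ₁l

lemma IsTwoOptimal.length_le (hσ : IsTwoOptimal σ) (hτ : IsTour τ) {K : ℝ} (hK : 1 < K) :
    length σ ≤ 8 * (length τ * (K / 2 + (1 + 2 * log (((#V : ℝ) + 1) ^ 4 + 1)) / log K)) := by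
  obtain ⟨t, m, ht, hV, hm, hlen⟩ := hτ.exists_simplePolygon
  have hlog : 0 ≤ log (((#V : ℝ) + 1) ^ 4 + 1) :=
    log_nonneg (le_add_of_nonneg_left (by positivity))
  have hlogK := log_pos hK
  calc
    _ ≤ _ := hσ.length_le_of_simplePolygon ht hV hm hK
    _ ≤ 4 * (2 * length τ * (K / 2 + (1 + 2 * log (((#V : ℝ) + 1) ^ 4 + 1)) / log K)) := by
      gcongr
    _ = _ := by ring

lemma le_of_mem_twoOptRatios {n : ℕ} {r : ℝ} (hr : r ∈ twoOptRatios n) {K : ℝ} (hK : 1 < K) :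
    r ≤ 8 * (K / 2 + (1 + 2 * log (((n : ℝ) + 1) ^ 4 + 1)) / log K) := by
  obtain ⟨V, rfl, σ, τ, ⟨-, -, -, hσ⟩, hτ, rfl⟩ := hr
  rw [div_le_iff₀ hτ.1.length_pos]
  have := hσ.length_le hτ.1 hK
  linarith

lemma bddAbove_twoOptRatios (n : ℕ) : BddAbove (twoOptRatios n) :=
  ⟨_, fun _ hr => le_of_mem_twoOptRatios hr one_lt_two⟩

lemma IsTwoOptimal.isTwoOptOutput (h : IsTwoOptimal σ) : IsTwoOptOutput σ :=
  ⟨σ, h.1, Relation.ReflTransGen.refl, h⟩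

lemma twoOptRatios_nonempty {n : ℕ} (hn : 3 ≤ n) : (twoOptRatios n).Nonempty := by
  obtain ⟨V, rfl⟩ := Infinite.exists_subset_card_eq Plane n
  obtain ⟨v, hv⟩ : V.Nonempty := card_pos.1 (by omega)
  have hwalk : HasClosedWalk (V : Set Plane) v (pathLength (v :: V.toList ++ [v])) :=
    ⟨V.toList, fun x => by simpa using fun h : x = v => h ▸ hv, le_rfl⟩
  obtain ⟨τ, hτ, -⟩ := hwalk.exists_isTour hn
  obtain ⟨σ, hσ⟩ := hτ.exists_isOptimalTour
  exact ⟨_, V, rfl, σ, σ, hσ.isTwoOptimal.isTwoOptOutput, hσ, rfl⟩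

end UpperBound

lemma plane_dist_sq (a b : Plane) : dist a b ^ 2 = (a 0 - b 0) ^ 2 + (a 1 - b 1) ^ 2 := by
  rw [EuclideanSpace.dist_eq, Real.sq_sqrt (by positivity), Fin.sum_univ_two, Real.dist_eq,
    Real.dist_eq, sq_abs, sq_abs]

lemma abs_sub_le_plane_dist (a b : Plane) (i : Fin 2) : |a i - b i| ≤ dist a b := by
  refine abs_le_of_sq_le_sq ?_ dist_nonneg
  rw [plane_dist_sq]
  fin_cases i
  · exact le_add_of_nonneg_right (sq_nonneg _)
  · exact le_add_of_nonneg_left (sq_nonneg _)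

lemma sub_le_plane_dist (a b : Plane) (i : Fin 2) : a i - b i ≤ dist a b :=
  (le_abs_self _).trans (abs_sub_le_plane_dist a b i)

lemma sub_le_plane_dist_symm (a b : Plane) (i : Fin 2) : b i - a i ≤ dist a b := by
  rw [dist_comm]; exact sub_le_plane_dist b a i

lemma plane_dist_of_fst_eq {a b : Plane} (h : a 0 = b 0) : dist a b = |a 1 - b 1| := by
  rw [← abs_of_nonneg (dist_nonneg (x := a) (y := b)), ← sq_eq_sq_iff_abs_eq_abs, plane_dist_sq, h]
  ring

lemma plane_dist_of_snd_eq {a b : Plane} (h : a 1 = b 1) : dist a b = |a 0 - b 0| := by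
  rw [← abs_of_nonneg (dist_nonneg (x := a) (y := b)), ← sq_eq_sq_iff_abs_eq_abs, plane_dist_sq, h]
  ring

-- The triangle inequality for `a - x` and the reflection of `b - y` in the vertical axis.
lemma le_dist_add_dist_of_sq_le {a b x y : Plane} {r : ℝ}
    (h : r ^ 2 ≤ ((a 0 - x 0) - (b 0 - y 0)) ^ 2 + ((a 1 - x 1) + (b 1 - y 1)) ^ 2) :
    r ≤ dist a x + dist b y := by
  refine (le_abs_self r).trans (abs_le_of_sq_le_sq ?_ (add_nonneg dist_nonneg dist_nonneg))
  have cauchy_schwarz :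
      (a 1 - x 1) * (b 1 - y 1) - (a 0 - x 0) * (b 0 - y 0) ≤ dist a x * dist b y := by
    refine (le_abs_self _).trans (abs_le_of_sq_le_sq ?_ (mul_nonneg dist_nonneg dist_nonneg))
    rw [mul_pow, plane_dist_sq, plane_dist_sq]
    nlinarith [sq_nonneg ((a 0 - x 0) * (b 1 - y 1) + (a 1 - x 1) * (b 0 - y 0))]
  nlinarith [plane_dist_sq a x, plane_dist_sq b y]

/-- The height of the layer `i` of an instance on which 2-Opt performs badly. Its points lie on
horizontal layers `0, …, d`, which the tour traverses in this order, alternately rightwards and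
leftwards. -/
noncomputable def layerHeight (d i : ℕ) : ℝ := 2 / (d : ℝ) ^ (i + 1)

/-- The number of edges of the tour in the layer `i`. The parameter `q` for the last layer serves to
adjust the number of points of the instance. -/
def layerSteps (d q i : ℕ) : ℕ := if i < d then d ^ i else q

/-- The leftmost abscissa of the layer `i`; the rightmost one is `1`. The first and the last layer
extend to `-1`, so that the tour can be closed by a vertical edge away from the other layers. -/
noncomputable def layerLeft (d i : ℕ) : ℝ := if i = 0 ∨ i = d then -1 else 0

/-- The length of the edges in the layer `i`. -/
noncomputable def layerGap (d q i : ℕ) : ℝ := (1 - layerLeft d i) / layerSteps d q i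

/-- The `j`-th point of the layer `i`, counted from the left. -/
noncomputable def layerPoint (d q i j : ℕ) : Plane :=
  !₂[layerLeft d i + j * layerGap d q i, layerHeight d i]

@[simp] lemma layerPoint_zero (d q i j : ℕ) :
    layerPoint d q i j 0 = layerLeft d i + j * layerGap d q i := by simp [layerPoint]

@[simp] lemma layerPoint_one (d q i j : ℕ) : layerPoint d q i j 1 = layerHeight d i := by
  simp [layerPoint]

/-- An edge inside of the layer `i`: rightwards in the even and leftwards in the odd layers. -/
structure IsLayerEdge (d q i : ℕ) (a b : Plane) : Prop where
  le : i ≤ d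
  height_fst : a 1 = layerHeight d i
  height_snd : b 1 = layerHeight d i
  left_le_fst : layerLeft d i ≤ a 0
  left_le_snd : layerLeft d i ≤ b 0
  fst_le_one : a 0 ≤ 1
  snd_le_one : b 0 ≤ 1
  even : Even i → b 0 = a 0 + layerGap d q i
  odd : Odd i → b 0 = a 0 - layerGap d q i
  grid : ∃ j : ℤ, a 0 = layerLeft d i + j * layerGap d q i

/-- An edge from the layer `i` to the layer `i + 1`. -/
structure IsConnector (d i : ℕ) (a b : Plane) : Prop where
  lt : i < d
  height_fst : a 1 = layerHeight d i
  height_snd : b 1 = layerHeight d (i + 1)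
  vertical : b 0 = a 0
  even : Even i → a 0 = 1
  odd : Odd i → a 0 = 0

/-- The edge from the last layer back to the first one. -/
structure IsClosingEdge (d : ℕ) (a b : Plane) : Prop where
  height_fst : a 1 = layerHeight d d
  height_snd : b 1 = layerHeight d 0
  vertical : b 0 = a 0
  left : a 0 = -1

/-- The oriented edges of the tour through the layers. -/
def IsLayeredEdge (d q : ℕ) (a b : Plane) : Prop :=
  (∃ i, IsLayerEdge d q i a b) ∨ (∃ i, IsConnector d i a b) ∨ IsClosingEdge d a b

section LayeredInstance
variable {d q : ℕ}

lemma layerHeight_pos (hd : 5 ≤ d) (i : ℕ) : 0 < layerHeight d i := by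
  have : (0 : ℝ) < d := by exact_mod_cast (by omega : 0 < d)
  unfold layerHeight; positivity

lemma mul_layerHeight_succ (hd : 5 ≤ d) (i : ℕ) :
    (d : ℝ) * layerHeight d (i + 1) = layerHeight d i := by
  have : (0 : ℝ) < d := by exact_mod_cast (by omega : 0 < d)
  unfold layerHeight; field_simp; ring

lemma five_mul_layerHeight_succ (hd : 5 ≤ d) (i : ℕ) :
    5 * layerHeight d (i + 1) ≤ layerHeight d i := by
  have : (5 : ℝ) ≤ d := by exact_mod_cast hd
  rw [← mul_layerHeight_succ hd i]
  exact mul_le_mul_of_nonneg_right this (layerHeight_pos hd _).le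

lemma layerHeight_anti (hd : 5 ≤ d) : Antitone (layerHeight d) :=
  antitone_nat_of_succ_le fun i => by
    linarith [five_mul_layerHeight_succ hd i, layerHeight_pos hd (i + 1)]

lemma five_mul_layerHeight (hd : 5 ≤ d) {i j : ℕ} (h : i < j) :
    5 * layerHeight d j ≤ layerHeight d i := by
  have := layerHeight_anti hd (show i + 1 ≤ j from h)
  linarith [five_mul_layerHeight_succ hd i]

lemma layerHeight_one (d : ℕ) : layerHeight d 1 = layerHeight d 0 ^ 2 / 2 := by
  unfold layerHeight
  rw [div_pow]; ring

lemma layerHeight_zero_le (hd : 5 ≤ d) : layerHeight d 0 ≤ 2 / 5 := by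
  have : (5 : ℝ) ≤ d := by exact_mod_cast hd
  unfold layerHeight
  rw [zero_add, pow_one]
  exact div_le_div_of_nonneg_left (by norm_num) (by norm_num) this

lemma layerSteps_pos (hd : 5 ≤ d) (hq : 2 * d ^ d ≤ q) (i : ℕ) : 0 < layerSteps d q i := by
  have : 0 < d ^ d := by positivity
  unfold layerSteps; split_ifs
  · positivity
  · omega

lemma layerLeft_le (d i : ℕ) : layerLeft d i ≤ 0 := by
  unfold layerLeft; split_ifs <;> norm_num

lemma layerLeft_eq_zero {i : ℕ} (hi : 0 < i) (hid : i < d) : layerLeft d i = 0 := by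
  rw [layerLeft, if_neg (by omega)]

lemma layerGap_pos (hd : 5 ≤ d) (hq : 2 * d ^ d ≤ q) (i : ℕ) : 0 < layerGap d q i :=
  div_pos (by linarith [layerLeft_le d i]) (by exact_mod_cast layerSteps_pos hd hq i)

lemma layerGap_zero (hd : 5 ≤ d) : layerGap d q 0 = 2 := by
  have : 0 < d := by omega
  simp [layerGap, layerLeft, layerSteps, this]; norm_num

lemma layerGap_le (hd : 5 ≤ d) (hq : 2 * d ^ d ≤ q) {i : ℕ} (hi : i < d) :
    2 * layerGap d q (i + 1) ≤ layerHeight d i := by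
  unfold layerGap layerSteps layerHeight layerLeft
  rcases Nat.lt_or_ge (i + 1) d with h | h
  · rw [if_neg (by omega), if_pos h, sub_zero, Nat.cast_pow, mul_one_div]
  · have : i + 1 = d := by omega
    rw [if_pos (Or.inr this), if_neg (by omega), this]
    have hq' : 2 * (d : ℝ) ^ d ≤ q := by exact_mod_cast hq
    have hp : 0 < (d : ℝ) ^ d := by positivity
    rw [← mul_div_assoc, div_le_div_iff₀ (by linarith) hp]
    linarith

lemma layerGap_le_mul (hd : 5 ≤ d) (hq : 2 * d ^ d ≤ q) {i : ℕ} (hi : i ≤ d) :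
    layerGap d q i ≤ d * layerHeight d i := by
  have d_pos : (0 : ℝ) < d := by exact_mod_cast (by omega : 0 < d)
  cases i with
  | zero =>
    rw [layerGap_zero hd]
    unfold layerHeight
    rw [zero_add, pow_one, mul_div_cancel₀ _ d_pos.ne']
  | succ i =>
    rw [mul_layerHeight_succ hd]
    linarith [layerGap_le hd hq (show i < d by omega), layerGap_pos hd hq (i + 1)]

lemma layerGap_mul_le (hd : 5 ≤ d) (hq : 2 * d ^ d ≤ q) {i j : ℕ} (hij : i + 2 ≤ j) (hj : j ≤ d) :
    layerGap d q i * layerGap d q j ≤ (layerHeight d i - layerHeight d j) ^ 2 := by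
  obtain ⟨k, rfl⟩ : ∃ k, j = k + 1 := ⟨j - 1, by omega⟩
  have height_le := layerHeight_anti hd (show i + 1 ≤ k by omega)
  have height_pos := layerHeight_pos hd i
  have gap_le : layerGap d q (k + 1) ≤ layerHeight d (i + 1) / 2 := by
    linarith [layerGap_le hd hq hj]
  have product_le : layerGap d q i * layerGap d q (k + 1) ≤ layerHeight d i ^ 2 / 2 :=
    calc layerGap d q i * layerGap d q (k + 1)
        ≤ (d * layerHeight d i) * (layerHeight d (i + 1) / 2) :=
          mul_le_mul (layerGap_le_mul hd hq (by omega)) gap_le (layerGap_pos hd hq _).le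
            (by positivity)
      _ = layerHeight d i ^ 2 / 2 := by
        rw [← mul_layerHeight_succ hd i]
        ring
  nlinarith [five_mul_layerHeight_succ hd i, five_mul_layerHeight_succ hd k,
    layerHeight_pos hd (k + 1)]

variable {a b x y : Plane} {i j : ℕ}

lemma IsLayerEdge.dist_eq (hd : 5 ≤ d) (hq : 2 * d ^ d ≤ q) (h : IsLayerEdge d q i a b) :
    dist a b = layerGap d q i := by
  have := layerGap_pos hd hq i
  rw [plane_dist_of_snd_eq (h.height_fst.trans h.height_snd.symm)]
  rcases Nat.even_or_odd i with hi | hi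
  · rw [h.even hi, show a 0 - (a 0 + layerGap d q i) = -layerGap d q i by ring, abs_neg,
      abs_of_pos this]
  · rw [h.odd hi, show a 0 - (a 0 - layerGap d q i) = layerGap d q i by ring, abs_of_pos this]

lemma IsConnector.dist_eq (hd : 5 ≤ d) (h : IsConnector d i a b) :
    dist a b = layerHeight d i - layerHeight d (i + 1) := by
  rw [plane_dist_of_fst_eq h.vertical.symm, h.height_fst, h.height_snd,
    abs_of_nonneg (sub_nonneg.2 (layerHeight_anti hd (Nat.le_succ i)))]

lemma IsClosingEdge.dist_eq (hd : 5 ≤ d) (h : IsClosingEdge d a b) :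
    dist a b = layerHeight d 0 - layerHeight d d := by
  rw [dist_comm, plane_dist_of_fst_eq h.vertical, h.height_fst, h.height_snd,
    abs_of_nonneg (sub_nonneg.2 (layerHeight_anti hd (Nat.zero_le d)))]

lemma IsLayerEdge.layerGap_le_abs_sub (hd : 5 ≤ d) (hq : 2 * d ^ d ≤ q)
    (h : IsLayerEdge d q i a b) (h' : IsLayerEdge d q i x y) (hne : a ≠ x) :
    layerGap d q i ≤ |a 0 - x 0| := by
  have gap_pos := layerGap_pos hd hq i
  obtain ⟨k, hk⟩ := h.grid
  obtain ⟨l, hl⟩ := h'.grid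
  have hkl : k ≠ l := by
    rintro rfl
    exact hne (plane_ext (hk.trans hl.symm) (h.height_fst.trans h'.height_fst.symm))
  have one_le : (1 : ℝ) ≤ |((k - l : ℤ) : ℝ)| := by
    rw [← Int.cast_abs]
    exact_mod_cast Int.one_le_abs (sub_ne_zero.2 hkl)
  calc layerGap d q i ≤ |((k - l : ℤ) : ℝ)| * layerGap d q i :=
        le_mul_of_one_le_left gap_pos.le one_le
    _ = |a 0 - x 0| := by
      rw [hk, hl, ← abs_of_pos gap_pos, ← abs_mul, abs_of_pos gap_pos]
      push_cast
      ring_nf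

lemma IsLayerEdge.dist_add_dist_le_of_eq (hd : 5 ≤ d) (hq : 2 * d ^ d ≤ q)
    (h : IsLayerEdge d q i a b) (h' : IsLayerEdge d q i x y) (hne : a ≠ x) :
    dist a b + dist x y ≤ dist a x + dist b y := by
  have gap_le := h.layerGap_le_abs_sub hd hq h' hne
  have parallel : b 0 - y 0 = a 0 - x 0 := by
    rcases Nat.even_or_odd i with hi | hi
    · rw [h.even hi, h'.even hi]; ring
    · rw [h.odd hi, h'.odd hi]; ring
  have le_fst := abs_sub_le_plane_dist a x 0
  have le_snd := abs_sub_le_plane_dist b y 0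
  rw [parallel] at le_snd
  rw [h.dist_eq hd hq, h'.dist_eq hd hq]
  linarith

lemma IsLayerEdge.dist_add_dist_le_of_even_iff (hd : 5 ≤ d) (hq : 2 * d ^ d ≤ q)
    (h : IsLayerEdge d q i a b) (h' : IsLayerEdge d q j x y) (hij : i < j)
    (hpar : Even i ↔ Even j) : dist a b + dist x y ≤ dist a x + dist b y := by
  have hij' : i + 2 ≤ j := by grind
  have gap_mul_le := layerGap_mul_le hd hq hij' h'.le
  rw [h.dist_eq hd hq, h'.dist_eq hd hq]
  refine le_dist_add_dist_of_sq_le ?_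
  rw [h.height_fst, h.height_snd, h'.height_fst, h'.height_snd]
  rcases Nat.even_or_odd i with hi | hi
  · rw [h.even hi, h'.even (hpar.1 hi)]
    nlinarith
  · rw [h.odd hi, h'.odd (by grind)]
    nlinarith

lemma IsLayerEdge.dist_add_dist_le_of_not_even_iff (hd : 5 ≤ d) (hq : 2 * d ^ d ≤ q)
    (h : IsLayerEdge d q i a b) (h' : IsLayerEdge d q j x y) (hpar : ¬(Even i ↔ Even j)) :
    dist a b + dist x y ≤ dist a x + dist b y := by
  rw [h.dist_eq hd hq, h'.dist_eq hd hq]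
  rcases Nat.even_or_odd i with hi | hi
  · have hb := h.even hi
    have hy := h'.odd (by grind)
    linarith [sub_le_plane_dist_symm a x 0, sub_le_plane_dist b y 0]
  · have hb := h.odd hi
    have hy := h'.even (by grind)
    linarith [sub_le_plane_dist a x 0, sub_le_plane_dist_symm b y 0]

lemma IsLayerEdge.dist_add_dist_le (hd : 5 ≤ d) (hq : 2 * d ^ d ≤ q) (h : IsLayerEdge d q i a b)
    (h' : IsLayerEdge d q j x y) (hne : a ≠ x) (hij : i ≤ j) :
    dist a b + dist x y ≤ dist a x + dist b y := by
  by_cases hpar : Even i ↔ Even j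
  · rcases hij.eq_or_lt with rfl | hlt
    · exact h.dist_add_dist_le_of_eq hd hq h' hne
    · exact h.dist_add_dist_le_of_even_iff hd hq h' hlt hpar
  · exact h.dist_add_dist_le_of_not_even_iff hd hq h' hpar

lemma IsConnector.dist_add_dist_le_layerEdge_of_lt (hd : 5 ≤ d) (hq : 2 * d ^ d ≤ q)
    (h : IsConnector d i a b) (h' : IsLayerEdge d q j x y) (hij : i + 1 < j) :
    dist a b + dist x y ≤ dist a x + dist b y := by
  obtain ⟨k, rfl⟩ : ∃ k, j = k + 1 := ⟨j - 1, by omega⟩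
  have le_fst := sub_le_plane_dist a x 1
  have le_snd := sub_le_plane_dist b y 1
  rw [h.height_fst, h'.height_fst] at le_fst
  rw [h.height_snd, h'.height_snd] at le_snd
  have gap_le := layerGap_le hd hq h'.le
  have height_le := layerHeight_anti hd (show i + 1 ≤ k by omega)
  have next_height_le := five_mul_layerHeight_succ hd k
  have height_pos := layerHeight_pos hd (k + 1)
  rw [h.dist_eq hd, h'.dist_eq hd hq]
  linarith

lemma IsConnector.dist_add_dist_le_layerEdge_of_le (hd : 5 ≤ d) (hq : 2 * d ^ d ≤ q)
    (h : IsConnector d i a b) (h' : IsLayerEdge d q j x y) (hji : j ≤ i)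
    (hpar : Even i ↔ Even j) : dist a b + dist x y ≤ dist a x + dist b y := by
  have height_le := layerHeight_anti hd hji
  have le_snd := sub_le_plane_dist_symm b y 1
  rw [h.height_snd, h'.height_snd] at le_snd
  rw [h.dist_eq hd, h'.dist_eq hd hq]
  suffices layerGap d q j ≤ dist a x by linarith
  rcases Nat.even_or_odd i with hi | hi
  · linarith [sub_le_plane_dist a x 0, h.even hi, h'.even (hpar.1 hi), h'.snd_le_one]
  · have hj : Odd j := by grind
    have left_le := h'.left_le_snd
    rw [layerLeft_eq_zero hj.pos (by have := h.lt; omega)] at left_le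
    linarith [sub_le_plane_dist_symm a x 0, h.odd hi, h'.odd hj]

lemma IsLayerEdge.eq_neg_one_and_eq_one (hd : 5 ≤ d) (h : IsLayerEdge d q 0 x y) :
    x 0 = -1 ∧ y 0 = 1 := by
  have snd_eq := h.even (by simp)
  have left_le := h.left_le_fst
  rw [layerGap_zero hd] at snd_eq
  have left_eq : layerLeft d 0 = -1 := by simp [layerLeft]
  constructor <;> linarith [h.snd_le_one]

lemma IsConnector.dist_add_dist_le_layerEdge_zero (hd : 5 ≤ d) (hq : 2 * d ^ d ≤ q)
    (h : IsConnector d i a b) (h' : IsLayerEdge d q 0 x y) (hi : Odd i) :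
    dist a b + dist x y ≤ dist a x + dist b y := by
  obtain ⟨hx, hy⟩ := h'.eq_neg_one_and_eq_one hd
  rw [h.dist_eq hd, h'.dist_eq hd hq, layerGap_zero hd]
  refine le_dist_add_dist_of_sq_le ?_
  rw [h.vertical, h.odd hi, hx, hy, h.height_fst, h.height_snd, h'.height_fst, h'.height_snd]
  have height_le := layerHeight_anti hd (show 1 ≤ i from hi.pos)
  have five_height_le := five_mul_layerHeight hd (show 0 < i from hi.pos)
  have five_next_height_le := five_mul_layerHeight_succ hd i
  have height_one := layerHeight_one d
  have height_pos := layerHeight_pos hd i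
  have next_height_pos := layerHeight_pos hd (i + 1)
  nlinarith

lemma IsConnector.dist_le_dist_layerEdge (hd : 5 ≤ d) (h : IsConnector d i a b)
    (h' : IsLayerEdge d q j x y) (hij : i ≠ j) : dist a b ≤ dist a x := by
  rw [h.dist_eq hd]
  rcases hij.lt_or_gt with hlt | hgt
  · have le_dist := sub_le_plane_dist a x 1
    rw [h.height_fst, h'.height_fst] at le_dist
    linarith [layerHeight_anti hd hlt]
  · have le_dist := sub_le_plane_dist_symm a x 1
    rw [h.height_fst, h'.height_fst] at le_dist
    linarith [five_mul_layerHeight hd hgt, layerHeight_pos hd i, layerHeight_pos hd (i + 1)]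

lemma IsConnector.dist_add_dist_le_layerEdge_of_not_even_iff (hdo : Odd d) (hd : 5 ≤ d)
    (hq : 2 * d ^ d ≤ q) (h : IsConnector d i a b) (h' : IsLayerEdge d q j x y) (hj : j ≠ 0)
    (hpar : ¬(Even i ↔ Even j)) : dist a b + dist x y ≤ dist a x + dist b y := by
  refine add_le_add (h.dist_le_dist_layerEdge hd h' (by grind)) ?_
  rw [h'.dist_eq hd hq]
  rcases Nat.even_or_odd i with hi | hi
  · linarith [sub_le_plane_dist b y 0, h.vertical, h.even hi, h'.odd (by grind), h'.fst_le_one]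
  · have hje : Even j := by grind
    have hjd : j < d := lt_of_le_of_ne h'.le (by grind)
    have left_le := h'.left_le_fst
    rw [layerLeft_eq_zero hj.pos hjd] at left_le
    linarith [sub_le_plane_dist_symm b y 0, h.vertical, h.odd hi, h'.even hje]

lemma IsConnector.dist_add_dist_le_layerEdge (hdo : Odd d) (hd : 5 ≤ d) (hq : 2 * d ^ d ≤ q)
    (h : IsConnector d i a b) (h' : IsLayerEdge d q j x y) :
    dist a b + dist x y ≤ dist a x + dist b y := by
  by_cases hpar : Even i ↔ Even j
  · rcases Nat.lt_or_ge i j with hij | hij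
    · exact h.dist_add_dist_le_layerEdge_of_lt hd hq h' (by grind)
    · exact h.dist_add_dist_le_layerEdge_of_le hd hq h' hij hpar
  · rcases eq_or_ne j 0 with rfl | hj
    · exact h.dist_add_dist_le_layerEdge_zero hd hq h' (by grind)
    · exact h.dist_add_dist_le_layerEdge_of_not_even_iff hdo hd hq h' hj hpar

lemma IsClosingEdge.dist_add_dist_le_layerEdge (hdo : Odd d) (hd : 5 ≤ d) (hq : 2 * d ^ d ≤ q)
    (h : IsClosingEdge d a b) (h' : IsLayerEdge d q j x y) :
    dist a b + dist x y ≤ dist a x + dist b y := by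
  rw [h.dist_eq hd, h'.dist_eq hd hq]
  have fst_eq := h.left
  have snd_eq := h.vertical.trans h.left
  have le_fst := sub_le_plane_dist_symm a x 1
  have le_snd := sub_le_plane_dist b y 1
  have abscissa_le_fst := sub_le_plane_dist_symm a x 0
  have abscissa_le_snd := sub_le_plane_dist_symm b y 0
  rw [h.height_fst, h'.height_fst] at le_fst
  rw [h.height_snd, h'.height_snd] at le_snd
  have height_pos := layerHeight_pos hd d
  have height_zero_le := layerHeight_zero_le hd
  rcases Nat.eq_zero_or_pos j with rfl | hj
  · obtain ⟨_, _⟩ := h'.eq_neg_one_and_eq_one hd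
    have gap_eq := layerGap_zero (q := q) hd
    linarith
  rcases h'.le.eq_or_lt with rfl | hjd
  · have step := h'.odd hdo
    have left_le_snd := h'.left_le_snd
    have left_eq : layerLeft j j = -1 := by simp [layerLeft]
    linarith
  · have left_eq := layerLeft_eq_zero hj hjd
    obtain ⟨k, rfl⟩ : ∃ k, j = k + 1 := ⟨j - 1, by omega⟩
    have gap_le := layerGap_le hd hq (show k < d by omega)
    have height_le := layerHeight_anti hd (Nat.zero_le k)
    have left_le_fst := h'.left_le_fst
    have left_le_snd := h'.left_le_snd
    linarith

lemma IsConnector.dist_add_dist_le (hd : 5 ≤ d) (h : IsConnector d i a b) (h' : IsConnector d j x y)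
    (hne : a ≠ x) (hij : i ≤ j) : dist a b + dist x y ≤ dist a x + dist b y := by
  rw [h.dist_eq hd, h'.dist_eq hd]
  have hlt : i < j := by
    refine lt_of_le_of_ne hij ?_
    rintro rfl
    refine hne (plane_ext ?_ (h.height_fst.trans h'.height_fst.symm))
    rcases Nat.even_or_odd i with hi | hi
    · rw [h.even hi, h'.even hi]
    · rw [h.odd hi, h'.odd hi]
  have le_fst := sub_le_plane_dist a x 1
  have le_snd := sub_le_plane_dist b y 1
  rw [h.height_fst, h'.height_fst] at le_fst
  rw [h.height_snd, h'.height_snd] at le_snd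
  have := layerHeight_anti hd (show i + 1 ≤ j from hlt)
  linarith

lemma IsClosingEdge.dist_add_dist_le_connector (hd : 5 ≤ d) (h : IsClosingEdge d a b)
    (h' : IsConnector d j x y) : dist a b + dist x y ≤ dist a x + dist b y := by
  rw [h.dist_eq hd, h'.dist_eq hd]
  have le_fst := sub_le_plane_dist_symm a x 1
  have le_snd := sub_le_plane_dist b y 1
  rw [h.height_fst, h'.height_fst] at le_fst
  rw [h.height_snd, h'.height_snd] at le_snd
  linarith

lemma IsLayeredEdge.dist_add_dist_le (hdo : Odd d) (hd : 5 ≤ d) (hq : 2 * d ^ d ≤ q)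
    (h : IsLayeredEdge d q a b) (h' : IsLayeredEdge d q x y) (hne : a ≠ x) :
    dist a b + dist x y ≤ dist a x + dist b y := by
  have swap : dist x y + dist a b ≤ dist x a + dist y b →
      dist a b + dist x y ≤ dist a x + dist b y := fun hxy => by
    rw [dist_comm x a, dist_comm y b] at hxy; linarith
  rcases h with ⟨i, h⟩ | ⟨i, h⟩ | h <;> rcases h' with ⟨j, h'⟩ | ⟨j, h'⟩ | h'
  · rcases le_total i j with hij | hij
    · exact h.dist_add_dist_le hd hq h' hne hij
    · exact swap (h'.dist_add_dist_le hd hq h hne.symm hij)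
  · exact swap (h'.dist_add_dist_le_layerEdge hdo hd hq h)
  · exact swap (h'.dist_add_dist_le_layerEdge hdo hd hq h)
  · exact h.dist_add_dist_le_layerEdge hdo hd hq h'
  · rcases le_total i j with hij | hij
    · exact h.dist_add_dist_le hd h' hne hij
    · exact swap (h'.dist_add_dist_le hd h hne.symm hij)
  · exact swap (h'.dist_add_dist_le_connector hd h)
  · exact h.dist_add_dist_le_layerEdge hdo hd hq h'
  · exact h.dist_add_dist_le_connector hd h'
  · exact absurd (plane_ext (h.left.trans h'.left.symm) (h.height_fst.trans h'.height_fst.symm)) hne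

end LayeredInstance

lemma dist_head_last_le_pathLength {X : Type*} [PseudoMetricSpace X] {l : List X} {a b : X}
    (ha : a ∈ l.head?) (hb : b ∈ l.getLast?) : dist a b ≤ pathLength l := by
  induction l generalizing a with
  | nil => simp at ha
  | cons c l ih =>
    simp only [List.head?_cons, Option.mem_def, Option.some.injEq] at ha
    subst ha
    cases l with
    | nil => simp at hb; simp [hb]
    | cons e l =>
      rw [List.getLast?_cons_cons] at hb
      rw [pathLength_cons_cons]
      linarith [ih (a := e) (by simp) hb, dist_triangle c e b]

lemma pathLength_add_le {X : Type*} [PseudoMetricSpace X] (l₁ l₂ : List X) :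
    pathLength l₁ + pathLength l₂ ≤ pathLength (l₁ ++ l₂) := by
  induction l₁ with
  | nil => simp [pathLength]
  | cons a l ih =>
    cases l with
    | nil =>
      cases l₂ with
      | nil => simp [pathLength]
      | cons b l => simp
    | cons b l => simp only [List.cons_append, pathLength_cons_cons] at ih ⊢; linarith

/-- The points of a layer in the order of the tour. -/
noncomputable def layerList (d q i : ℕ) : List Plane :=
  (List.range (layerSteps d q i + 1)).map fun j =>
    layerPoint d q i (if Even i then j else layerSteps d q i - j)

/-- The points of the first `m` layers in the order of the tour. -/
noncomputable def layersList (d q m : ℕ) : List Plane :=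
  (List.range m).flatMap (layerList d q)

section LayeredTour

open Finset

variable {d q : ℕ}

lemma layersList_succ (m : ℕ) : layersList d q (m + 1) = layersList d q m ++ layerList d q m := by
  simp [layersList, List.range_succ]

lemma mem_layerList {i : ℕ} {p : Plane} :
    p ∈ layerList d q i ↔ ∃ j ≤ layerSteps d q i, layerPoint d q i j = p := by
  simp only [layerList, List.mem_map, List.mem_range, Nat.lt_succ_iff]
  split_ifs with h
  · rfl
  · constructor
    · rintro ⟨j, -, rfl⟩
      exact ⟨_, Nat.sub_le _ _, rfl⟩
    · rintro ⟨j, hj, rfl⟩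
      exact ⟨layerSteps d q i - j, Nat.sub_le _ _, by rw [Nat.sub_sub_self hj]⟩

lemma mem_layersList {m : ℕ} {p : Plane} :
    p ∈ layersList d q m ↔ ∃ i < m, ∃ j ≤ layerSteps d q i, layerPoint d q i j = p := by
  simp only [layersList, List.mem_flatMap, List.mem_range, mem_layerList]

lemma head?_layerList (i : ℕ) : (layerList d q i).head? =
    some (layerPoint d q i (if Even i then 0 else layerSteps d q i)) := by
  simp [layerList, List.range_succ_eq_map]

lemma getLast?_layerList (i : ℕ) : (layerList d q i).getLast? =
    some (layerPoint d q i (if Even i then layerSteps d q i else 0)) := by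
  simp [layerList, List.range_succ]

lemma layerPoint_injective (hd : 5 ≤ d) (hq : 2 * d ^ d ≤ q) (i : ℕ) :
    Function.Injective (layerPoint d q i) := by
  intro j k h
  have := congrArg (fun p : Plane => p 0) h
  simp only [layerPoint_zero, add_right_inj, mul_eq_mul_right_iff,
    (layerGap_pos hd hq i).ne', or_false, Nat.cast_inj] at this
  exact this

lemma nodup_layersList (hd : 5 ≤ d) (hq : 2 * d ^ d ≤ q) (m : ℕ) : (layersList d q m).Nodup := by
  induction m with
  | zero => simp [layersList]
  | succ m ih =>
    rw [layersList_succ, List.nodup_append']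
    refine ⟨ih, ?_, ?_⟩
    · refine List.Nodup.map_on ?_ List.nodup_range
      intro j hj k hk h
      rw [List.mem_range] at hj hk
      have := layerPoint_injective hd hq m h
      split_ifs at this <;> omega
    · intro p hp hp'
      obtain ⟨i, hi, j, -, rfl⟩ := mem_layersList.1 hp
      obtain ⟨k, -, hk⟩ := mem_layerList.1 hp'
      have := congrArg (fun p : Plane => p 1) hk
      simp only [layerPoint_one] at this
      linarith [five_mul_layerHeight hd hi, layerHeight_pos hd m]

lemma length_layersList (m : ℕ) :
    (layersList d q m).length = ∑ i ∈ range m, (layerSteps d q i + 1) := by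
  induction m with
  | zero => simp [layersList]
  | succ m ih =>
    rw [layersList_succ, List.length_append, ih, sum_range_succ]
    simp [layerList]

lemma layerPoint_last (hd : 5 ≤ d) (hq : 2 * d ^ d ≤ q) (i : ℕ) :
    layerPoint d q i (layerSteps d q i) 0 = 1 := by
  have : (layerSteps d q i : ℝ) ≠ 0 := by exact_mod_cast (layerSteps_pos hd hq i).ne'
  rw [layerPoint_zero, layerGap, mul_div_cancel₀ _ this]
  ring

lemma le_layerPoint (hd : 5 ≤ d) (hq : 2 * d ^ d ≤ q) (i j : ℕ) :
    layerLeft d i ≤ layerPoint d q i j 0 := by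
  rw [layerPoint_zero]
  have := layerGap_pos hd hq i
  linarith [mul_nonneg (Nat.cast_nonneg (α := ℝ) j) this.le]

lemma layerPoint_le (hd : 5 ≤ d) (hq : 2 * d ^ d ≤ q) {i j : ℕ} (hj : j ≤ layerSteps d q i) :
    layerPoint d q i j 0 ≤ 1 := by
  rw [← layerPoint_last hd hq i, layerPoint_zero, layerPoint_zero]
  have gap_pos := layerGap_pos hd hq i
  have cast_le : (j : ℝ) ≤ layerSteps d q i := by exact_mod_cast hj
  nlinarith

lemma isLayerEdge_layerPoint (hd : 5 ≤ d) (hq : 2 * d ^ d ≤ q) {i j : ℕ} (hi : i ≤ d)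
    (hj : j < layerSteps d q i) :
    IsLayerEdge d q i (layerPoint d q i (if Even i then j else layerSteps d q i - j))
      (layerPoint d q i (if Even i then j + 1 else layerSteps d q i - (j + 1))) where
  le := hi
  height_fst := layerPoint_one ..
  height_snd := layerPoint_one ..
  left_le_fst := le_layerPoint hd hq _ _
  left_le_snd := le_layerPoint hd hq _ _
  fst_le_one := layerPoint_le hd hq (by split_ifs <;> omega)
  snd_le_one := layerPoint_le hd hq (by split_ifs <;> omega)
  even he := by
    simp only [if_pos he, layerPoint_zero]
    push_cast
    ring
  odd ho := by
    have steps_sub : layerSteps d q i - j = (layerSteps d q i - (j + 1)) + 1 := by omega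
    simp only [if_neg (Nat.not_even_iff_odd.2 ho)]
    rw [steps_sub, layerPoint_zero, layerPoint_zero]
    push_cast
    ring
  grid := ⟨_, layerPoint_zero d q i _⟩

lemma isChain_layerList (hd : 5 ≤ d) (hq : 2 * d ^ d ≤ q) {i : ℕ} (hi : i ≤ d) :
    List.IsChain (IsLayeredEdge d q) (layerList d q i) := by
  rw [layerList, List.isChain_map, List.isChain_range_succ]
  exact fun j hj => Or.inl ⟨i, isLayerEdge_layerPoint hd hq hi hj⟩

lemma layerPoint_first {i : ℕ} (hi : 0 < i) (hid : i < d) : layerPoint d q i 0 0 = 0 := by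
  rw [layerPoint_zero, layerLeft_eq_zero hi hid]
  simp

lemma isConnector_layerPoint (hdo : Odd d) (hd : 5 ≤ d) (hq : 2 * d ^ d ≤ q) {i : ℕ} (hi : i < d) :
    IsConnector d i (layerPoint d q i (if Even i then layerSteps d q i else 0))
      (layerPoint d q (i + 1) (if Even (i + 1) then 0 else layerSteps d q (i + 1))) where
  lt := hi
  height_fst := layerPoint_one ..
  height_snd := layerPoint_one ..
  vertical := by
    rcases Nat.even_or_odd i with he | ho
    · rw [if_pos he, if_neg (Nat.not_even_iff_odd.2 he.add_one), layerPoint_last hd hq,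
        layerPoint_last hd hq]
    · have hid : i + 1 < d := by grind
      rw [if_neg (Nat.not_even_iff_odd.2 ho), if_pos ho.add_one, layerPoint_first ho.pos hi,
        layerPoint_first (Nat.succ_pos i) hid]
  even he := by rw [if_pos he, layerPoint_last hd hq]
  odd ho := by rw [if_neg (Nat.not_even_iff_odd.2 ho), layerPoint_first ho.pos hi]

lemma isClosingEdge_layerPoint (d q : ℕ) :
    IsClosingEdge d (layerPoint d q d 0) (layerPoint d q 0 0) where
  height_fst := layerPoint_one ..
  height_snd := layerPoint_one ..
  vertical := by simp [layerLeft]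
  left := by simp [layerLeft]

lemma getLast?_layersList_succ (m : ℕ) : (layersList d q (m + 1)).getLast? =
    some (layerPoint d q m (if Even m then layerSteps d q m else 0)) := by
  rw [layersList_succ, List.getLast?_append, getLast?_layerList, Option.some_or]

lemma isChain_layersList (hdo : Odd d) (hd : 5 ≤ d) (hq : 2 * d ^ d ≤ q) {m : ℕ} (hm : m ≤ d + 1) :
    List.IsChain (IsLayeredEdge d q) (layersList d q m) := by
  induction m with
  | zero => simp [layersList]
  | succ m ih =>
    rw [layersList_succ, List.isChain_append]
    refine ⟨ih (by omega), isChain_layerList hd hq (by omega), fun x hx y hy => ?_⟩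
    cases m with
    | zero => simp [layersList] at hx
    | succ i =>
      rw [getLast?_layersList_succ, Option.mem_some_iff] at hx
      rw [head?_layerList, Option.mem_some_iff] at hy
      subst hx hy
      exact Or.inr (Or.inl ⟨i, isConnector_layerPoint hdo hd hq (by omega)⟩)

lemma isChain_layersList_append (hdo : Odd d) (hd : 5 ≤ d) (hq : 2 * d ^ d ≤ q) :
    List.IsChain (IsLayeredEdge d q) (layersList d q (d + 1) ++ [layerPoint d q 0 0]) := by
  rw [List.isChain_append]
  refine ⟨isChain_layersList hdo hd hq le_rfl, List.isChain_singleton _, fun x hx y hy => ?_⟩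
  rw [getLast?_layersList_succ, if_neg (Nat.not_even_iff_odd.2 hdo), Option.mem_some_iff] at hx
  rw [List.head?_singleton, Option.mem_some_iff] at hy
  subst hx hy
  exact Or.inr (Or.inr (isClosingEdge_layerPoint d q))

lemma exists_layersList_eq_cons (d q m : ℕ) :
    ∃ l, layersList d q (m + 1) = layerPoint d q 0 0 :: l := by
  rw [← List.head?_eq_some_iff]
  induction m with
  | zero => simp [layersList, head?_layerList]
  | succ m ih => rw [layersList_succ, List.head?_append, ih, Option.some_or]

lemma one_le_pathLength_layerList (hd : 5 ≤ d) (hq : 2 * d ^ d ≤ q) (i : ℕ) :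
    1 ≤ pathLength (layerList d q i) := by
  have one_le_dist : 1 ≤ dist (layerPoint d q i 0) (layerPoint d q i (layerSteps d q i)) := by
    refine le_trans ?_ (sub_le_plane_dist_symm _ _ 0)
    rw [layerPoint_last hd hq, layerPoint_zero, Nat.cast_zero]
    linarith [layerLeft_le d i]
  have dist_le := dist_head_last_le_pathLength (head?_layerList (d := d) (q := q) i)
    (getLast?_layerList i)
  split_ifs at dist_le
  · exact one_le_dist.trans dist_le
  · exact one_le_dist.trans ((dist_comm _ _).trans_le dist_le)

lemma le_pathLength_layersList (hd : 5 ≤ d) (hq : 2 * d ^ d ≤ q) (m : ℕ) :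
    (m : ℝ) ≤ pathLength (layersList d q m) := by
  induction m with
  | zero => simp [layersList, pathLength]
  | succ m ih =>
    rw [layersList_succ]
    have length_add_le := pathLength_add_le (layersList d q m) (layerList d q m)
    push_cast
    linarith [one_le_pathLength_layerList hd hq m]

lemma exists_isTwoOptimal_and_le_length (hdo : Odd d) (hd : 5 ≤ d) (hq : 2 * d ^ d ≤ q) :
    ∃ V : Finset Plane, #V = ∑ i ∈ range (d + 1), (layerSteps d q i + 1) ∧
      (∀ p, p ∈ V ↔ p ∈ layersList d q (d + 1)) ∧
      ∃ σ : Equiv.Perm V, IsTwoOptimal σ ∧ (d : ℝ) ≤ length σ := by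
  classical
  have hnd := nodup_layersList hd hq (d + 1)
  have hchain := isChain_layersList_append hdo hd hq
  have length_ge := le_pathLength_layersList hd hq (d + 1)
  have hcard :
      #(layersList d q (d + 1)).toFinset = ∑ i ∈ range (d + 1), (layerSteps d q i + 1) := by
    rw [List.toFinset_card_of_nodup hnd, length_layersList]
  have three_le : 3 ≤ #(layersList d q (d + 1)).toFinset := by
    rw [hcard, sum_add_distrib, sum_const, card_range, smul_eq_mul]
    omega
  refine ⟨_, hcard, fun p => List.mem_toFinset, ?_⟩
  obtain ⟨l, hl⟩ := exists_layersList_eq_cons d q d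
  rw [hl] at hchain hnd
  obtain ⟨σ, hσ, hedge, hlength⟩ := exists_isTour_of_isChain three_le hnd
    (fun x => by rw [List.mem_toFinset, hl]) hchain
  refine ⟨σ, ⟨hσ, fun a x hax => ?_⟩, ?_⟩
  · exact (hedge a).dist_add_dist_le hdo hd hq (hedge x) fun h => hax (Subtype.ext h)
  · rw [hlength, ← hl]
    have length_add_le := pathLength_add_le (layersList d q (d + 1)) [layerPoint d q 0 0]
    rw [pathLength_singleton] at length_add_le
    push_cast at length_ge
    linarith

lemma layerSteps_last (d q : ℕ) : layerSteps d q d = q := by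
  simp [layerSteps]

lemma layerLeft_last (d : ℕ) : layerLeft d d = -1 := by
  simp [layerLeft]

lemma mul_layerGap_last (hd : 5 ≤ d) (hq : 2 * d ^ d ≤ q) : q * layerGap d q d = 2 := by
  have last_eq := layerPoint_last hd hq d
  rw [layerPoint_zero, layerLeft_last, layerSteps_last] at last_eq
  linarith

lemma plane_dist_le (a b : Plane) : dist a b ≤ |a 0 - b 0| + |a 1 - b 1| := by
  refine (le_abs_self _).trans (abs_le_of_sq_le_sq ?_ (by positivity))
  rw [plane_dist_sq, ← sq_abs (a 0 - b 0), ← sq_abs (a 1 - b 1)]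
  nlinarith [abs_nonneg (a 0 - b 0), abs_nonneg (a 1 - b 1)]

lemma exists_layerPoint_near (hd : 5 ≤ d) (hq : 2 * d ^ d ≤ q) {p : Plane} (hp : -1 ≤ p 0)
    (hp' : p 0 ≤ 1) :
    ∃ j ≤ q, dist (layerPoint d q d j) p ≤ layerGap d q d + |layerHeight d d - p 1| := by
  have gap_pos := layerGap_pos hd hq d
  have mul_gap := mul_layerGap_last hd hq
  have quotient_nonneg : 0 ≤ (p 0 + 1) / layerGap d q d := div_nonneg (by linarith) gap_pos.le
  set j := ⌊(p 0 + 1) / layerGap d q d⌋₊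
  have floor_mul_le : j * layerGap d q d ≤ p 0 + 1 :=
    (le_div_iff₀ gap_pos).1 (Nat.floor_le quotient_nonneg)
  have le_floor_add_one_mul : p 0 + 1 ≤ (j + 1) * layerGap d q d :=
    (div_le_iff₀ gap_pos).1 (Nat.lt_floor_add_one _).le
  refine ⟨j, ?_, ?_⟩
  · have : (j : ℝ) ≤ q := by
      by_contra! hlt
      nlinarith
    exact_mod_cast this
  · refine (plane_dist_le _ _).trans (add_le_add ?_ (by rw [layerPoint_one]))
    rw [layerPoint_zero, layerLeft_last, abs_le]
    constructor <;> linarith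

lemma hasClosedWalk_image_Iic {X : Type*} [PseudoMetricSpace X] (t : ℕ → X) (m : ℕ) :
    HasClosedWalk (t '' Set.Iic m) (t 0)
      (∑ k ∈ range m, dist (t k) (t (k + 1)) + dist (t m) (t 0)) := by
  have list_eq : t 0 :: (List.range m).map (fun j => t (j + 1)) = (List.range (m + 1)).map t := by
    rw [List.range_succ_eq_map, List.map_cons, List.map_map]
    rfl
  refine ⟨(List.range m).map fun j => t (j + 1), fun x => ?_, ?_⟩
  · simp [list_eq]
  · rw [list_eq, ← pathLength_map_range, List.range_succ, List.map_append, List.map_singleton,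
      List.append_assoc, List.singleton_append, pathLength_append]
    simp

lemma dist_layerPoint_last (hd : 5 ≤ d) (hq : 2 * d ^ d ≤ q) (j k : ℕ) :
    dist (layerPoint d q d j) (layerPoint d q d k) = |(j : ℝ) - k| * layerGap d q d := by
  rw [plane_dist_of_snd_eq (by simp), layerPoint_zero, layerPoint_zero,
    ← abs_of_pos (layerGap_pos hd hq d), ← abs_mul, abs_of_pos (layerGap_pos hd hq d)]
  ring_nf

lemma hasClosedWalk_layerList_last (hd : 5 ≤ d) (hq : 2 * d ^ d ≤ q) :
    HasClosedWalk {p | p ∈ layerList d q d} (layerPoint d q d 0) 4 := by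
  have points_eq : {p | p ∈ layerList d q d} = layerPoint d q d '' Set.Iic q := by
    ext p
    simp only [Set.mem_ofPred_eq, mem_layerList, layerSteps_last, Set.mem_image, Set.mem_Iic]
  rw [points_eq]
  refine (hasClosedWalk_image_Iic _ q).mono ?_
  have abs_succ (k : ℕ) : |(k : ℝ) - ((k + 1 : ℕ) : ℝ)| = 1 := by simp
  simp only [dist_layerPoint_last hd hq, abs_succ, one_mul, sum_const, card_range, nsmul_eq_mul]
  rw [Nat.cast_zero, sub_zero, Nat.abs_cast, mul_layerGap_last hd hq]
  norm_num

lemma two_mul_mul_layerSteps_le (hd : 5 ≤ d) (hq : 2 * d ^ d ≤ q) {m : ℕ} (hm : m < d) :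
    2 * (layerGap d q d + layerHeight d m) * ((layerSteps d q m + 1 : ℕ) : ℝ) ≤ 12 / d := by
  have gap_le : 2 * layerGap d q d ≤ layerHeight d m := by
    obtain ⟨e, rfl⟩ : ∃ e, d = e + 1 := ⟨d - 1, by omega⟩
    linarith [layerGap_le hd hq (Nat.lt_succ_self e),
      layerHeight_anti hd (show m ≤ e by omega)]
  have steps_le : ((layerSteps d q m + 1 : ℕ) : ℝ) ≤ 2 * (d : ℝ) ^ m := by
    have pow_pos : 0 < d ^ m := by positivity
    have : layerSteps d q m + 1 ≤ 2 * d ^ m := by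
      rw [layerSteps, if_pos hm]
      omega
    exact_mod_cast this
  have height_pos := layerHeight_pos hd m
  calc 2 * (layerGap d q d + layerHeight d m) * ((layerSteps d q m + 1 : ℕ) : ℝ)
      ≤ (3 * layerHeight d m) * (2 * (d : ℝ) ^ m) :=
        mul_le_mul (by linarith) steps_le (by positivity) (by positivity)
    _ = 12 / d := by
      unfold layerHeight
      field_simp
      ring

lemma exists_layerPoint_last_near (hd : 5 ≤ d) (hq : 2 * d ^ d ≤ q) {m j : ℕ} (hm : m < d)
    (hj : j ≤ layerSteps d q m) :
    ∃ p ∈ layerList d q d, dist p (layerPoint d q m j) ≤ layerGap d q d + layerHeight d m := by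
  have neg_one_le : -1 ≤ layerLeft d m := by unfold layerLeft; split_ifs <;> norm_num
  obtain ⟨k, hk, hdist⟩ := exists_layerPoint_near hd hq
    (neg_one_le.trans (le_layerPoint hd hq m j)) (layerPoint_le hd hq hj)
  refine ⟨_, mem_layerList.2 ⟨k, by rwa [layerSteps_last], rfl⟩, hdist.trans ?_⟩
  have height_pos := layerHeight_pos hd d
  rw [layerPoint_one, abs_of_nonpos (sub_nonpos.2 (layerHeight_anti hd hm.le))]
  linarith

lemma hasClosedWalk_layersList_union (hd : 5 ≤ d) (hq : 2 * d ^ d ≤ q) {m : ℕ} (hm : m ≤ d) :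
    HasClosedWalk {p | p ∈ layersList d q m ∨ p ∈ layerList d q d} (layerPoint d q d 0)
      (4 + m * (12 / d)) := by
  induction m with
  | zero => simpa [layersList] using hasClosedWalk_layerList_last hd hq
  | succ m ih =>
    have with_next_layer := (ih (by omega)).union_image (range (layerSteps d q m + 1))
      (layerPoint d q m) fun j hj =>
        (exists_layerPoint_last_near hd hq hm (Nat.lt_succ_iff.1 (mem_range.1 hj))).imp
          fun _ hp => ⟨Or.inr hp.1, hp.2⟩
    have points_eq : {p | p ∈ layersList d q m ∨ p ∈ layerList d q d} ∪
        layerPoint d q m '' (range (layerSteps d q m + 1) : Finset ℕ) =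
        {p | p ∈ layersList d q (m + 1) ∨ p ∈ layerList d q d} := by
      ext p
      simp only [layersList_succ, List.mem_append, Set.mem_union, Set.mem_ofPred_eq,
        Set.mem_image, coe_range, Set.mem_Iio, Nat.lt_succ_iff]
      rw [← mem_layerList]
      tauto
    rw [points_eq, card_range] at with_next_layer
    refine with_next_layer.mono ?_
    have increment_le := two_mul_mul_layerSteps_le hd hq hm
    push_cast at increment_le ⊢
    linarith

lemma hasClosedWalk_layersList (hd : 5 ≤ d) (hq : 2 * d ^ d ≤ q) :
    HasClosedWalk {p | p ∈ layersList d q (d + 1)} (layerPoint d q d 0) 16 := by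
  have d_ne_zero : (d : ℝ) ≠ 0 := by exact_mod_cast (by omega : d ≠ 0)
  have points_eq : {p | p ∈ layersList d q (d + 1)} =
      {p | p ∈ layersList d q d ∨ p ∈ layerList d q d} := by
    simp only [layersList_succ, List.mem_append]
  rw [points_eq]
  refine (hasClosedWalk_layersList_union hd hq le_rfl).mono ?_
  rw [mul_div_cancel₀ _ d_ne_zero]
  norm_num

lemma sum_layerSteps_add_one (d q : ℕ) :
    ∑ i ∈ range (d + 1), (layerSteps d q i + 1) = ∑ i ∈ range d, d ^ i + d + (q + 1) := by
  rw [sum_range_succ, layerSteps_last, sum_add_distrib, sum_const, card_range, smul_eq_mul, mul_one]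
  congr 2
  exact sum_congr rfl fun i hi => if_pos (mem_range.1 hi)

lemma exists_sum_layerSteps_eq (hd : 5 ≤ d) {n : ℕ} (hn : 5 * d ^ d ≤ n) :
    ∃ q, 2 * d ^ d ≤ q ∧ ∑ i ∈ range (d + 1), (layerSteps d q i + 1) = n := by
  have geom_sum_lt : ∑ i ∈ range d, d ^ i < d ^ d :=
    Nat.geomSum_lt (by omega) fun i hi => mem_range.1 hi
  have le_pow : d ≤ d ^ d := Nat.le_self_pow (by omega) d
  refine ⟨n - (∑ i ∈ range d, d ^ i + d + 1), ?_, ?_⟩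
  · omega
  · rw [sum_layerSteps_add_one]
    omega

lemma exists_mem_twoOptRatios_ge (hdo : Odd d) (hd : 5 ≤ d) {n : ℕ} (hn : 5 * d ^ d ≤ n) :
    ∃ r ∈ twoOptRatios n, (d : ℝ) / 16 ≤ r := by
  obtain ⟨q, hq, hcard⟩ := exists_sum_layerSteps_eq hd hn
  obtain ⟨V, hVcard, hV, σ, hσ, le_length⟩ := exists_isTwoOptimal_and_le_length hdo hd hq
  have walk := hasClosedWalk_layersList hd hq
  rw [show {p | p ∈ layersList d q (d + 1)} = (V : Set Plane) from
    Set.ext fun p => (hV p).symm] at walk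
  obtain ⟨τ, hτ, length_le⟩ := walk.exists_isTour hσ.1.1
  obtain ⟨τ', hτ'⟩ := hτ.exists_isOptimalTour
  refine ⟨_, ⟨V, hVcard.trans hcard, σ, τ', hσ.isTwoOptOutput, hτ', rfl⟩, ?_⟩
  exact div_le_div₀ (d.cast_nonneg.trans le_length) le_length hτ'.1.length_pos
    ((hτ'.2 τ hτ).trans length_le)

end LayeredTour

section AsymptoticBounds

open Filter Asymptotics Real

lemma log_add_one_pow_four_add_one_le {x : ℝ} (hx : 4 ≤ x) :
    log ((x + 1) ^ 4 + 1) ≤ 8 * log x := by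
  have add_one_le : x + 1 ≤ x ^ 2 / 2 := by nlinarith
  have one_le_pow : 1 ≤ x ^ 8 / 2 := by
    have : (4 : ℝ) ^ 8 ≤ x ^ 8 := by gcongr
    linarith
  have pow_add_one_le : (x + 1) ^ 4 + 1 ≤ x ^ 8 :=
    calc (x + 1) ^ 4 + 1 ≤ (x ^ 2 / 2) ^ 4 + x ^ 8 / 2 := by gcongr
      _ = x ^ 8 * (9 / 16) := by ring
      _ ≤ x ^ 8 := by linarith
  calc log ((x + 1) ^ 4 + 1) ≤ log (x ^ 8) := log_le_log (by positivity) pow_add_one_le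
    _ = 8 * log x := by rw [log_pow]; norm_num

lemma sqrt_le_two_mul_div_log {x : ℝ} (hx : 1 < x) : √x ≤ 2 * (x / log x) := by
  have sqrt_pos : 0 < √x := sqrt_pos.2 (by linarith)
  have log_le : log x ≤ 2 * √x := by
    have log_sqrt_le := log_le_sub_one_of_pos sqrt_pos
    rw [log_sqrt (by linarith)] at log_sqrt_le
    linarith
  rw [← mul_div_assoc, le_div_iff₀ (log_pos hx)]
  calc √x * log x ≤ √x * (2 * √x) := mul_le_mul_of_nonneg_left log_le sqrt_pos.le
    _ = 2 * x := by rw [mul_left_comm, mul_self_sqrt (by linarith)]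

lemma twoOptApproxRatio_le {n : ℕ} (hn : 4 ≤ n) (hlog : 1 < log n) :
    twoOptApproxRatio n ≤ 280 * (log n / log (log n)) := by
  have loglog_pos : 0 < log (log n) := log_pos hlog
  have one_lt_sqrt : 1 < √(log n) := by rwa [lt_sqrt zero_le_one, one_pow]
  have log_poly_le := log_add_one_pow_four_add_one_le (x := n) (by exact_mod_cast hn)
  have quotient_le : (1 + 2 * log (((n : ℝ) + 1) ^ 4 + 1)) / log √(log n) ≤
      34 * (log n / log (log n)) := by
    rw [log_sqrt (by linarith), ← mul_div_assoc, div_le_div_iff₀ (by linarith) loglog_pos]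
    nlinarith
  refine csSup_le (twoOptRatios_nonempty (by omega)) fun r hr => ?_
  -- The parameter `K = √(log n)` makes both summands of the bound `O(log n / log log n)`.
  refine (le_of_mem_twoOptRatios hr one_lt_sqrt).trans ?_
  linarith [sqrt_le_two_mul_div_log hlog]

lemma log_five_le_two : log 5 ≤ 2 := by
  rw [log_le_iff_le_exp (by norm_num), show (2 : ℝ) = 1 + 1 by norm_num, exp_add]
  nlinarith [exp_one_gt_d9]

lemma exists_odd_mul_pow_le {n : ℕ} (hn : 0 < n) (hloglog : 1 ≤ log (log n))
    (hlog : 8 * log (log n) ≤ log n) :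
    ∃ d : ℕ, Odd d ∧ 5 ≤ d ∧ 5 * d ^ d ≤ n ∧ log n / log (log n) / 4 ≤ d := by
  set x := log n / log (log n) with hx
  have eight_le : 8 ≤ x := by rwa [hx, le_div_iff₀ (by linarith)]
  have le_log : x ≤ log n := div_le_self (by linarith) hloglog
  have mul_loglog : x * log (log n) = log n := div_mul_cancel₀ _ (by linarith)
  have floor_le : (⌊x / 4⌋₊ : ℝ) ≤ x / 4 := Nat.floor_le (by linarith)
  have lt_floor := Nat.lt_floor_add_one (x / 4)
  have two_le_floor : 2 ≤ ⌊x / 4⌋₊ := Nat.le_floor (by push_cast; linarith)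
  obtain ⟨d, hd⟩ : ∃ d, d = 2 * ⌊x / 4⌋₊ + 1 := ⟨_, rfl⟩
  have cast_d : (d : ℝ) = 2 * ⌊x / 4⌋₊ + 1 := by rw [hd]; push_cast; ring
  have five_le : 5 ≤ d := by omega
  have d_pos : (0 : ℝ) < d := by exact_mod_cast (by omega : 0 < d)
  have log_d_le : log d ≤ log (log n) := log_le_log d_pos (by linarith)
  have mul_log_le : (d : ℝ) * log d ≤ (x / 2 + 1) * log (log n) :=
    mul_le_mul (by linarith) log_d_le (log_natCast_nonneg d) (by linarith)
  have size_le : (5 : ℝ) * (d : ℝ) ^ d ≤ n := by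
    rw [← log_le_log_iff (by positivity) (by exact_mod_cast hn),
      log_mul (by norm_num) (by positivity), log_pow]
    linarith [log_five_le_two]
  exact ⟨d, ⟨_, hd⟩, five_le, by exact_mod_cast size_le, by linarith⟩

lemma le_twoOptApproxRatio {n : ℕ} (hn : 0 < n) (hloglog : 1 ≤ log (log n))
    (hlog : 8 * log (log n) ≤ log n) :
    log n / log (log n) / 64 ≤ twoOptApproxRatio n := by
  obtain ⟨d, hdo, hd, hsize, le_d⟩ := exists_odd_mul_pow_le hn hloglog hlog
  obtain ⟨r, hr, le_r⟩ := exists_mem_twoOptRatios_ge hdo hd hsize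
  calc log n / log (log n) / 64 ≤ d / 16 := by linarith
    _ ≤ r := le_r
    _ ≤ twoOptApproxRatio n := le_csSup (bddAbove_twoOptRatios n) hr

lemma eventually_twoOptApproxRatio_bounds : ∀ᶠ n : ℕ in atTop,
    0 ≤ log n / log (log n) ∧ log n / log (log n) / 64 ≤ twoOptApproxRatio n ∧
      twoOptApproxRatio n ≤ 280 * (log n / log (log n)) := by
  have tendsto_log : Tendsto (fun n : ℕ => log (n : ℝ)) atTop atTop :=
    tendsto_log_atTop.comp tendsto_natCast_atTop_atTop
  have loglog_small := tendsto_log.eventually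
    (isLittleO_log_id_atTop.bound (show (0 : ℝ) < 1 / 8 by norm_num))
  filter_upwards [tendsto_log.eventually_gt_atTop 1,
    (tendsto_log_atTop.comp tendsto_log).eventually_ge_atTop 1, loglog_small,
    eventually_ge_atTop 4] with n one_lt_log one_le_loglog loglog_le four_le
  simp only [Function.comp_apply] at one_le_loglog
  rw [id, norm_of_nonneg (by linarith), norm_of_nonneg (by linarith)] at loglog_le
  exact ⟨div_nonneg (by linarith) (by linarith),
    le_twoOptApproxRatio (by omega) one_le_loglog (by linarith),
    twoOptApproxRatio_le four_le one_lt_log⟩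

lemma twoOptApproxRatio_isTheta :
    IsTheta atTop twoOptApproxRatio (fun n : ℕ => log (n : ℝ) / log (log (n : ℝ))) := by
  constructor
  · refine IsBigO.of_bound 280 ?_
    filter_upwards [eventually_twoOptApproxRatio_bounds] with n ⟨h_nonneg, le_ratio, ratio_le⟩
    rwa [norm_of_nonneg (by linarith), norm_of_nonneg h_nonneg]
  · refine IsBigO.of_bound 64 ?_
    filter_upwards [eventually_twoOptApproxRatio_bounds] with n ⟨quotient_nonneg, le_ratio, _⟩
    rw [norm_of_nonneg quotient_nonneg, norm_of_nonneg (by linarith)]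
    linarith

end AsymptoticBounds

end EuclideanTSP

theorem theorem1 :
    (∀ n : ℕ, 3 ≤ n → (EuclideanTSP.twoOptRatios n).Nonempty ∧
      BddAbove (EuclideanTSP.twoOptRatios n)) ∧
    Asymptotics.IsTheta Filter.atTop EuclideanTSP.twoOptApproxRatio
      (fun n : ℕ => Real.log (n : ℝ) / Real.log (Real.log (n : ℝ))) :=
  ⟨fun n hn => ⟨EuclideanTSP.twoOptRatios_nonempty hn, EuclideanTSP.bddAbove_twoOptRatios n⟩,
    EuclideanTSP.twoOptApproxRatio_isTheta⟩
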